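/- **Setting.** A static spacetime has metric $-\lambda\,dt^2+\lambda^{-1}h$, where $\xi=\partial_t$ is the static Killing vector, $\lambda=-\xi^a\xi_a>0$ and $h=\lambda g+\xi\otimes\xi$ is the induced Riemannian metric on the 3-manifold $V$ of trajectories of $\xi$. It is asymptotically flat: there are a smooth 3-manifold $\widetilde V=V\cup\{\Lambda\}$, with $\Lambda$ a single point, and a smooth function $\Omega$ on $\widetilde V$, positive on $V$, such that $\tilde h=\Omega^2h$ extends to a smooth Riemannian metric on $\widetilde V$ and, at $\Lambda$, $\Omega=0$, $\tilde D_a\Omega=0$, $\tilde D_a\tilde D_b\Omega=2\tilde h_{ab}$, where $\tilde D$ is the Levi-Civita connection of $\tilde h$. It is axisymmetric: there is a nontrivial smooth action of the circle group on $\widetilde V$ that fixes $\Lambda$ and preserves $\lambda$ and $h$. For a potential $\phi$ on $V$ such that $\tilde\phi=\phi/\sqrt\Omega$ extends smoothly to $\Lambda$, define tensor fields on $\widetilde V$ by $P=\tilde\phi$ and, for $n\ge1$, $$P_{a_1\ldots a_n}=C\Big[\tilde D_{a_1}P_{a_2\ldots a_n}-\tfrac{(n-1)(2n-3)}{2}\,\widetilde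 R_{a_1a_2}P_{a_3\ldots a_n}\Big]$$ (the second term is absent for $n=1$), where $\widetilde R_{ab}$ is the Ricci tensor of $\tilde h$ and $C[\,\cdot\,]$ denotes the totally symmetric and trace-free part with respect to $\tilde h$. The multipole moments produced by $\phi$ are the tensors $P_{a_1\ldots a_n}(\Lambda)$, $n=0,1,2,\ldots$. **Theorem.** Suppose that a static, axisymmetric, asymptotically flat spacetime as above satisfies the vacuum Einstein equations. Let $$\phi_H=\frac{1-\lambda^2}{4\lambda},\qquad \phi_G=\lambda^{-1/4}\,(1-\sqrt\lambda)$$ be the Hansen and the Geroch potential. Then $\phi_H/\sqrt\Omega$ extends smoothly to $\Lambda$ if and only if $\phi_G/\sqrt\Omega$ does, and in this case the two potentials produce the same multipole moments: for every $n\ge0$ the tensors $P_{a_1\ldots a_n}(\Lambda)$ obtained from $\phi_H$ and from $\phi_G$ are equal. -/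

import Mathlib

open scoped Manifold ContDiff

noncomputable section

namespace Multipole

/-! ### Tensor calculus in coordinates

Metrics on (open subsets of) `ℝ^ι` are given by their matrices of components; a covariant tensor
of rank `n` is given by its components, indexed by `Fin n → ι`. -/

section Coordinates

variable {ι : Type} [Fintype ι] [DecidableEq ι]

/-- The partial derivative `∂_i f` at `x`. -/
def pderiv (i : ι) (f : EuclideanSpace ℝ ι → ℝ) (x : EuclideanSpace ℝ ι) : ℝ :=
  fderiv ℝ f x (EuclideanSpace.single i 1)

/-- The Christoffel symbols `Γ^k_{ij}` of the Levi-Civita connection of `g`. -/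
def christoffel (g : EuclideanSpace ℝ ι → Matrix ι ι ℝ) (k i j : ι)
    (x : EuclideanSpace ℝ ι) : ℝ :=
  (1 / 2) * ∑ l, (g x)⁻¹ k l *
    (pderiv i (fun y => g y j l) x + pderiv j (fun y => g y i l) x - pderiv l (fun y => g y i j) x)

/-- The Ricci tensor
`R_{ij} = ∂_k Γ^k_{ij} - ∂_j Γ^k_{ik} + Γ^k_{kl} Γ^l_{ij} - Γ^k_{jl} Γ^l_{ik}`. -/
def ricci (g : EuclideanSpace ℝ ι → Matrix ι ι ℝ) (x : EuclideanSpace ℝ ι) (i j : ι) : ℝ :=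
  ∑ k, (pderiv k (christoffel g k i j) x - pderiv j (christoffel g k i k) x) +
    ∑ k, ∑ l, (christoffel g k k l x * christoffel g l i j x -
      christoffel g k j l x * christoffel g l i k x)

/-- The covariant derivative `D_{a_0} T_{a_1 … a_n}` of a covariant tensor field; the
differentiation index comes first. -/
def covDeriv (g : EuclideanSpace ℝ ι → Matrix ι ι ℝ) {n : ℕ}
    (T : EuclideanSpace ℝ ι → (Fin n → ι) → ℝ) (x : EuclideanSpace ℝ ι)
    (I : Fin (n + 1) → ι) : ℝ :=
  pderiv (I 0) (fun y => T y (Fin.tail I)) x -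
    ∑ k : Fin n, ∑ c, christoffel g c (I 0) (Fin.tail I k) x *
      T x (Function.update (Fin.tail I) k c)

/-- Total symmetry and vanishing of all traces with respect to the metric `H`. -/
structure IsSTF (H : Matrix ι ι ℝ) {n : ℕ} (T : (Fin n → ι) → ℝ) : Prop where
  symm : ∀ (σ : Equiv.Perm (Fin n)) (I : Fin n → ι), T (I ∘ σ) = T I
  traceFree : ∀ k l : Fin n, k ≠ l → ∀ I : Fin n → ι,
    ∑ a, ∑ b, H⁻¹ a b * T (Function.update (Function.update I k a) l b) = 0

/-- The inner product `H^{a_1 b_1} ⋯ H^{a_n b_n} S_{a_1 … a_n} T_{b_1 … b_n}` of tensors. -/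
def tensorInner (H : Matrix ι ι ℝ) {n : ℕ} (S T : (Fin n → ι) → ℝ) : ℝ :=
  ∑ I : Fin n → ι, ∑ J : Fin n → ι, (∏ k, H⁻¹ (I k) (J k)) * S I * T J

/-- `S` is the totally symmetric and trace-free part of `T`, that is, the orthogonal projection
of `T` to the space of totally symmetric trace-free tensors. -/
def IsSTFPart (H : Matrix ι ι ℝ) {n : ℕ} (T S : (Fin n → ι) → ℝ) : Prop :=
  IsSTF H S ∧ ∀ X, IsSTF H X → tensorInner H (T - S) X = 0

theorem isSTF_zero (H : Matrix ι ι ℝ) (n : ℕ) : IsSTF H (0 : (Fin n → ι) → ℝ) :=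
  ⟨fun _ _ => rfl, fun _ _ _ _ => by simp⟩

/-- The totally symmetric trace-free tensors form a linear space. -/
def stfSubmodule (H : Matrix ι ι ℝ) (n : ℕ) : Submodule ℝ ((Fin n → ι) → ℝ) where
  carrier := {T | IsSTF H T}
  zero_mem' := isSTF_zero H n
  add_mem' := fun {S T} hS hT =>
    ⟨fun σ I => by simp [hS.symm σ I, hT.symm σ I], fun k l hkl I => by
      simp [mul_add, Finset.sum_add_distrib, hS.traceFree k l hkl I, hT.traceFree k l hkl I]⟩
  smul_mem' := fun c T hT =>
    ⟨fun σ I => by simp [hT.symm σ I], fun k l hkl I => by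
      have h := hT.traceFree k l hkl I
      simp only [Pi.smul_apply, smul_eq_mul, mul_left_comm _ c, ← Finset.mul_sum, h, mul_zero]⟩

open scoped MatrixOrder Matrix.Norms.L2Operator in
theorem eq_zero_of_tensorInner_self_nonpos {H : Matrix ι ι ℝ} (hH : H.PosDef) {n : ℕ}
    {T : (Fin n → ι) → ℝ} (hT : tensorInner H T T ≤ 0) : T = 0 := by
  obtain ⟨B, hB, hBH⟩ : ∃ B : Matrix ι ι ℝ, IsUnit B ∧ H⁻¹ = B.transpose * B := by
    obtain ⟨B, hB, h⟩ := CStarAlgebra.isStrictlyPositive_iff_eq_star_mul_self.mp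
      hH.inv.isStrictlyPositive
    exact ⟨B, hB, by rw [h, Matrix.star_eq_conjTranspose, Matrix.conjTranspose_eq_transpose_of_trivial]⟩
  have key : tensorInner H T T = ∑ K : Fin n → ι, (∑ I, (∏ k, B (K k) (I k)) * T I) ^ 2 := by
    have e1 : ∀ I J : Fin n → ι, (∏ k, H⁻¹ (I k) (J k)) =
        ∑ K : Fin n → ι, (∏ k, B (K k) (I k)) * ∏ k, B (K k) (J k) := by
      intro I J
      simp only [hBH, Matrix.mul_apply, Matrix.transpose_apply, ← Finset.prod_mul_distrib]
      rw [Finset.prod_univ_sum, Fintype.piFinset_univ]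
    simp only [tensorInner, e1, sq, Finset.sum_mul]
    conv_lhs => enter [2, I]; rw [Finset.sum_comm]
    rw [Finset.sum_comm]
    refine Finset.sum_congr rfl fun K _ => Finset.sum_congr rfl fun I _ => ?_
    rw [Finset.mul_sum]
    exact Finset.sum_congr rfl fun J _ => by ring
  have hz : ∀ K : Fin n → ι, ∑ I, (∏ k, B (K k) (I k)) * T I = 0 := by
    have h0 := (Finset.sum_eq_zero_iff_of_nonneg
      (fun (K : Fin n → ι) _ => sq_nonneg (∑ I, (∏ k, B (K k) (I k)) * T I))).mp
      (le_antisymm (key ▸ hT) (Finset.sum_nonneg fun _ _ => sq_nonneg _))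
    intro K
    exact pow_eq_zero_iff two_ne_zero |>.mp (h0 K (Finset.mem_univ K))
  have hinv : B⁻¹ * B = 1 := Matrix.nonsing_inv_mul B ((Matrix.isUnit_iff_isUnit_det B).mp hB)
  funext J
  have e2 : ∀ I : Fin n → ι, ∑ K : Fin n → ι, (∏ k, B⁻¹ (J k) (K k)) * ∏ k, B (K k) (I k) =
      if J = I then 1 else 0 := by
    intro I
    have h1 : ∏ k, (B⁻¹ * B) (J k) (I k) =
        ∑ K : Fin n → ι, (∏ k, B⁻¹ (J k) (K k)) * ∏ k, B (K k) (I k) := by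
      simp only [Matrix.mul_apply, ← Finset.prod_mul_distrib]
      rw [Finset.prod_univ_sum, Fintype.piFinset_univ]
    rw [← h1, hinv]
    simp only [Matrix.one_apply, Finset.prod_ite_zero, Finset.prod_const_one, Finset.mem_univ,
      true_implies, funext_iff]
  have h2 : ∑ K : Fin n → ι, (∏ k, B⁻¹ (J k) (K k)) * ∑ I, (∏ k, B (K k) (I k)) * T I = T J := by
    simp only [Finset.mul_sum, ← mul_assoc]
    rw [Finset.sum_comm]
    simp only [← Finset.sum_mul, e2, ite_mul, one_mul, zero_mul, Finset.sum_ite_eq,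
      Finset.mem_univ, if_true]
  rw [← h2]
  simp [hz]

/-- For a positive definite metric the totally symmetric and trace-free part exists and is
unique. -/
theorem existsUnique_isSTFPart {H : Matrix ι ι ℝ} (hH : H.PosDef) {n : ℕ}
    (T : (Fin n → ι) → ℝ) : ∃! S, IsSTFPart H T S := by
  let F : ((Fin n → ι) → ℝ) →ₗ[ℝ] Module.Dual ℝ (stfSubmodule H n) :=
    LinearMap.mk₂ ℝ (fun S (X : stfSubmodule H n) => tensorInner H S X)
      (fun S S' X => by simp [tensorInner, mul_add, add_mul, Finset.sum_add_distrib])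
      (fun c S X => by
        simp only [tensorInner, Pi.smul_apply, smul_eq_mul, Finset.mul_sum]
        exact Finset.sum_congr rfl fun _ _ => Finset.sum_congr rfl fun _ _ => by ring)
      (fun S X X' => by simp [tensorInner, mul_add, Finset.sum_add_distrib])
      (fun c S X => by
        simp only [tensorInner, Submodule.coe_smul, Pi.smul_apply, smul_eq_mul, Finset.mul_sum]
        exact Finset.sum_congr rfl fun _ _ => Finset.sum_congr rfl fun _ _ => by ring)
  have hF : ∀ S (X : stfSubmodule H n), F S X = tensorInner H S X := fun _ _ => rfl
  have hinj : Function.Injective (F.comp (stfSubmodule H n).subtype) := by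
    rw [← LinearMap.ker_eq_bot, LinearMap.ker_eq_bot']
    intro X hX
    have h := LinearMap.congr_fun hX X
    exact Subtype.ext (eq_zero_of_tensorInner_self_nonpos hH (le_of_eq h))
  have hsurj := (LinearMap.injective_iff_surjective_of_finrank_eq_finrank
    (Subspace.dual_finrank_eq (K := ℝ) (V := stfSubmodule H n)).symm).mp hinj
  have hiff : ∀ S : stfSubmodule H n, IsSTFPart H T S ↔
      F.comp (stfSubmodule H n).subtype S = F T := by
    intro S
    have hsub : ∀ X : stfSubmodule H n,
        tensorInner H (T - (S : (Fin n → ι) → ℝ)) X = F T X - F S X := fun X => by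
      rw [← hF, map_sub, LinearMap.sub_apply]
    constructor
    · intro h
      ext X
      have := h.2 X X.2
      rw [hsub] at this
      exact (sub_eq_zero.mp this).symm
    · intro h
      refine ⟨S.2, fun X hX => ?_⟩
      rw [hsub ⟨X, hX⟩, ← h]
      exact sub_self _
  obtain ⟨S, hS⟩ := hsurj (F T)
  refine ⟨S, (hiff S).mpr hS, fun S' hS' => ?_⟩
  have := (hiff ⟨S', hS'.1⟩).mp hS'
  exact congrArg Subtype.val (hinj (this.trans hS.symm))

open Classical in
/-- `C[T]`, the totally symmetric and trace-free part of `T`. By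
`existsUnique_isSTFPart` it is characterized by `IsSTFPart`; the value `0` in the other case is
never used for a (positive definite) metric. -/
def stfPart (H : Matrix ι ι ℝ) {n : ℕ} (T : (Fin n → ι) → ℝ) : (Fin n → ι) → ℝ :=
  if h : ∃ S, IsSTFPart H T S then h.choose else 0

/-- The Geroch–Hansen recursion: `P = φ`, `P_a = C[D_a P]` and
`P_{a_1 … a_n} = C[D_{a_1} P_{a_2 … a_n} - ((n-1)(2n-3)/2) R_{a_1 a_2} P_{a_3 … a_n}]`
for `n ≥ 2` (written below with `n + 2` in place of `n`). -/
def multipoleTensor (g : EuclideanSpace ℝ ι → Matrix ι ι ℝ) (φ : EuclideanSpace ℝ ι → ℝ) :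
    (n : ℕ) → EuclideanSpace ℝ ι → (Fin n → ι) → ℝ
  | 0 => fun x _ => φ x
  | 1 => fun x => stfPart (g x) (covDeriv g (multipoleTensor g φ 0) x)
  | n + 2 => fun x => stfPart (g x) fun I =>
      covDeriv g (multipoleTensor g φ (n + 1)) x I -
        ((n + 1 : ℝ) * (2 * n + 1) / 2) *
          (ricci g x (I 0) (I 1) * multipoleTensor g φ n x (Fin.tail (Fin.tail I)))

end Coordinates

/-- The components, in coordinates `(t, x)` on `ℝ × ℝ³`, of the static metric
`-λ dt² + λ⁻¹ h_{ij} dx^i dx^j`. -/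
def staticMetric (lam : EuclideanSpace ℝ (Fin 3) → ℝ)
    (h : EuclideanSpace ℝ (Fin 3) → Matrix (Fin 3) (Fin 3) ℝ)
    (y : EuclideanSpace ℝ (Fin 4)) : Matrix (Fin 4) (Fin 4) ℝ :=
  let x : EuclideanSpace ℝ (Fin 3) := WithLp.toLp 2 fun i => y i.succ
  Matrix.of fun a b =>
    Fin.cases (Fin.cases (-lam x) (fun _ => 0) b)
      (fun i => Fin.cases 0 (fun j => (lam x)⁻¹ * h x i j) b) a

/-! ### Static asymptotically flat spacetimes -/

variable {Vt : Type*} [TopologicalSpace Vt] [ChartedSpace (EuclideanSpace ℝ (Fin 3)) Vt]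

/-- The components, in a chart `e`, of a field of bilinear forms on tangent spaces. -/
def chartComponents
    (B : ∀ p : Vt, TangentSpace (𝓡 3) p → TangentSpace (𝓡 3) p → ℝ)
    (e : OpenPartialHomeomorph Vt (EuclideanSpace ℝ (Fin 3)))
    (x : EuclideanSpace ℝ (Fin 3)) : Matrix (Fin 3) (Fin 3) ℝ :=
  Matrix.of fun i j =>
    B (e.symm x)
      (mfderiv (𝓡 3) (𝓡 3) e.symm x (EuclideanSpace.single i (1 : ℝ) : EuclideanSpace ℝ (Fin 3)))
      (mfderiv (𝓡 3) (𝓡 3) e.symm x (EuclideanSpace.single j (1 : ℝ) : EuclideanSpace ℝ (Fin 3)))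

variable (Vt) in
/-- A static asymptotically flat spacetime, described on the one-point conformal
compactification `Vt = V ∪ {Λ}` of the 3-manifold `V` of trajectories of the static Killing
vector `ξ = ∂_t`. The data are the function `lam = -ξ^a ξ_a > 0` on `V` (its value at `Λ` plays no
role), the smooth metric `h̃` on `Vt` and the conformal factor `Ω`. The metric on `V` is
`h = Ω⁻² h̃`, and the spacetime metric is `-lam dt² + lam⁻¹ h`. -/
structure StaticAF [IsManifold (𝓡 3) ∞ Vt] where
  /-- the point at infinity -/
  Λ : Vt
  lam : Vt → ℝ
  lam_pos : ∀ p, p ≠ Λ → 0 < lam p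
  lam_smooth : ContMDiffOn (𝓡 3) 𝓘(ℝ, ℝ) ∞ lam {Λ}ᶜ
  /-- the rescaled metric `h̃ = Ω² h` -/
  ht : Bundle.ContMDiffRiemannianMetric (𝓡 3) ∞ (EuclideanSpace ℝ (Fin 3))
    (fun p : Vt => TangentSpace (𝓡 3) p)
  /-- the conformal factor -/
  Ω : Vt → ℝ
  Ω_smooth : ContMDiff (𝓡 3) 𝓘(ℝ, ℝ) ∞ Ω
  Ω_pos : ∀ p, p ≠ Λ → 0 < Ω p
  Ω_zero : Ω Λ = 0
  /-- `D̃_a Ω = 0` at `Λ` -/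
  Ω_grad : ∀ e ∈ IsManifold.maximalAtlas (𝓡 3) ∞ Vt, Λ ∈ e.source → ∀ i : Fin 3,
    pderiv i (Ω ∘ e.symm) (e Λ) = 0
  /-- `D̃_a D̃_b Ω = 2 h̃_{ab}` at `Λ` -/
  Ω_hess : ∀ e ∈ IsManifold.maximalAtlas (𝓡 3) ∞ Vt, Λ ∈ e.source → ∀ i j : Fin 3,
    pderiv i (pderiv j (Ω ∘ e.symm)) (e Λ) -
        ∑ k, christoffel (chartComponents (fun p v w => ht.inner p v w) e) k i j (e Λ) *
          pderiv k (Ω ∘ e.symm) (e Λ) =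
      2 * chartComponents (fun p v w => ht.inner p v w) e (e Λ) i j

namespace StaticAF

variable [IsManifold (𝓡 3) ∞ Vt] (S : StaticAF Vt)

/-- The components of `h̃` in a chart. -/
def htChart (e : OpenPartialHomeomorph Vt (EuclideanSpace ℝ (Fin 3))) :
    EuclideanSpace ℝ (Fin 3) → Matrix (Fin 3) (Fin 3) ℝ :=
  chartComponents (fun p v w => S.ht.inner p v w) e

/-- The metric `h = Ω⁻² h̃` on `V`. -/
def h (p : Vt) (v w : TangentSpace (𝓡 3) p) : ℝ := (S.Ω p ^ 2)⁻¹ * S.ht.inner p v w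

/-- The spacetime metric `-lam dt² + lam⁻¹ h` is Ricci flat. -/
def IsVacuum : Prop :=
  ∀ e ∈ IsManifold.maximalAtlas (𝓡 3) ∞ Vt, ∀ y : EuclideanSpace ℝ (Fin 4),
    ∀ x : EuclideanSpace ℝ (Fin 3), (∀ i : Fin 3, x i = y i.succ) →
      x ∈ e.target → e.symm x ≠ S.Λ → ∀ a b : Fin 4,
        ricci (staticMetric (S.lam ∘ e.symm) (chartComponents S.h e)) y a b = 0

/-- Axisymmetry: a nontrivial smooth action of the rotation group `ℝ / 2πℤ` which fixes `Λ` and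
preserves `lam` and `h`, and hence the spacetime metric. -/
def IsAxisymmetric : Prop :=
  ∃ R : ℝ → Vt → Vt,
    ContMDiff (𝓘(ℝ, ℝ).prod (𝓡 3)) (𝓡 3) ∞ (fun q : ℝ × Vt => R q.1 q.2) ∧
    (∀ p, R 0 p = p) ∧
    (∀ s t p, R (s + t) p = R s (R t p)) ∧
    (∀ p, R (2 * Real.pi) p = p) ∧
    (∃ s p, R s p ≠ p) ∧
    (∀ s, R s S.Λ = S.Λ) ∧
    (∀ s p, p ≠ S.Λ → S.lam (R s p) = S.lam p) ∧
    (∀ s p, p ≠ S.Λ → ∀ v w : TangentSpace (𝓡 3) p,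
      S.h (R s p) (mfderiv (𝓡 3) (𝓡 3) (R s) p v) (mfderiv (𝓡 3) (𝓡 3) (R s) p w) = S.h p v w)

/-- The Hansen potential of a static spacetime. -/
def hansen (p : Vt) : ℝ := (1 - S.lam p ^ 2) / (4 * S.lam p)

/-- The Geroch potential. -/
def geroch (p : Vt) : ℝ := S.lam p ^ (-(1 / 4) : ℝ) * (1 - √(S.lam p))

/-- `φt` is the rescaled potential `φ̃ = φ / √Ω`, smoothly extended to `Λ`. -/
def IsRescaled (φ φt : Vt → ℝ) : Prop :=
  ContMDiff (𝓡 3) 𝓘(ℝ, ℝ) ∞ φt ∧ ∀ p, p ≠ S.Λ → φt p = φ p / √(S.Ω p)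

/-- The components, in a chart around `Λ`, of the `n`-th multipole moment `P_{a_1 … a_n}(Λ)`
which is produced by the rescaled potential `φt`. -/
def moment (φt : Vt → ℝ) (e : OpenPartialHomeomorph Vt (EuclideanSpace ℝ (Fin 3))) (n : ℕ) :
    (Fin n → Fin 3) → ℝ :=
  multipoleTensor (S.htChart e) (φt ∘ e.symm) n (e S.Λ)

end StaticAF

end Multipole

end

set_option linter.unusedSectionVars false

noncomputable section

namespace Multipole

/-! ### Smoothness of metric quantities, and the geodesic spray on the tangent bundle. -/

section Calculus

variable {ι : Type} [Fintype ι] [DecidableEq ι] {U : Set (EuclideanSpace ℝ ι)}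

/-! ### Smoothness of the geometric quantities -/

/-! A symmetric covariant tensor field is the same thing as a function on the tangent bundle that is
polynomial in the velocity `v`, namely its full contraction with copies of `v`. Under this
dictionary the covariant derivative becomes differentiation along the geodesic spray `X`
(`tensorEval_covDeriv`), multiplication by the Ricci tensor becomes multiplication by a function,
and passing to the symmetric trace-free part changes a function only by a smooth multiple of the
quadratic form `q` of the metric (`exists_tensorEval_stfPart`). The multipole recursion is therefore
linear and, modulo `q`, is built from `X` and from multiplication by smooth functions.

Consider the ideal generated by `Ω`, `dΩ` and `q` in the smooth functions on the tangent bundle. The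
derivation `X` sends `Ω` to `dΩ`, annihilates `q`, and sends `dΩ` to the Hessian of `Ω`. Once that
Hessian lies in the ideal, `X` preserves the ideal. If two potentials differ by a multiple of `Ω`,
induction then puts the difference of all their multipole functions into the ideal. At `Λ` both `Ω`
and `dΩ` vanish, so the difference there is divisible by `q`, and a symmetric trace-free tensor
whose polynomial is divisible by `q` is zero (`IsSTF.eq_zero_of_tensorEval_eq`). This is
`multipoleTensor_eq_of_memIdeal`.

The Hessian condition comes from the vacuum equations. Written in terms of the rescaled metric, with
`u = log λ`, they say that `Ω R_ij + D_i D_j Ω - (Ω/2) u_i u_j` is pure trace. Since `φ_G = -2 sinh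
(u/4)`, the last term equals `8 W_i W_j / (4 + Ω φ²)` for the rescaled Geroch potential `φ` and `W =
Ω dφ + (1/2) φ dΩ`. This expression is smooth across `Λ` and `W` lies in the ideal
(`source_eq_of_geroch`, `memIdeal_spray_diffForm`).

Finally `φ_H = -(1/2) sinh u`, so duplication formulas express each potential as the other times a
smooth nonvanishing function of its square. The squares are `Ω φ̃²`, hence smooth at `Λ`. This
transfers smooth extendability in both directions, and since the factor equals 1 at argument 0, the
rescaled potentials differ by a multiple of `Ω`. -/

theorem ContDiffOn.matrix_det {E κ : Type*} [NormedAddCommGroup E] [NormedSpace ℝ E] [Fintype κ]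
    [DecidableEq κ] {s : Set E} {A : E → Matrix κ κ ℝ}
    (hA : ∀ i j, ContDiffOn ℝ ∞ (fun x => A x i j) s) :
    ContDiffOn ℝ ∞ (fun x => (A x).det) s := by
  simp only [Matrix.det_apply']
  exact ContDiffOn.sum fun σ _ => contDiffOn_const.mul (contDiffOn_prod fun i _ => hA _ _)

/-- Cramer's rule: an entry of the inverse is a quotient of two determinants. -/
theorem ContDiffOn.matrix_inv {E κ : Type*} [NormedAddCommGroup E] [NormedSpace ℝ E] [Fintype κ]
    [DecidableEq κ] {s : Set E} {A : E → Matrix κ κ ℝ}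
    (hA : ∀ i j, ContDiffOn ℝ ∞ (fun x => A x i j) s) (hdet : ∀ x ∈ s, (A x).det ≠ 0) (i j : κ) :
    ContDiffOn ℝ ∞ (fun x => (A x)⁻¹ i j) s := by
  have h : (fun x => (A x)⁻¹ i j) =
      fun x => ((A x).det)⁻¹ * ((A x).updateRow j (Pi.single i 1)).det := by
    funext x
    rw [Matrix.inv_def, Matrix.smul_apply, Matrix.adjugate_apply, Ring.inverse_eq_inv', smul_eq_mul]
  rw [h]
  refine ((ContDiffOn.matrix_det hA).inv hdet).mul (ContDiffOn.matrix_det fun k l => ?_)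
  by_cases hk : k = j
  · subst hk
    simpa using contDiffOn_const
  · simpa [Matrix.updateRow_ne hk] using hA k l

theorem ContDiffOn.pderiv (hU : IsOpen U) {f : EuclideanSpace ℝ ι → ℝ} (hf : ContDiffOn ℝ ∞ f U)
    (i : ι) : ContDiffOn ℝ ∞ (pderiv i f) U :=
  (hf.fderiv_of_isOpen hU (by simp)).clm_apply contDiffOn_const

/-- A smooth Riemannian metric on an open set, given by its matrix of components. -/
structure IsSmoothMetricOn (g : EuclideanSpace ℝ ι → Matrix ι ι ℝ)
    (U : Set (EuclideanSpace ℝ ι)) : Prop where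
  isOpen : IsOpen U
  smooth : ∀ i j, ContDiffOn ℝ ∞ (fun x => g x i j) U
  posDef : ∀ x ∈ U, (g x).PosDef

namespace IsSmoothMetricOn

variable {g : EuclideanSpace ℝ ι → Matrix ι ι ℝ} {x : EuclideanSpace ℝ ι}

theorem det_ne_zero (hg : IsSmoothMetricOn g U) (hx : x ∈ U) : (g x).det ≠ 0 :=
  (hg.posDef x hx).det_pos.ne'

theorem symm (hg : IsSmoothMetricOn g U) (hx : x ∈ U) (i j : ι) : g x i j = g x j i := by
  simpa using ((hg.posDef x hx).isHermitian.apply i j).symm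

theorem sum_mul_inv (hg : IsSmoothMetricOn g U) (hx : x ∈ U) (i j : ι) :
    ∑ k, g x i k * (g x)⁻¹ k j = if i = j then 1 else 0 := by
  rw [← Matrix.mul_apply, Matrix.mul_nonsing_inv _ (hg.det_ne_zero hx).isUnit, Matrix.one_apply]

theorem sum_inv_mul (hg : IsSmoothMetricOn g U) (hx : x ∈ U) (i j : ι) :
    ∑ k, (g x)⁻¹ i k * g x k j = if i = j then 1 else 0 := by
  rw [← Matrix.mul_apply, Matrix.nonsing_inv_mul _ (hg.det_ne_zero hx).isUnit, Matrix.one_apply]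

theorem contDiffOn_inv (hg : IsSmoothMetricOn g U) (i j : ι) :
    ContDiffOn ℝ ∞ (fun x => (g x)⁻¹ i j) U :=
  ContDiffOn.matrix_inv hg.smooth (fun _ hx => hg.det_ne_zero hx) i j

theorem contDiffOn_christoffel (hg : IsSmoothMetricOn g U) (k i j : ι) :
    ContDiffOn ℝ ∞ (christoffel g k i j) U := by
  refine contDiffOn_const.mul (ContDiffOn.sum fun l _ => (hg.contDiffOn_inv k l).mul ?_)
  exact ((ContDiffOn.pderiv hg.isOpen (hg.smooth j l) i).add
    (ContDiffOn.pderiv hg.isOpen (hg.smooth i l) j)).sub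
    (ContDiffOn.pderiv hg.isOpen (hg.smooth i j) l)

theorem contDiffOn_ricci (hg : IsSmoothMetricOn g U) (i j : ι) :
    ContDiffOn ℝ ∞ (fun x => ricci g x i j) U := by
  have hΓ := hg.contDiffOn_christoffel
  refine ContDiffOn.add (ContDiffOn.sum fun k _ => ?_)
    (ContDiffOn.sum fun k _ => ContDiffOn.sum fun l _ => ?_)
  · exact (ContDiffOn.pderiv hg.isOpen (hΓ k i j) k).sub (ContDiffOn.pderiv hg.isOpen (hΓ k i k) j)
  · exact ((hΓ k k l).mul (hΓ l i j)).sub ((hΓ k j l).mul (hΓ l i k))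

theorem pderiv_symm (hg : IsSmoothMetricOn g U) (hx : x ∈ U) (k i j : ι) :
    pderiv k (fun y => g y i j) x = pderiv k (fun y => g y j i) x := by
  have h : (fun y => g y i j) =ᶠ[nhds x] fun y => g y j i :=
    Filter.eventuallyEq_of_mem (hg.isOpen.mem_nhds hx) fun y hy => hg.symm hy i j
  rw [pderiv, h.fderiv_eq, pderiv]

theorem christoffel_symm (hg : IsSmoothMetricOn g U) (hx : x ∈ U) (k i j : ι) :
    christoffel g k i j x = christoffel g k j i x := by
  simp only [christoffel, hg.pderiv_symm hx _ j i]
  congr 1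
  exact Finset.sum_congr rfl fun l _ => by ring

/-- Christoffel symbols with the upper index lowered. -/
theorem sum_mul_christoffel (hg : IsSmoothMetricOn g U) (hx : x ∈ U) (m i j : ι) :
    ∑ k, g x m k * christoffel g k i j x = (1 / 2) * (pderiv i (fun y => g y j m) x +
      pderiv j (fun y => g y i m) x - pderiv m (fun y => g y i j) x) := by
  simp only [christoffel, Finset.mul_sum]
  rw [Finset.sum_comm]
  have : ∀ l, ∑ k, g x m k * (1 / 2 * ((g x)⁻¹ k l * (pderiv i (fun y => g y j l) x +
      pderiv j (fun y => g y i l) x - pderiv l (fun y => g y i j) x))) =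
      (if m = l then 1 else 0) * (1 / 2 * (pderiv i (fun y => g y j l) x +
      pderiv j (fun y => g y i l) x - pderiv l (fun y => g y i j) x)) := by
    intro l
    rw [← hg.sum_mul_inv hx m l, Finset.sum_mul]
    exact Finset.sum_congr rfl fun k _ => by ring
  rw [Finset.sum_congr rfl fun l _ => this l]
  simp

/-- Compatibility of the Levi-Civita connection with the metric. -/
theorem pderiv_eq (hg : IsSmoothMetricOn g U) (hx : x ∈ U) (k i j : ι) :
    pderiv k (fun y => g y i j) x =
      ∑ l, g x j l * christoffel g l k i x + ∑ l, g x i l * christoffel g l k j x := by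
  rw [hg.sum_mul_christoffel hx, hg.sum_mul_christoffel hx, hg.pderiv_symm hx k j i]
  ring

end IsSmoothMetricOn

/-! ### The geodesic spray -/

/-- The full contraction of a covariant tensor with copies of a vector. -/
def tensorEval {n : ℕ} (T : (Fin n → ι) → ℝ) (v : EuclideanSpace ℝ ι) : ℝ :=
  ∑ I : Fin n → ι, T I * ∏ k, v (I k)

/-- The quadratic form of the metric as a function on the tangent bundle. -/
def metricForm (g : EuclideanSpace ℝ ι → Matrix ι ι ℝ)
    (p : EuclideanSpace ℝ ι × EuclideanSpace ℝ ι) : ℝ :=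
  ∑ i, ∑ j, g p.1 i j * (p.2 i * p.2 j)

/-- The vertical part of the geodesic spray of `g`. -/
def sprayVector (g : EuclideanSpace ℝ ι → Matrix ι ι ℝ)
    (p : EuclideanSpace ℝ ι × EuclideanSpace ℝ ι) : EuclideanSpace ℝ ι :=
  WithLp.toLp 2 fun k => -∑ i, ∑ j, christoffel g k i j p.1 * (p.2 i * p.2 j)

/-- The derivative of a function on the tangent bundle along the geodesic spray of `g`. -/
def spray (g : EuclideanSpace ℝ ι → Matrix ι ι ℝ) (F : EuclideanSpace ℝ ι × EuclideanSpace ℝ ι → ℝ)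
    (p : EuclideanSpace ℝ ι × EuclideanSpace ℝ ι) : ℝ :=
  fderiv ℝ F p (p.2, sprayVector g p)

variable {g : EuclideanSpace ℝ ι → Matrix ι ι ℝ} {p : EuclideanSpace ℝ ι × EuclideanSpace ℝ ι}

theorem spray_add {F G : EuclideanSpace ℝ ι × EuclideanSpace ℝ ι → ℝ}
    (hF : DifferentiableAt ℝ F p) (hG : DifferentiableAt ℝ G p) :
    spray g (fun p => F p + G p) p = spray g F p + spray g G p := by
  simp [spray, fderiv_fun_add hF hG]

theorem spray_mul {F G : EuclideanSpace ℝ ι × EuclideanSpace ℝ ι → ℝ}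
    (hF : DifferentiableAt ℝ F p) (hG : DifferentiableAt ℝ G p) :
    spray g (fun p => F p * G p) p = spray g F p * G p + F p * spray g G p := by
  simp [spray, fderiv_fun_mul hF hG]
  ring

theorem spray_sum {α : Type*} (s : Finset α)
    {F : α → EuclideanSpace ℝ ι × EuclideanSpace ℝ ι → ℝ}
    (hF : ∀ a ∈ s, DifferentiableAt ℝ (F a) p) :
    spray g (fun p => ∑ a ∈ s, F a p) p = ∑ a ∈ s, spray g (F a) p := by
  simp [spray, fderiv_fun_sum hF]

theorem sum_smul_single (v : EuclideanSpace ℝ ι) :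
    ∑ i, v i • EuclideanSpace.single i (1 : ℝ) = v := by
  ext j
  simp [Pi.single_apply]

theorem fderiv_eq_sum_pderiv (f : EuclideanSpace ℝ ι → ℝ) (x v : EuclideanSpace ℝ ι) :
    fderiv ℝ f x v = ∑ i, v i * pderiv i f x := by
  conv_lhs => rw [← sum_smul_single v]
  simp [pderiv]

theorem spray_comp_fst {f : EuclideanSpace ℝ ι → ℝ} (hf : DifferentiableAt ℝ f p.1) :
    spray g (fun p => f p.1) p = ∑ i, p.2 i * pderiv i f p.1 := by
  have h : HasFDerivAt (fun p : EuclideanSpace ℝ ι × EuclideanSpace ℝ ι => f p.1)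
      ((fderiv ℝ f p.1).comp (ContinuousLinearMap.fst ℝ _ _)) p :=
    hf.hasFDerivAt.comp p hasFDerivAt_fst
  rw [spray, h.fderiv, ContinuousLinearMap.comp_apply, ContinuousLinearMap.coe_fst',
    fderiv_eq_sum_pderiv]

theorem hasFDerivAt_snd_apply (k : ι) :
    HasFDerivAt (fun p : EuclideanSpace ℝ ι × EuclideanSpace ℝ ι => p.2 k)
      ((EuclideanSpace.proj k : EuclideanSpace ℝ ι →L[ℝ] ℝ).comp
        (ContinuousLinearMap.snd ℝ _ _)) p :=
  (EuclideanSpace.proj k : EuclideanSpace ℝ ι →L[ℝ] ℝ).hasFDerivAt.comp p hasFDerivAt_snd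

theorem differentiableAt_snd_apply (k : ι) :
    DifferentiableAt ℝ (fun p : EuclideanSpace ℝ ι × EuclideanSpace ℝ ι => p.2 k) p :=
  (hasFDerivAt_snd_apply k).differentiableAt

theorem contDiff_snd_apply (k : ι) :
    ContDiff ℝ ∞ (fun p : EuclideanSpace ℝ ι × EuclideanSpace ℝ ι => p.2 k) :=
  (EuclideanSpace.proj k : EuclideanSpace ℝ ι →L[ℝ] ℝ).contDiff.comp contDiff_snd

theorem spray_snd_apply (k : ι) :
    spray g (fun p => p.2 k) p = -∑ i, ∑ j, christoffel g k i j p.1 * (p.2 i * p.2 j) := by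
  rw [spray, (hasFDerivAt_snd_apply k).fderiv]
  simp [sprayVector]

theorem spray_congr {F G : EuclideanSpace ℝ ι × EuclideanSpace ℝ ι → ℝ} (hU : IsOpen U)
    (h : ∀ p : EuclideanSpace ℝ ι × EuclideanSpace ℝ ι, p.1 ∈ U → F p = G p) (hp : p.1 ∈ U) :
    spray g F p = spray g G p := by
  have : F =ᶠ[nhds p] G := Filter.eventuallyEq_of_mem
    ((hU.preimage continuous_fst).mem_nhds hp) fun q hq => h q hq
  rw [spray, this.fderiv_eq, spray]

theorem ContDiffOn.comp_fst {f : EuclideanSpace ℝ ι → ℝ} (hf : ContDiffOn ℝ ∞ f U) :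
    ContDiffOn ℝ ∞ (fun p : EuclideanSpace ℝ ι × EuclideanSpace ℝ ι => f p.1) (Prod.fst ⁻¹' U) :=
  hf.comp contDiff_fst.contDiffOn fun _ h => h

theorem contDiffOn_differentiableAt {E : Type*} [NormedAddCommGroup E] [NormedSpace ℝ E]
    {s : Set E} (hs : IsOpen s) {f : E → ℝ} (hf : ContDiffOn ℝ ∞ f s) {x : E} (hx : x ∈ s) :
    DifferentiableAt ℝ f x :=
  (hf.contDiffAt (hs.mem_nhds hx)).differentiableAt (by simp)

theorem ContDiffOn.differentiableAt_fst (hU : IsOpen U)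
    {F : EuclideanSpace ℝ ι × EuclideanSpace ℝ ι → ℝ}
    (hF : ContDiffOn ℝ ∞ F (Prod.fst ⁻¹' U)) (hp : p.1 ∈ U) : DifferentiableAt ℝ F p :=
  contDiffOn_differentiableAt (hU.preimage continuous_fst) hF hp

theorem ContDiffOn.spray (hg : IsSmoothMetricOn g U)
    {F : EuclideanSpace ℝ ι × EuclideanSpace ℝ ι → ℝ}
    (hF : ContDiffOn ℝ ∞ F (Prod.fst ⁻¹' U)) : ContDiffOn ℝ ∞ (spray g F) (Prod.fst ⁻¹' U) := by
  have hopen : IsOpen (Prod.fst ⁻¹' U : Set (EuclideanSpace ℝ ι × EuclideanSpace ℝ ι)) :=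
    hg.isOpen.preimage continuous_fst
  refine (hF.fderiv_of_isOpen hopen (by simp)).clm_apply (contDiff_snd.contDiffOn.prodMk ?_)
  refine contDiffOn_euclidean.mpr fun k => ?_
  refine ContDiffOn.neg (ContDiffOn.sum fun i _ => ContDiffOn.sum fun j _ => ?_)
  exact (ContDiffOn.comp_fst (hg.contDiffOn_christoffel k i j)).mul
    ((contDiff_snd_apply i).mul (contDiff_snd_apply j)).contDiffOn

theorem contDiffOn_tensorEval {n : ℕ} {T : EuclideanSpace ℝ ι → (Fin n → ι) → ℝ}
    (hT : ∀ I, ContDiffOn ℝ ∞ (fun x => T x I) U) :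
    ContDiffOn ℝ ∞ (fun p : EuclideanSpace ℝ ι × EuclideanSpace ℝ ι => tensorEval (T p.1) p.2)
      (Prod.fst ⁻¹' U) :=
  ContDiffOn.sum fun I _ => (ContDiffOn.comp_fst (hT I)).mul
    (contDiffOn_prod fun k _ => (contDiff_snd_apply (I k)).contDiffOn)

theorem contDiffOn_metricForm (hg : IsSmoothMetricOn g U) :
    ContDiffOn ℝ ∞ (metricForm g) (Prod.fst ⁻¹' U) :=
  ContDiffOn.sum fun i _ => ContDiffOn.sum fun j _ => (ContDiffOn.comp_fst (hg.smooth i j)).mul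
    ((contDiff_snd_apply i).mul (contDiff_snd_apply j)).contDiffOn

/-- The geodesic spray annihilates the metric. -/
theorem spray_metricForm (hg : IsSmoothMetricOn g U) (hp : p.1 ∈ U) :
    spray g (metricForm g) p = 0 := by
  have hd : ∀ i j, DifferentiableAt ℝ (fun x => g x i j) p.1 := fun i j =>
    contDiffOn_differentiableAt hg.isOpen (hg.smooth i j) hp
  have hd' : ∀ i j, DifferentiableAt ℝ
      (fun p : EuclideanSpace ℝ ι × EuclideanSpace ℝ ι => g p.1 i j) p := fun i j =>
    ContDiffOn.differentiableAt_fst hg.isOpen (ContDiffOn.comp_fst (hg.smooth i j)) hp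
  have hv := fun i => differentiableAt_snd_apply (p := p) i
  have hvv : ∀ i j, DifferentiableAt ℝ
      (fun p : EuclideanSpace ℝ ι × EuclideanSpace ℝ ι => p.2 i * p.2 j) p :=
    fun i j => (hv i).fun_mul (hv j)
  unfold metricForm
  rw [spray_sum _ fun i _ => DifferentiableAt.fun_sum fun j _ => (hd' i j).fun_mul (hvv i j)]
  -- Metric compatibility turns the derivative of `g` into two Christoffel sums; the two velocity
  -- factors contribute the last two. After summation over `i` and `j` they cancel in pairs by
  -- relabelling.
  have e1 : ∀ i j, spray g (fun p => g p.1 i j * (p.2 i * p.2 j)) p =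
      (∑ k, ∑ l, g p.1 j l * christoffel g l k i p.1 * (p.2 k * p.2 i * p.2 j)) +
      (∑ k, ∑ l, g p.1 i l * christoffel g l k j p.1 * (p.2 k * p.2 i * p.2 j)) -
      (∑ a, ∑ b, g p.1 i j * christoffel g i a b p.1 * (p.2 a * p.2 b * p.2 j)) -
      (∑ a, ∑ b, g p.1 i j * christoffel g j a b p.1 * (p.2 a * p.2 b * p.2 i)) := by
    intro i j
    rw [spray_mul (hd' i j) (hvv i j), spray_mul (hv i) (hv j), spray_snd_apply, spray_snd_apply,
      spray_comp_fst (hd i j)]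
    simp only [hg.pderiv_eq hp, mul_add, Finset.sum_add_distrib, add_mul, Finset.mul_sum,
      Finset.sum_mul, neg_mul, mul_neg, sub_eq_add_neg, ← Finset.sum_neg_distrib, add_assoc]
    refine congrArg₂ _ ?_ (congrArg₂ _ ?_ (congrArg₂ _ ?_ ?_)) <;>
      exact Finset.sum_congr rfl fun a _ => Finset.sum_congr rfl fun b _ => by ring
  have e2 : ∀ i, spray g (fun p => ∑ j, g p.1 i j * (p.2 i * p.2 j)) p =
      ∑ j, spray g (fun p => g p.1 i j * (p.2 i * p.2 j)) p := fun i =>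
    spray_sum _ fun j _ => (hd' i j).fun_mul (hvv i j)
  simp only [e2, e1, Finset.sum_sub_distrib, Finset.sum_add_distrib]
  have rot : ∀ f : ι → ι → ι → ℝ, ∑ a, ∑ b, ∑ c, f a b c = ∑ c, ∑ b, ∑ a, f a b c := by
    intro f
    rw [Finset.sum_comm, Finset.sum_congr rfl fun b _ => Finset.sum_comm, Finset.sum_comm]
  have r1 : ∑ i, ∑ j, ∑ k, ∑ l, g p.1 j l * christoffel g l k i p.1 * (p.2 k * p.2 i * p.2 j) =
      ∑ i, ∑ j, ∑ a, ∑ b, g p.1 i j * christoffel g j a b p.1 * (p.2 a * p.2 b * p.2 i) := by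
    rw [Finset.sum_comm]
    exact Finset.sum_congr rfl fun j _ => rot _
  have r2 : ∑ i, ∑ j, ∑ k, ∑ l, g p.1 i l * christoffel g l k j p.1 * (p.2 k * p.2 i * p.2 j) =
      ∑ i, ∑ j, ∑ a, ∑ b, g p.1 i j * christoffel g i a b p.1 * (p.2 a * p.2 b * p.2 j) := by
    rw [Finset.sum_comm (f := fun i j => ∑ a, ∑ b,
      g p.1 i j * christoffel g i a b p.1 * (p.2 a * p.2 b * p.2 j))]
    refine Finset.sum_congr rfl fun j _ => ?_
    rw [rot]
    refine Finset.sum_congr rfl fun i _ => Finset.sum_congr rfl fun a _ =>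
      Finset.sum_congr rfl fun b _ => ?_
    rw [hg.symm hp i j]
    ring
  rw [r1, r2]
  ring

theorem sum_fin_succ {n : ℕ} (f : (Fin (n + 1) → ι) → ℝ) :
    ∑ I, f I = ∑ i, ∑ I : Fin n → ι, f (Fin.cons i I) := by
  rw [← (Fin.consEquiv fun _ => ι).sum_comp, Fintype.sum_prod_type]
  rfl

theorem tail_cons' {n : ℕ} (i : ι) (I : Fin n → ι) :
    Fin.tail (Fin.cons i I : Fin (n + 1) → ι) = I :=
  Fin.tail_cons (α := fun _ => ι) i I

/-- On full contractions the covariant derivative is the derivative along the geodesic spray. -/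
theorem tensorEval_covDeriv (hg : IsSmoothMetricOn g U) {n : ℕ}
    {T : EuclideanSpace ℝ ι → (Fin n → ι) → ℝ} (hT : ∀ I, ContDiffOn ℝ ∞ (fun x => T x I) U)
    (hp : p.1 ∈ U) :
    tensorEval (covDeriv g T p.1) p.2 = spray g (fun p => tensorEval (T p.1) p.2) p := by
  have hprod : ∀ I : Fin n → ι, HasFDerivAt
      (fun p : EuclideanSpace ℝ ι × EuclideanSpace ℝ ι => ∏ k, p.2 (I k)) _ p := fun I =>
    HasFDerivAt.finsetProd fun k _ => hasFDerivAt_snd_apply (p := p) (I k)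
  have hdT : ∀ I, DifferentiableAt ℝ
      (fun p : EuclideanSpace ℝ ι × EuclideanSpace ℝ ι => T p.1 I) p := fun I =>
    ContDiffOn.differentiableAt_fst hg.isOpen (ContDiffOn.comp_fst (hT I)) hp
  have hsp : ∀ I : Fin n → ι, spray g (fun p => ∏ k, p.2 (I k)) p =
      -∑ k, ∑ a, ∑ b, (∏ l ∈ Finset.univ.erase k, p.2 (I l)) *
        (christoffel g (I k) a b p.1 * (p.2 a * p.2 b)) := by
    intro I
    rw [spray, (hprod I).fderiv]
    simp [sprayVector, Finset.mul_sum]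
  unfold tensorEval
  rw [spray_sum _ fun I _ => (hdT I).fun_mul (hprod I).differentiableAt,
    sum_fin_succ]
  simp only [spray_mul (hdT _) (hprod _).differentiableAt, hsp, covDeriv, tail_cons',
    Fin.cons_zero, Fin.prod_univ_succ, Fin.cons_succ, sub_mul,
    Finset.sum_sub_distrib, mul_neg,
    ← sub_eq_add_neg]
  congr 1
  · rw [Finset.sum_comm]
    refine Finset.sum_congr rfl fun I _ => ?_
    rw [spray_comp_fst (contDiffOn_differentiableAt hg.isOpen (hT I) hp), Finset.sum_mul]
    exact Finset.sum_congr rfl fun i _ => by ring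
  -- The correction in slot `k` of the covariant derivative has to match the spray derivative of the
  -- `k`-th velocity factor. The two sums differ by exchanging the `k`-th entry of the multi-index
  -- with the contracted index, which is an involution on pairs.
  · have hinv : ∀ k : Fin n, Function.Involutive
        (fun q : (Fin n → ι) × ι => (Function.update q.1 k q.2, q.1 k)) := fun k q => by simp
    have hL : ∀ i, ∑ I : Fin n → ι, (∑ k, ∑ c, christoffel g c i (I k) p.1 *
        T p.1 (Function.update I k c)) * (p.2 i * ∏ l, p.2 (I l)) =
        ∑ k, ∑ q : (Fin n → ι) × ι, (christoffel g q.2 i (q.1 k) p.1 *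
          T p.1 (Function.update q.1 k q.2)) * (p.2 i * ∏ l, p.2 (q.1 l)) := by
      intro i
      simp only [Finset.sum_mul, Fintype.sum_prod_type]
      rw [Finset.sum_comm]
    have hR : ∑ I : Fin n → ι, T p.1 I * ∑ k, ∑ a, ∑ b, (∏ l ∈ Finset.univ.erase k, p.2 (I l)) *
        (christoffel g (I k) a b p.1 * (p.2 a * p.2 b)) =
        ∑ i, ∑ k, ∑ q : (Fin n → ι) × ι, T p.1 q.1 *
          ((∏ l ∈ Finset.univ.erase k, p.2 (q.1 l)) *
            (christoffel g (q.1 k) i q.2 p.1 * (p.2 i * p.2 q.2))) := by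
      simp only [Finset.mul_sum, Fintype.sum_prod_type]
      rw [Finset.sum_comm]
      conv_rhs => rw [Finset.sum_comm]
      exact Finset.sum_congr rfl fun k _ => Finset.sum_comm
    rw [Finset.sum_congr rfl fun i _ => hL i, hR]
    refine Finset.sum_congr rfl fun i _ => Finset.sum_congr rfl fun k _ => ?_
    rw [← Equiv.sum_comp (hinv k).toPerm]
    refine Finset.sum_congr rfl fun q _ => ?_
    have h1 : ∏ l ∈ Finset.univ.erase k, p.2 (Function.update q.1 k q.2 l) =
        ∏ l ∈ Finset.univ.erase k, p.2 (q.1 l) :=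
      Finset.prod_congr rfl fun l hl => by rw [Function.update_of_ne (Finset.ne_of_mem_erase hl)]
    simp only [Function.Involutive.coe_toPerm, Function.update_self, Function.update_idem,
      Function.update_eq_self, ← Finset.mul_prod_erase _ _ (Finset.mem_univ k), h1]
    ring

end Calculus

/-! ### Algebra of symmetric tensors: polynomials, symmetrization, trace and its adjoint. -/

section Tensors

variable {ι : Type} [Fintype ι] [DecidableEq ι] {n : ℕ}

/-! ### Symmetric tensors and their full contractions -/

/-- Total symmetry of a covariant tensor. -/
def IsSymmTensor (T : (Fin n → ι) → ℝ) : Prop :=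
  ∀ (σ : Equiv.Perm (Fin n)) (I : Fin n → ι), T (I ∘ σ) = T I

/-- Permutations fixing the first slot show that freezing that slot leaves a symmetric tensor
symmetric. -/
theorem cons_comp_decomposeFin (σ : Equiv.Perm (Fin n)) (a : ι) (I : Fin n → ι) :
    (Fin.cons a I : Fin (n + 1) → ι) ∘ (Equiv.Perm.decomposeFin.symm (0, σ)) =
      Fin.cons a (I ∘ σ) := by
  funext k
  refine Fin.cases ?_ (fun k => ?_) k
  · simp
  · simp [Equiv.Perm.decomposeFin_symm_apply_succ]

theorem IsSymmTensor.cons {T : (Fin (n + 1) → ι) → ℝ} (hT : IsSymmTensor T) (a : ι) :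
    IsSymmTensor fun I : Fin n → ι => T (Fin.cons a I) := fun σ I => by
  change T (Fin.cons a (I ∘ σ)) = T (Fin.cons a I)
  rw [← cons_comp_decomposeFin, hT]

theorem IsSymmTensor.cons_cons_comm {T : (Fin (n + 2) → ι) → ℝ} (hT : IsSymmTensor T) (a b : ι)
    (I : Fin n → ι) : T (Fin.cons a (Fin.cons b I)) = T (Fin.cons b (Fin.cons a I)) := by
  rw [← hT (Equiv.swap 0 1) (Fin.cons b (Fin.cons a I))]
  congr 1
  funext k
  refine Fin.cases ?_ (fun k => Fin.cases ?_ (fun k => ?_) k) k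
  · rw [Function.comp_apply, Equiv.swap_apply_left]
    rfl
  · rw [Function.comp_apply, Fin.succ_zero_eq_one, Equiv.swap_apply_right]
    rfl
  · rw [Function.comp_apply,
      Equiv.swap_apply_of_ne_of_ne (Fin.succ_ne_zero _) (Fin.succ_succ_ne_one k)]
    rfl

theorem tensorEval_succ (T : (Fin (n + 1) → ι) → ℝ) (v : EuclideanSpace ℝ ι) :
    tensorEval T v = ∑ i, v i * tensorEval (fun I : Fin n → ι => T (Fin.cons i I)) v := by
  simp only [tensorEval, sum_fin_succ, Fin.prod_univ_succ, Fin.cons_zero, Fin.cons_succ,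
    Finset.mul_sum]
  exact Finset.sum_congr rfl fun i _ => Finset.sum_congr rfl fun I _ => by ring

theorem contDiff_tensorEval (T : (Fin n → ι) → ℝ) : ContDiff ℝ ∞ (tensorEval T) :=
  ContDiff.sum fun I _ => contDiff_const.mul
    (contDiff_prod fun k _ => (EuclideanSpace.proj (I k) : EuclideanSpace ℝ ι →L[ℝ] ℝ).contDiff)

theorem fderiv_tensorEval_succ (T : (Fin (n + 1) → ι) → ℝ) (v w : EuclideanSpace ℝ ι) :
    fderiv ℝ (tensorEval T) v w =
      ∑ i, w i * tensorEval (fun I : Fin n → ι => T (Fin.cons i I)) v +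
        ∑ i, v i * fderiv ℝ (tensorEval fun I : Fin n → ι => T (Fin.cons i I)) v w := by
  have hd : ∀ i, HasFDerivAt (tensorEval fun I : Fin n → ι => T (Fin.cons i I)) _ v := fun i =>
    ((contDiff_tensorEval fun I : Fin n → ι => T (Fin.cons i I)).differentiable
      (by simp) v).hasFDerivAt
  have hp : ∀ i, HasFDerivAt (fun v : EuclideanSpace ℝ ι => v i)
      (EuclideanSpace.proj i : EuclideanSpace ℝ ι →L[ℝ] ℝ) v :=
    fun i => (EuclideanSpace.proj i : EuclideanSpace ℝ ι →L[ℝ] ℝ).hasFDerivAt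
  have h1 := HasFDerivAt.fun_sum (u := Finset.univ) fun i _ => (hp i).fun_mul (hd i)
  rw [show tensorEval T = _ from funext fun v => tensorEval_succ T v, h1.fderiv,
    ← Finset.sum_add_distrib]
  simp only [sum_apply, add_apply,
    smul_apply, smul_eq_mul, PiLp.proj_apply]
  exact Finset.sum_congr rfl fun i _ => by ring

/-- By symmetry each of the `n + 1` slots contributes equally to the derivative. This allows
polarization: the polynomial determines its slices. -/
theorem fderiv_tensorEval {T : (Fin (n + 1) → ι) → ℝ} (hT : IsSymmTensor T)
    (v w : EuclideanSpace ℝ ι) : fderiv ℝ (tensorEval T) v w =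
      (n + 1) * ∑ i, w i * tensorEval (fun I : Fin n → ι => T (Fin.cons i I)) v := by
  induction n with
  | zero =>
    have : ∀ i, fderiv ℝ (tensorEval fun I : Fin 0 → ι => T (Fin.cons i I)) v = 0 := fun i => by
      have : (tensorEval fun I : Fin 0 → ι => T (Fin.cons i I)) =
        fun _ => T (Fin.cons i default) := by
        funext v
        simp [tensorEval]
      rw [this]
      simp
    simp [fderiv_tensorEval_succ, this]
  | succ n ih =>
    have h2 : ∑ i, v i * fderiv ℝ (tensorEval fun I : Fin (n + 1) → ι => T (Fin.cons i I)) v w =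
        (n + 1) * ∑ j, w j * tensorEval (fun I : Fin (n + 1) → ι => T (Fin.cons j I)) v := by
      simp only [fun i => ih (hT.cons i), tensorEval_succ (n := n), Finset.mul_sum]
      rw [Finset.sum_comm]
      refine Finset.sum_congr rfl fun j _ => Finset.sum_congr rfl fun i _ => ?_
      simp only [hT.cons_cons_comm i j]
      ring
    rw [fderiv_tensorEval_succ, h2]
    push_cast
    ring

/-- A symmetric tensor is determined by its full contractions with vectors. -/
theorem IsSymmTensor.eq_zero_of_tensorEval {T : (Fin n → ι) → ℝ} (hT : IsSymmTensor T)
    (h : ∀ v, tensorEval T v = 0) : T = 0 := by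
  induction n with
  | zero =>
    funext I
    simpa [tensorEval, Subsingleton.elim default I] using h 0
  | succ n ih =>
    have h0 : tensorEval T = fun _ => 0 := funext h
    have h1 : ∀ a, (fun I : Fin n → ι => T (Fin.cons a I)) = 0 := fun a => by
      -- The zero polynomial has zero partial derivatives, and these are positive multiples of the
      -- polynomials of the slices.
      refine ih (hT.cons a) fun v => ?_
      have := fderiv_tensorEval hT v (EuclideanSpace.single a 1)
      rw [h0] at this
      simp at this
      exact this.resolve_left (by positivity)
    funext I
    rw [← Fin.cons_self_tail I]
    exact congrFun (h1 (I 0)) (Fin.tail I)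

/-- The totally symmetric part of a tensor. -/
def symmetrize : ((Fin n → ι) → ℝ) →ₗ[ℝ] ((Fin n → ι) → ℝ) :=
  (n.factorial : ℝ)⁻¹ • ∑ σ : Equiv.Perm (Fin n), LinearMap.funLeft ℝ ℝ fun I => I ∘ σ

theorem symmetrize_apply (T : (Fin n → ι) → ℝ) (I : Fin n → ι) :
    symmetrize T I = (n.factorial : ℝ)⁻¹ * ∑ σ : Equiv.Perm (Fin n), T (I ∘ σ) := by
  simp [symmetrize, LinearMap.sum_apply, LinearMap.funLeft_apply]

theorem isSymmTensor_symmetrize (T : (Fin n → ι) → ℝ) : IsSymmTensor (symmetrize T) := by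
  intro σ I
  rw [symmetrize_apply, symmetrize_apply]
  congr 1
  exact Equiv.sum_comp (Equiv.mulLeft σ) fun τ : Equiv.Perm (Fin n) => T (I ∘ τ)

theorem factorial_inv_mul_sum_const (c : ℝ) :
    (n.factorial : ℝ)⁻¹ * ∑ _σ : Equiv.Perm (Fin n), c = c := by
  have : (n.factorial : ℝ) ≠ 0 := by positivity
  simp [Fintype.card_perm, this]

theorem IsSymmTensor.symmetrize_eq {T : (Fin n → ι) → ℝ} (hT : IsSymmTensor T) :
    symmetrize T = T := by
  funext I
  simp only [symmetrize_apply, hT _ I, factorial_inv_mul_sum_const]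

theorem sum_comp_perm (σ : Equiv.Perm (Fin n)) (f : (Fin n → ι) → ℝ) :
    ∑ I, f (I ∘ σ) = ∑ I, f I :=
  (Equiv.arrowCongr σ.symm (Equiv.refl ι)).sum_comp f

theorem tensorEval_symmetrize (T : (Fin n → ι) → ℝ) (v : EuclideanSpace ℝ ι) :
    tensorEval (symmetrize T) v = tensorEval T v := by
  simp only [tensorEval, symmetrize_apply, mul_assoc, Finset.sum_mul]
  rw [← Finset.mul_sum, Finset.sum_comm]
  have : ∀ σ : Equiv.Perm (Fin n), ∑ I : Fin n → ι, T (I ∘ σ) * ∏ k, v (I k) =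
      ∑ I, T I * ∏ k, v (I k) := fun σ => by
    rw [← sum_comp_perm σ fun I => T I * ∏ k, v (I k)]
    refine Finset.sum_congr rfl fun I _ => ?_
    rw [← Equiv.prod_comp σ fun k => v (I k)]
    rfl
  simp only [this, factorial_inv_mul_sum_const]

/-! ### The inner product of tensors -/

variable {H : Matrix ι ι ℝ}

theorem tensorInner_sub_left (S T X : (Fin n → ι) → ℝ) :
    tensorInner H (S - T) X = tensorInner H S X - tensorInner H T X := by
  simp [tensorInner, mul_sub, sub_mul, Finset.sum_sub_distrib]

theorem tensorInner_smul_left (c : ℝ) (S X : (Fin n → ι) → ℝ) :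
    tensorInner H (c • S) X = c * tensorInner H S X := by
  simp only [tensorInner, Finset.mul_sum, Pi.smul_apply, smul_eq_mul]
  exact Finset.sum_congr rfl fun I _ => Finset.sum_congr rfl fun J _ => by ring

theorem tensorInner_smul_right (c : ℝ) (S X : (Fin n → ι) → ℝ) :
    tensorInner H S (c • X) = c * tensorInner H S X := by
  simp only [tensorInner, Finset.mul_sum, Pi.smul_apply, smul_eq_mul]
  exact Finset.sum_congr rfl fun I _ => Finset.sum_congr rfl fun J _ => by ring

theorem tensorInner_sum_left {α : Type*} (s : Finset α) (S : α → (Fin n → ι) → ℝ)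
    (X : (Fin n → ι) → ℝ) :
    tensorInner H (∑ a ∈ s, S a) X = ∑ a ∈ s, tensorInner H (S a) X := by
  simp only [tensorInner, Finset.sum_apply, Finset.mul_sum, Finset.sum_mul]
  rw [Finset.sum_congr rfl fun I _ => Finset.sum_comm, Finset.sum_comm]

theorem tensorInner_sum_right {α : Type*} (s : Finset α) (S : (Fin n → ι) → ℝ)
    (X : α → (Fin n → ι) → ℝ) :
    tensorInner H S (∑ a ∈ s, X a) = ∑ a ∈ s, tensorInner H S (X a) := by
  simp only [tensorInner, Finset.sum_apply, Finset.mul_sum]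
  rw [Finset.sum_congr rfl fun I _ => Finset.sum_comm, Finset.sum_comm]

theorem tensorInner_zero_right (S : (Fin n → ι) → ℝ) : tensorInner H S 0 = 0 := by
  simp [tensorInner]

theorem tensorInner_succ (S X : (Fin (n + 1) → ι) → ℝ) :
    tensorInner H S X = ∑ a, ∑ c, H⁻¹ a c * tensorInner H (fun I : Fin n → ι => S (Fin.cons a I))
      (fun I : Fin n → ι => X (Fin.cons c I)) := by
  simp only [tensorInner, sum_fin_succ, Fin.prod_univ_succ, Fin.cons_zero, Fin.cons_succ,
    Finset.mul_sum]
  refine Finset.sum_congr rfl fun a _ => ?_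
  rw [Finset.sum_comm]
  exact Finset.sum_congr rfl fun c _ => Finset.sum_congr rfl fun I _ =>
    Finset.sum_congr rfl fun J _ => by ring

/-- The inner product is invariant under permuting the slots of both arguments simultaneously, and
the permutation is absorbed by the symmetric one. -/
theorem tensorInner_symmetrize {X : (Fin n → ι) → ℝ} (hX : IsSymmTensor X)
    (T : (Fin n → ι) → ℝ) : tensorInner H (symmetrize T) X = tensorInner H T X := by
  have key : ∀ σ : Equiv.Perm (Fin n), tensorInner H (fun I => T (I ∘ σ)) X = tensorInner H T X := by
    intro σ
    simp only [tensorInner]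
    refine Eq.trans ?_ (sum_comp_perm σ _)
    refine Finset.sum_congr rfl fun I _ => ?_
    refine Eq.trans ?_ (sum_comp_perm σ _)
    refine Finset.sum_congr rfl fun J _ => ?_
    rw [hX, ← Equiv.prod_comp σ fun k => H⁻¹ (I k) (J k)]
    rfl
  have : symmetrize T = (n.factorial : ℝ)⁻¹ • ∑ σ : Equiv.Perm (Fin n), fun I => T (I ∘ σ) := by
    funext I
    simp [symmetrize_apply]
  rw [this, tensorInner_smul_left, tensorInner_sum_left]
  simp only [key, factorial_inv_mul_sum_const]

/-! ### Multiplication by the metric and contraction -/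

/-- The product `H ⊗ Z` of the metric with a tensor. -/
def metricProd (H : Matrix ι ι ℝ) : ((Fin n → ι) → ℝ) →ₗ[ℝ] ((Fin (n + 2) → ι) → ℝ) where
  toFun Z I := H (I 0) (I 1) * Z (Fin.tail (Fin.tail I))
  map_add' Z Z' := by funext I; simp [mul_add]
  map_smul' c Z := by funext I; simp [mul_left_comm]

/-- The contraction of the first two indices of a tensor. -/
def metricTrace (H : Matrix ι ι ℝ) : ((Fin (n + 2) → ι) → ℝ) →ₗ[ℝ] ((Fin n → ι) → ℝ) where
  toFun Y I := ∑ a, ∑ b, H⁻¹ a b * Y (Fin.cons a (Fin.cons b I))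
  map_add' Z Z' := by funext I; simp [mul_add, Finset.sum_add_distrib]
  map_smul' c Z := by funext I; simp [mul_left_comm, Finset.mul_sum]

theorem metricProd_cons_cons (Z : (Fin n → ι) → ℝ) (a b : ι) (I : Fin n → ι) :
    metricProd H Z (Fin.cons a (Fin.cons b I)) = H a b * Z I := rfl

theorem metricTrace_apply (Y : (Fin (n + 2) → ι) → ℝ) (I : Fin n → ι) :
    metricTrace H Y I = ∑ a, ∑ b, H⁻¹ a b * Y (Fin.cons a (Fin.cons b I)) := rfl

theorem tensorEval_metricProd (Z : (Fin n → ι) → ℝ) (v : EuclideanSpace ℝ ι) :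
    tensorEval (metricProd H Z) v = (∑ i, ∑ j, H i j * (v i * v j)) * tensorEval Z v := by
  simp only [tensorEval_succ, metricProd_cons_cons, Finset.sum_mul, Finset.mul_sum]
  refine Finset.sum_congr rfl fun i _ => Finset.sum_congr rfl fun j _ => ?_
  simp only [tensorEval, Finset.mul_sum]
  exact Finset.sum_congr rfl fun I _ => by ring

theorem IsSymmTensor.metricTrace {Y : (Fin (n + 2) → ι) → ℝ} (hY : IsSymmTensor Y) :
    IsSymmTensor (metricTrace H Y) := fun σ I => by
  simp only [metricTrace_apply]
  exact Finset.sum_congr rfl fun a _ => Finset.sum_congr rfl fun b _ =>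
    congrArg _ (((hY.cons a).cons b) σ I)

/-- Multiplication by the metric and contraction are adjoint. Hence anything of the form `H ⊗ Z` is
orthogonal to trace-free tensors, the mechanism behind the whole trace-free calculus below. -/
theorem tensorInner_metricProd (hH : H.PosDef) (Z : (Fin n → ι) → ℝ)
    (X : (Fin (n + 2) → ι) → ℝ) :
    tensorInner H (metricProd H Z) X = tensorInner H Z (metricTrace H X) := by
  have hinv : ∀ c b, ∑ a, H⁻¹ a c * H a b = if c = b then 1 else 0 := fun c b => by
    have h1 : ∀ a, H⁻¹ a c = H⁻¹ c a := fun a => by simpa using (hH.inv.isHermitian.apply a c).symm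
    simp only [h1]
    rw [← Matrix.mul_apply, Matrix.nonsing_inv_mul _ hH.det_pos.ne'.isUnit, Matrix.one_apply]
  have hR : metricTrace H X =
      ∑ c, ∑ d, H⁻¹ c d • fun I : Fin n → ι => X (Fin.cons c (Fin.cons d I)) := by
    funext I
    simp [metricTrace_apply]
  have hL : ∀ a b, (fun I : Fin n → ι => metricProd H Z (Fin.cons a (Fin.cons b I))) =
      H a b • Z := fun a b => rfl
  rw [hR, tensorInner_sum_right, tensorInner_succ, Finset.sum_comm]
  refine Finset.sum_congr rfl fun c _ => ?_
  rw [tensorInner_sum_right]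
  simp only [tensorInner_succ (n := n), hL, tensorInner_smul_left, tensorInner_smul_right,
    Finset.mul_sum]
  rw [Finset.sum_comm, Finset.sum_congr rfl fun b _ => Finset.sum_comm, Finset.sum_comm]
  refine Finset.sum_congr rfl fun d _ => ?_
  have : ∀ b, ∑ a, H⁻¹ a c * (H⁻¹ b d * (H a b * tensorInner H Z fun I =>
      X (Fin.cons c (Fin.cons d I)))) = (if c = b then 1 else 0) * (H⁻¹ b d *
        tensorInner H Z fun I => X (Fin.cons c (Fin.cons d I))) := fun b => by
    rw [← hinv c b, Finset.sum_mul]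
    exact Finset.sum_congr rfl fun a _ => by ring
  rw [Finset.sum_congr rfl fun b _ => this b]
  simp

theorem IsSTF.metricTrace_eq_zero {X : (Fin (n + 2) → ι) → ℝ} (hX : IsSTF H X) :
    metricTrace H X = 0 := by
  funext I
  rw [metricTrace_apply]
  -- The trace condition is stated for a full multi-index with two entries overwritten, so some
  -- index `c` is needed to pad those two slots; without any index the sums are empty.
  rcases isEmpty_or_nonempty ι with h | ⟨⟨c⟩⟩
  · simp
  · refine Eq.trans ?_ (hX.traceFree 0 1 (by simp) (Fin.cons c (Fin.cons c I)))
    refine Finset.sum_congr rfl fun a _ => Finset.sum_congr rfl fun b _ => ?_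
    congr 2
    rw [Fin.update_cons_zero, ← Fin.succ_zero_eq_one, ← Fin.cons_update, Fin.update_cons_zero]

/-- For a symmetric tensor one vanishing trace suffices: a permutation carrying slots 0 and 1 to `k`
and `l` moves the contraction to any other pair. -/
theorem isSTF_of_metricTrace_eq_zero {X : (Fin (n + 2) → ι) → ℝ} (hX : IsSymmTensor X)
    (h : metricTrace H X = 0) : IsSTF H X := by
  refine ⟨hX, fun k l hkl I => ?_⟩
  have h01 : (0 : Fin (n + 2)) ≠ 1 := by simp
  set τ : Equiv.Perm (Fin (n + 2)) := Equiv.swap 0 k with hτ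
  set σ : Equiv.Perm (Fin (n + 2)) := Equiv.swap (τ 1) l * τ with hσ
  have hτ0 : τ 0 = k := Equiv.swap_apply_left 0 k
  have hσ1 : σ 1 = l := by simp [hσ]
  have hσ0 : σ 0 = k := by
    rw [hσ, Equiv.Perm.mul_apply, hτ0]
    refine Equiv.swap_apply_of_ne_of_ne ?_ hkl
    rw [← hτ0]
    exact fun h => h01 (τ.injective h)
  have key : ∀ a b, X (Function.update (Function.update I k a) l b) =
      X (Fin.cons a (Fin.cons b (Fin.tail (Fin.tail (I ∘ σ))))) := fun a b => by
    rw [← hX σ]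
    congr 1
    funext m
    refine Fin.cases ?_ (fun m => Fin.cases ?_ (fun m => ?_) m) m
    · simp [hσ0, Function.update_of_ne hkl]
    · simp [hσ1]
    · have h1 : σ m.succ.succ ≠ l := by
        rw [← hσ1]
        exact fun h => Fin.succ_succ_ne_one m (σ.injective h)
      have h2 : σ m.succ.succ ≠ k := by
        rw [← hσ0]
        exact fun h => by simpa using σ.injective h
      simp [Function.update_of_ne h1, Function.update_of_ne h2, Fin.tail]
  simp only [key]
  exact congrFun h _

end Tensors

/-! ### The trace-free projection: solving for the trace terms, divisibility by the metric, smooth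
dependence. -/

section TraceFree

variable {ι : Type} [Fintype ι] [DecidableEq ι] {n : ℕ} {H : Matrix ι ι ℝ}

/-! ### The symmetric trace-free part -/

theorem quadraticForm_pos (hH : H.PosDef) {v : EuclideanSpace ℝ ι} (hv : v ≠ 0) :
    0 < ∑ i, ∑ j, H i j * (v i * v j) := by
  have hv' : v.ofLp ≠ 0 := fun h => hv (by ext i; exact congrFun h i)
  refine (hH.dotProduct_mulVec_pos hv').trans_eq ?_
  simp only [dotProduct, Matrix.mulVec, Finset.mul_sum, star_trivial]
  exact Finset.sum_congr rfl fun i _ => Finset.sum_congr rfl fun j _ => by ring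

/-- On symmetric tensors this is `Z ↦ tr Sym (H ⊗ Z)`; it is the identity on tensors without
symmetric part. -/
def traceOperator (H : Matrix ι ι ℝ) : ((Fin n → ι) → ℝ) →ₗ[ℝ] ((Fin n → ι) → ℝ) :=
  metricTrace H ∘ₗ symmetrize ∘ₗ metricProd H ∘ₗ symmetrize + (LinearMap.id - symmetrize)

theorem traceOperator_apply (Z : (Fin n → ι) → ℝ) : traceOperator H Z =
    metricTrace H (symmetrize (metricProd H (symmetrize Z))) + (Z - symmetrize Z) := rfl

/-- The first summand of the operator is always symmetric, while `Z - symmetrize Z` has no symmetric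
part; a symmetric value forces the latter to vanish. -/
theorem isSymmTensor_of_traceOperator {Z : (Fin n → ι) → ℝ}
    (h : IsSymmTensor (traceOperator H Z)) : IsSymmTensor Z := by
  have h1 := h.symmetrize_eq
  rw [traceOperator_apply, map_add, map_sub,
    ((isSymmTensor_symmetrize _).metricTrace).symmetrize_eq,
    (isSymmTensor_symmetrize Z).symmetrize_eq, sub_self, add_zero, left_eq_add, sub_eq_zero] at h1
  rw [h1]
  exact isSymmTensor_symmetrize Z

/-- On the kernel, adjointness gives `|Sym (H ⊗ Z)|² = ⟨Z, tr Sym (H ⊗ Z)⟩ = 0`. The polynomial of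
`Sym (H ⊗ Z)` is the quadratic form times that of `Z`, and the form is positive away from 0. -/
theorem traceOperator_injective [Nonempty ι] (hH : H.PosDef) :
    Function.Injective (traceOperator H : ((Fin n → ι) → ℝ) →ₗ[ℝ] _) := by
  refine (injective_iff_map_eq_zero _).mpr fun Z hZ => ?_
  have hsymm : IsSymmTensor Z := isSymmTensor_of_traceOperator (H := H) (by
    rw [hZ]
    exact fun _ _ => rfl)
  rw [traceOperator_apply, hsymm.symmetrize_eq, sub_self, add_zero] at hZ
  have hY : symmetrize (metricProd H Z) = 0 := by
    refine eq_zero_of_tensorInner_self_nonpos hH (le_of_eq ?_)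
    rw [tensorInner_symmetrize (isSymmTensor_symmetrize _), tensorInner_metricProd hH, hZ,
      tensorInner_zero_right]
  refine hsymm.eq_zero_of_tensorEval fun v => ?_
  -- The quadratic form vanishes at `v = 0`, so it is cancelled on the dense set `v ≠ 0` only.
  have : tensorEval Z = fun _ => 0 := by
    refine Continuous.ext_on (dense_compl_singleton (0 : EuclideanSpace ℝ ι))
      (contDiff_tensorEval Z).continuous continuous_const fun v hv => ?_
    have h1 := tensorEval_symmetrize (metricProd H Z) v
    rw [hY, tensorEval_metricProd] at h1
    have h2 : (∑ i, ∑ j, H i j * (v i * v j)) * tensorEval Z v = 0 := by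
      rw [← h1]
      simp [tensorEval]
    exact (mul_eq_zero.mp h2).resolve_left (quadraticForm_pos hH hv).ne'
  exact congrFun this v

theorem stfPart_eq (hH : H.PosDef) {T S : (Fin n → ι) → ℝ} (h : IsSTFPart H T S) :
    stfPart H T = S := by
  have hex : ∃ S, IsSTFPart H T S := ⟨S, h⟩
  rw [stfPart, dif_pos hex]
  exact (existsUnique_isSTFPart hH T).unique hex.choose_spec h

theorem isSTF_stfPart (hH : H.PosDef) (T : (Fin n → ι) → ℝ) : IsSTF H (stfPart H T) := by
  obtain ⟨S, hS, -⟩ := existsUnique_isSTFPart hH T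
  rw [stfPart_eq hH hS]
  exact hS.1

theorem stfPart_eq_self (hH : H.PosDef) {T : (Fin n → ι) → ℝ} (h : IsSTF H T) :
    stfPart H T = T :=
  stfPart_eq hH ⟨h, fun X _ => by simp [tensorInner]⟩

theorem isSTF_zero_indices (T : (Fin 0 → ι) → ℝ) : IsSTF H T :=
  ⟨fun _ _ => congrArg T (Subsingleton.elim _ _), fun k => k.elim0⟩

theorem isSTF_one_index (T : (Fin 1 → ι) → ℝ) : IsSTF H T :=
  ⟨fun _ I => congrArg T (funext fun _ => congrArg I (Subsingleton.elim _ _)),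
    fun _ _ hkl => (hkl (Subsingleton.elim _ _)).elim⟩

/-- The equation for `Z` says exactly that `Sym (T - H ⊗ Z)` has zero trace; the subtracted term is
orthogonal to all trace-free tensors. This replaces the choice in the definition of `stfPart` by the
solution of a linear system. -/
theorem stfPart_eq_symmetrize (hH : H.PosDef) {T : (Fin (n + 2) → ι) → ℝ} {Z : (Fin n → ι) → ℝ}
    (hZ : traceOperator H Z = metricTrace H (symmetrize T)) :
    stfPart H T = symmetrize (T - metricProd H Z) := by
  have hsymm : IsSymmTensor Z := isSymmTensor_of_traceOperator (H := H) (by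
    rw [hZ]
    exact (isSymmTensor_symmetrize T).metricTrace)
  rw [traceOperator_apply, hsymm.symmetrize_eq, sub_self, add_zero] at hZ
  refine stfPart_eq hH ⟨isSTF_of_metricTrace_eq_zero (isSymmTensor_symmetrize _) ?_,
    fun X hX => ?_⟩
  · rw [map_sub, map_sub, hZ, sub_self]
  · rw [tensorInner_sub_left, tensorInner_symmetrize hX.symm, tensorInner_sub_left,
      tensorInner_metricProd hH, hX.metricTrace_eq_zero, tensorInner_zero_right]
    ring

theorem tensorEval_sub (S T : (Fin n → ι) → ℝ) (v : EuclideanSpace ℝ ι) :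
    tensorEval (S - T) v = tensorEval S v - tensorEval T v := by
  simp [tensorEval, sub_mul]

theorem tensorEval_smul (S : (Fin n → ι) → ℝ) (t : ℝ) (v : EuclideanSpace ℝ ι) :
    tensorEval S (t • v) = t ^ n * tensorEval S v := by
  simp only [tensorEval, PiLp.smul_apply, smul_eq_mul, Finset.prod_mul_distrib, Finset.prod_const,
    Finset.card_univ, Fintype.card_fin, Finset.mul_sum]
  exact Finset.sum_congr rfl fun I _ => by ring

/-- The homogeneous polynomial given by a derivative at the origin. -/
theorem tensorEval_iteratedFDeriv (Z : EuclideanSpace ℝ ι → ℝ) (v : EuclideanSpace ℝ ι) :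
    tensorEval (fun I : Fin n → ι => iteratedFDeriv ℝ n Z 0 fun k =>
      EuclideanSpace.single (I k) 1) v = iteratedFDeriv ℝ n Z 0 fun _ => v := by
  conv_rhs => rw [← sum_smul_single v]
  rw [ContinuousMultilinearMap.map_sum]
  simp only [ContinuousMultilinearMap.map_smul_univ, tensorEval, smul_eq_mul]
  exact Finset.sum_congr rfl fun I _ => by ring

/-- A symmetric trace-free tensor whose associated polynomial is a multiple of the metric
vanishes. -/
theorem IsSTF.eq_zero_of_tensorEval_eq (hH : H.PosDef) {S : (Fin n → ι) → ℝ} (hS : IsSTF H S)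
    {Z : EuclideanSpace ℝ ι → ℝ} (hZ : ContDiff ℝ ∞ Z)
    (h : ∀ v : EuclideanSpace ℝ ι, tensorEval S v = (∑ i, ∑ j, H i j * (v i * v j)) * Z v) :
    S = 0 := by
  have hq : ∀ (t : ℝ) (v : EuclideanSpace ℝ ι), ∑ i, ∑ j, H i j * ((t • v) i * (t • v) j) =
      t ^ 2 * ∑ i, ∑ j, H i j * (v i * v j) := fun t v => by
    simp only [PiLp.smul_apply, smul_eq_mul, Finset.mul_sum]
    exact Finset.sum_congr rfl fun i _ => Finset.sum_congr rfl fun j _ => by ring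
  -- `Z` is merely smooth, so its degree of homogeneity has to be extracted by comparing powers of
  -- `t` along rays.
  have hscale : ∀ (t : ℝ) (v : EuclideanSpace ℝ ι), t ^ n * tensorEval S v =
      t ^ 2 * (∑ i, ∑ j, H i j * (v i * v j)) * Z (t • v) := fun t v => by
    rw [← tensorEval_smul, h, hq]
  have hcont : ∀ v : EuclideanSpace ℝ ι, Continuous fun t : ℝ => Z (t • v) := fun v =>
    hZ.continuous.comp (continuous_id.smul continuous_const)
  -- In ranks 0 and 1 the left side is of lower order in `t` than the factor `t ^ 2`, so it vanishes
  -- on letting `t = 0`, after dividing by `t` in rank 1.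
  match n, S, hS with
  | 0, S, hS =>
    refine IsSymmTensor.eq_zero_of_tensorEval hS.symm fun v => ?_
    simpa using hscale 0 v
  | 1, S, hS =>
    refine IsSymmTensor.eq_zero_of_tensorEval hS.symm fun v => ?_
    have : (fun _ : ℝ => tensorEval S v) =
        fun t => t * (∑ i, ∑ j, H i j * (v i * v j)) * Z (t • v) := by
      refine Continuous.ext_on (dense_compl_singleton (0 : ℝ)) continuous_const
        ((continuous_id.mul continuous_const).mul (hcont v)) fun t ht => ?_
      refine mul_left_cancel₀ (show t ≠ 0 from ht) ?_
      have := hscale t v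
      rw [pow_one] at this
      simp only [this]
      ring
    simpa using congrFun this 0
  | m + 2, S, hS =>
    have hfac : (m.factorial : ℝ) ≠ 0 := by positivity
    -- Off the origin `Z (t • v) = t ^ m * Z v`, so `Z` agrees there with the degree-`m` term of its
    -- Taylor expansion at 0. It is thus the polynomial of the tensor `Z'` introduced next.
    have hpoly : ∀ v : EuclideanSpace ℝ ι, v ≠ 0 →
        iteratedFDeriv ℝ m Z 0 (fun _ => v) = m.factorial * Z v := by
      intro v hv
      have hpow : (fun t : ℝ => Z (t • v)) = fun t => Z v * t ^ m := by
        refine Continuous.ext_on (dense_compl_singleton (0 : ℝ)) (hcont v) (by fun_prop)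
          fun t ht => ?_
        have h1 := hscale t v
        rw [h v] at h1
        have h2 := (quadraticForm_pos hH hv).ne'
        have h3 : t ^ 2 * (∑ i, ∑ j, H i j * (v i * v j)) ≠ 0 :=
          mul_ne_zero (pow_ne_zero 2 ht) h2
        refine mul_left_cancel₀ h3 ?_
        simp only [← h1]
        ring
      have h4 := ContinuousLinearMap.iteratedFDeriv_comp_right (i := m)
        (ContinuousLinearMap.toSpanSingleton ℝ v) hZ 0 (by exact_mod_cast le_top)
      have h5 : (Z ∘ ContinuousLinearMap.toSpanSingleton ℝ v) = fun t : ℝ => Z v * t ^ m := by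
        rw [← hpow]
        rfl
      have h6 : iteratedDeriv m (fun t : ℝ => Z v * t ^ m) 0 =
          iteratedFDeriv ℝ m Z 0 fun _ => v := by
        rw [iteratedDeriv_eq_iteratedFDeriv, ← h5, h4]
        simp
      rw [← h6, iteratedDeriv_const_mul_field, iteratedDeriv_pow]
      simp [Nat.descFactorial_self, mul_comm]
    set Z' : (Fin m → ι) → ℝ := (m.factorial : ℝ)⁻¹ • fun I => iteratedFDeriv ℝ m Z 0 fun k =>
      EuclideanSpace.single (I k) 1 with hZ'
    have hsm : ∀ v, tensorEval Z' v = (m.factorial : ℝ)⁻¹ * iteratedFDeriv ℝ m Z 0 fun _ => v := by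
      intro v
      rw [← tensorEval_iteratedFDeriv]
      simp [tensorEval, hZ', Finset.mul_sum, mul_assoc]
    have heq : S = symmetrize (metricProd H Z') := by
      rw [← sub_eq_zero]
      refine IsSymmTensor.eq_zero_of_tensorEval (fun σ I => ?_) fun v => ?_
      · simp only [Pi.sub_apply]
        rw [hS.symm σ I, isSymmTensor_symmetrize _ σ I]
      · rw [tensorEval_sub, tensorEval_symmetrize, tensorEval_metricProd, h v, hsm]
        by_cases hv : v = 0
        · simp [hv]
        · rw [hpoly v hv]
          field_simp
          ring
    -- Now `⟨S, S⟩ = ⟨Sym (H ⊗ Z'), S⟩ = ⟨Z', tr S⟩ = 0`.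
    refine eq_zero_of_tensorInner_self_nonpos hH (le_of_eq ?_)
    conv_lhs => enter [2]; rw [heq]
    rw [tensorInner_symmetrize hS.symm, tensorInner_metricProd hH, hS.metricTrace_eq_zero,
      tensorInner_zero_right]

/-! ### Smooth dependence on the metric -/

section Smooth

variable {E : Type*} [NormedAddCommGroup E] [NormedSpace ℝ E] {s : Set E}

theorem contDiffOn_symmetrize {T : E → (Fin n → ι) → ℝ}
    (hT : ∀ I, ContDiffOn ℝ ∞ (fun x => T x I) s) (I : Fin n → ι) :
    ContDiffOn ℝ ∞ (fun x => symmetrize (T x) I) s := by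
  simp only [symmetrize_apply]
  exact contDiffOn_const.mul (ContDiffOn.sum fun σ _ => hT _)

variable {U : Set (EuclideanSpace ℝ ι)} {g : EuclideanSpace ℝ ι → Matrix ι ι ℝ}

theorem contDiffOn_metricProd (hg : IsSmoothMetricOn g U) {T : EuclideanSpace ℝ ι → (Fin n → ι) → ℝ}
    (hT : ∀ I, ContDiffOn ℝ ∞ (fun x => T x I) U) (I : Fin (n + 2) → ι) :
    ContDiffOn ℝ ∞ (fun x => metricProd (g x) (T x) I) U :=
  (hg.smooth _ _).mul (hT _)

theorem contDiffOn_metricTrace (hg : IsSmoothMetricOn g U)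
    {T : EuclideanSpace ℝ ι → (Fin (n + 2) → ι) → ℝ}
    (hT : ∀ I, ContDiffOn ℝ ∞ (fun x => T x I) U) (I : Fin n → ι) :
    ContDiffOn ℝ ∞ (fun x => metricTrace (g x) (T x) I) U :=
  ContDiffOn.sum fun a _ => ContDiffOn.sum fun b _ => (hg.contDiffOn_inv a b).mul (hT _)

/-- The trace term solves a linear system with invertible matrix and smooth coefficients, so
Cramer's rule makes it smooth in the base point. -/
theorem contDiffOn_stfPart_aux [Nonempty ι] (hg : IsSmoothMetricOn g U)
    {T : EuclideanSpace ℝ ι → (Fin (n + 2) → ι) → ℝ}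
    (hT : ∀ I, ContDiffOn ℝ ∞ (fun x => T x I) U) :
    ∃ Z : EuclideanSpace ℝ ι → (Fin n → ι) → ℝ, (∀ I, ContDiffOn ℝ ∞ (fun x => Z x I) U) ∧
      ∀ x ∈ U, stfPart (g x) (T x) = symmetrize (T x - metricProd (g x) (Z x)) := by
  -- Because `traceOperator` is invertible on all tensors, not only on symmetric ones, its matrix in
  -- the standard basis can be used and no basis of the symmetric tensors is needed.
  set M : EuclideanSpace ℝ ι → Matrix (Fin n → ι) (Fin n → ι) ℝ := fun x =>
    LinearMap.toMatrix' (traceOperator (g x)) with hM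
  have hMs : ∀ I J, ContDiffOn ℝ ∞ (fun x => M x I J) U := fun I J => by
    simp only [hM, LinearMap.toMatrix'_apply, traceOperator_apply, Pi.add_apply, Pi.sub_apply]
    have hc : ∀ (Y : (Fin n → ι) → ℝ) K, ContDiffOn ℝ ∞
        (fun _ : EuclideanSpace ℝ ι => Y K) U := fun Y K => contDiffOn_const
    exact (contDiffOn_metricTrace hg (contDiffOn_symmetrize
      (contDiffOn_metricProd hg (hc _))) I).add contDiffOn_const
  have hMdet : ∀ x ∈ U, IsUnit (M x).det := fun x hx => by
    rw [← Matrix.isUnit_iff_isUnit_det, ← Matrix.mulVec_injective_iff_isUnit]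
    intro v w hvw
    simp only [hM, LinearMap.toMatrix'_mulVec] at hvw
    exact traceOperator_injective (hg.posDef x hx) hvw
  refine ⟨fun x => (M x)⁻¹.mulVec (metricTrace (g x) (symmetrize (T x))), fun I => ?_,
    fun x hx => stfPart_eq_symmetrize (hg.posDef x hx) ?_⟩
  · simp only [Matrix.mulVec, dotProduct]
    exact ContDiffOn.sum fun J _ => (ContDiffOn.matrix_inv hMs
      (fun x hx => (hMdet x hx).ne_zero) I J).mul
      (contDiffOn_metricTrace hg (contDiffOn_symmetrize hT) J)
  · rw [← LinearMap.toMatrix'_mulVec, Matrix.mulVec_mulVec,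
      Matrix.mul_nonsing_inv _ (hMdet x hx), Matrix.one_mulVec]

theorem contDiffOn_stfPart [Nonempty ι] (hg : IsSmoothMetricOn g U)
    {T : EuclideanSpace ℝ ι → (Fin n → ι) → ℝ} (hT : ∀ I, ContDiffOn ℝ ∞ (fun x => T x I) U)
    (I : Fin n → ι) : ContDiffOn ℝ ∞ (fun x => stfPart (g x) (T x) I) U := by
  match n, T, hT, I with
  | 0, T, hT, I =>
    exact (hT I).congr fun x hx => by rw [stfPart_eq_self (hg.posDef x hx) (isSTF_zero_indices _)]
  | 1, T, hT, I =>
    exact (hT I).congr fun x hx => by rw [stfPart_eq_self (hg.posDef x hx) (isSTF_one_index _)]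
  | n + 2, T, hT, I =>
    obtain ⟨Z, hZ, h⟩ := contDiffOn_stfPart_aux hg hT
    refine (contDiffOn_symmetrize (T := fun x => T x - metricProd (g x) (Z x)) (fun J => ?_)
      I).congr fun x hx => by rw [h x hx]
    exact (hT J).sub (contDiffOn_metricProd hg hZ J)

/-- Up to multiples of the metric, taking the symmetric trace-free part does not change full
contractions. -/
theorem exists_tensorEval_stfPart [Nonempty ι] (hg : IsSmoothMetricOn g U)
    {T : EuclideanSpace ℝ ι → (Fin n → ι) → ℝ} (hT : ∀ I, ContDiffOn ℝ ∞ (fun x => T x I) U) :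
    ∃ Z : EuclideanSpace ℝ ι × EuclideanSpace ℝ ι → ℝ, ContDiffOn ℝ ∞ Z (Prod.fst ⁻¹' U) ∧
      ∀ p : EuclideanSpace ℝ ι × EuclideanSpace ℝ ι, p.1 ∈ U →
        tensorEval (stfPart (g p.1) (T p.1)) p.2 =
          tensorEval (T p.1) p.2 + metricForm g p * Z p := by
  match n, T, hT with
  | 0, T, hT =>
    exact ⟨fun _ => 0, contDiffOn_const, fun p hp => by
      rw [stfPart_eq_self (hg.posDef _ hp) (isSTF_zero_indices _)]; simp⟩
  | 1, T, hT =>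
    exact ⟨fun _ => 0, contDiffOn_const, fun p hp => by
      rw [stfPart_eq_self (hg.posDef _ hp) (isSTF_one_index _)]; simp⟩
  | n + 2, T, hT =>
    obtain ⟨Z, hZ, h⟩ := contDiffOn_stfPart_aux hg hT
    refine ⟨fun p => -tensorEval (Z p.1) p.2, (contDiffOn_tensorEval hZ).neg, fun p hp => ?_⟩
    rw [h _ hp, tensorEval_symmetrize, tensorEval_sub, tensorEval_metricProd, metricForm]
    ring

end Smooth

end TraceFree

/-! ### The recursion as a dynamical system on the tangent bundle, and the ideal argument. -/

section Moments

variable {ι : Type} [Fintype ι] [DecidableEq ι] {U : Set (EuclideanSpace ℝ ι)}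
  {g : EuclideanSpace ℝ ι → Matrix ι ι ℝ}

/-! ### The multipole recursion on full contractions -/

theorem contDiffOn_covDeriv (hg : IsSmoothMetricOn g U) {n : ℕ}
    {T : EuclideanSpace ℝ ι → (Fin n → ι) → ℝ} (hT : ∀ I, ContDiffOn ℝ ∞ (fun x => T x I) U)
    (I : Fin (n + 1) → ι) : ContDiffOn ℝ ∞ (fun x => covDeriv g T x I) U :=
  (ContDiffOn.pderiv hg.isOpen (hT _) _).sub (ContDiffOn.sum fun _ _ => ContDiffOn.sum fun _ _ =>
    (hg.contDiffOn_christoffel _ _ _).mul (hT _))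

/-- The Ricci tensor as a quadratic function on the tangent bundle. -/
def ricciForm (g : EuclideanSpace ℝ ι → Matrix ι ι ℝ)
    (p : EuclideanSpace ℝ ι × EuclideanSpace ℝ ι) : ℝ :=
  ∑ i, ∑ j, ricci g p.1 i j * (p.2 i * p.2 j)

theorem contDiffOn_ricciForm (hg : IsSmoothMetricOn g U) :
    ContDiffOn ℝ ∞ (ricciForm g) (Prod.fst ⁻¹' U) :=
  ContDiffOn.sum fun i _ => ContDiffOn.sum fun j _ =>
    (ContDiffOn.comp_fst (hg.contDiffOn_ricci i j)).mul
      ((contDiff_snd_apply i).mul (contDiff_snd_apply j)).contDiffOn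

variable [Nonempty ι]

theorem contDiffOn_multipoleTensor (hg : IsSmoothMetricOn g U) {φ : EuclideanSpace ℝ ι → ℝ}
    (hφ : ContDiffOn ℝ ∞ φ U) : ∀ (n : ℕ) (I : Fin n → ι),
      ContDiffOn ℝ ∞ (fun x => multipoleTensor g φ n x I) U
  | 0, _ => hφ
  | 1, I => contDiffOn_stfPart hg (contDiffOn_covDeriv hg (contDiffOn_multipoleTensor hg hφ 0)) I
  | n + 2, I => contDiffOn_stfPart hg (fun J =>
      (contDiffOn_covDeriv hg (contDiffOn_multipoleTensor hg hφ (n + 1)) J).sub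
        (contDiffOn_const.mul ((hg.contDiffOn_ricci _ _).mul
          (contDiffOn_multipoleTensor hg hφ n _)))) I

theorem isSTF_multipoleTensor (hg : IsSmoothMetricOn g U) (φ : EuclideanSpace ℝ ι → ℝ)
    {x : EuclideanSpace ℝ ι} (hx : x ∈ U) : ∀ n : ℕ, IsSTF (g x) (multipoleTensor g φ n x)
  | 0 => isSTF_zero_indices _
  | 1 => isSTF_stfPart (hg.posDef x hx) _
  | _ + 2 => isSTF_stfPart (hg.posDef x hx) _

theorem exists_tensorEval_multipoleTensor_one (hg : IsSmoothMetricOn g U)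
    {φ : EuclideanSpace ℝ ι → ℝ} (hφ : ContDiffOn ℝ ∞ φ U) :
    ∃ Z : EuclideanSpace ℝ ι × EuclideanSpace ℝ ι → ℝ, ContDiffOn ℝ ∞ Z (Prod.fst ⁻¹' U) ∧
      ∀ p : EuclideanSpace ℝ ι × EuclideanSpace ℝ ι, p.1 ∈ U →
        tensorEval (multipoleTensor g φ 1 p.1) p.2 =
          spray g (fun p => tensorEval (multipoleTensor g φ 0 p.1) p.2) p +
            metricForm g p * Z p := by
  have h0 := contDiffOn_multipoleTensor hg hφ 0
  obtain ⟨Z, hZ, h⟩ := exists_tensorEval_stfPart hg (contDiffOn_covDeriv hg h0)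
  exact ⟨Z, hZ, fun p hp => by rw [← tensorEval_covDeriv hg h0 hp, ← h p hp]; rfl⟩

/-- For the ideal argument only the shape matters: the recursion is linear in the potential, and its
Ricci term is a smooth multiple of the function of rank `n`. -/
theorem exists_tensorEval_multipoleTensor_add_two (hg : IsSmoothMetricOn g U)
    {φ : EuclideanSpace ℝ ι → ℝ} (hφ : ContDiffOn ℝ ∞ φ U) (n : ℕ) :
    ∃ Z : EuclideanSpace ℝ ι × EuclideanSpace ℝ ι → ℝ, ContDiffOn ℝ ∞ Z (Prod.fst ⁻¹' U) ∧
      ∀ p : EuclideanSpace ℝ ι × EuclideanSpace ℝ ι, p.1 ∈ U →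
        tensorEval (multipoleTensor g φ (n + 2) p.1) p.2 =
          spray g (fun p => tensorEval (multipoleTensor g φ (n + 1) p.1) p.2) p -
            ((n + 1 : ℝ) * (2 * n + 1) / 2) * (ricciForm g p *
              tensorEval (multipoleTensor g φ n p.1) p.2) + metricForm g p * Z p := by
  have h0 := contDiffOn_multipoleTensor hg hφ n
  have h1 := contDiffOn_multipoleTensor hg hφ (n + 1)
  obtain ⟨Z, hZ, h⟩ := exists_tensorEval_stfPart hg (T := fun x I =>
      covDeriv g (multipoleTensor g φ (n + 1)) x I - ((n + 1 : ℝ) * (2 * n + 1) / 2) *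
          (ricci g x (I 0) (I 1) * multipoleTensor g φ n x (Fin.tail (Fin.tail I)))) fun J =>
      (contDiffOn_covDeriv hg h1 J).sub
        (contDiffOn_const.mul ((hg.contDiffOn_ricci _ _).mul (h0 _)))
  refine ⟨Z, hZ, fun p hp => (h p hp).trans ?_⟩
  rw [← tensorEval_covDeriv hg h1 hp]
  congr 1
  have hric : tensorEval (fun I : Fin (n + 2) → ι => ricci g p.1 (I 0) (I 1) *
      multipoleTensor g φ n p.1 (Fin.tail (Fin.tail I))) p.2 =
      -- The product formula for contractions needs neither symmetry nor positivity of the matrix,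
      -- so it applies with the Ricci tensor in place of the metric.
      ricciForm g p * tensorEval (multipoleTensor g φ n p.1) p.2 :=
    tensorEval_metricProd (H := Matrix.of (ricci g p.1)) (multipoleTensor g φ n p.1) p.2
  rw [← hric]
  simp only [tensorEval, sub_mul, Finset.sum_sub_distrib, Finset.mul_sum, mul_assoc]

/-! ### The ideal generated by the conformal factor, its differential and the metric -/

/-- Membership in the ideal of the ring of smooth functions on `U × ℝ^ι` which is generated by
`a`, `b` and `c`. -/
def MemIdeal (U : Set (EuclideanSpace ℝ ι))
    (a b c F : EuclideanSpace ℝ ι × EuclideanSpace ℝ ι → ℝ) : Prop :=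
  ∃ A B C : EuclideanSpace ℝ ι × EuclideanSpace ℝ ι → ℝ, ContDiffOn ℝ ∞ A (Prod.fst ⁻¹' U) ∧
    ContDiffOn ℝ ∞ B (Prod.fst ⁻¹' U) ∧ ContDiffOn ℝ ∞ C (Prod.fst ⁻¹' U) ∧
      ∀ p : EuclideanSpace ℝ ι × EuclideanSpace ℝ ι, p.1 ∈ U →
        F p = a p * A p + b p * B p + c p * C p

namespace MemIdeal

variable {a b c F G : EuclideanSpace ℝ ι × EuclideanSpace ℝ ι → ℝ}

theorem sub (hF : MemIdeal U a b c F) (hG : MemIdeal U a b c G) :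
    MemIdeal U a b c fun p => F p - G p := by
  obtain ⟨A, B, C, hA, hB, hC, h⟩ := hF
  obtain ⟨A', B', C', hA', hB', hC', h'⟩ := hG
  exact ⟨_, _, _, hA.sub hA', hB.sub hB', hC.sub hC', fun p hp => by simp only [h p hp, h' p hp]; ring⟩

theorem add (hF : MemIdeal U a b c F) (hG : MemIdeal U a b c G) :
    MemIdeal U a b c fun p => F p + G p := by
  obtain ⟨A, B, C, hA, hB, hC, h⟩ := hF
  obtain ⟨A', B', C', hA', hB', hC', h'⟩ := hG
  exact ⟨_, _, _, hA.add hA', hB.add hB', hC.add hC', fun p hp => by simp only [h p hp, h' p hp]; ring⟩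

theorem mul_left (hF : MemIdeal U a b c F) (hG : ContDiffOn ℝ ∞ G (Prod.fst ⁻¹' U)) :
    MemIdeal U a b c fun p => G p * F p := by
  obtain ⟨A, B, C, hA, hB, hC, h⟩ := hF
  exact ⟨_, _, _, hG.mul hA, hG.mul hB, hG.mul hC, fun p hp => by simp only [h p hp]; ring⟩

theorem congr (hF : MemIdeal U a b c F)
    (h : ∀ p : EuclideanSpace ℝ ι × EuclideanSpace ℝ ι, p.1 ∈ U → G p = F p) :
    MemIdeal U a b c G := by
  obtain ⟨A, B, C, hA, hB, hC, h'⟩ := hF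
  exact ⟨A, B, C, hA, hB, hC, fun p hp => by rw [h p hp, h' p hp]⟩

theorem of_mul_first (hG : ContDiffOn ℝ ∞ G (Prod.fst ⁻¹' U)) :
    MemIdeal U a b c fun p => a p * G p :=
  ⟨G, fun _ => 0, fun _ => 0, hG, contDiffOn_const, contDiffOn_const, fun p _ => by simp⟩

theorem of_mul_second (hG : ContDiffOn ℝ ∞ G (Prod.fst ⁻¹' U)) :
    MemIdeal U a b c fun p => b p * G p :=
  ⟨fun _ => 0, G, fun _ => 0, contDiffOn_const, hG, contDiffOn_const, fun p _ => by simp⟩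

theorem of_mul_third (hG : ContDiffOn ℝ ∞ G (Prod.fst ⁻¹' U)) :
    MemIdeal U a b c fun p => c p * G p :=
  ⟨fun _ => 0, fun _ => 0, G, contDiffOn_const, contDiffOn_const, hG, fun p _ => by simp⟩

/-- A derivation preserves an ideal as soon as it maps the generators into it, by the Leibniz rule.
-/
theorem spray (hg : IsSmoothMetricOn g U) (ha : ContDiffOn ℝ ∞ a (Prod.fst ⁻¹' U))
    (hb : ContDiffOn ℝ ∞ b (Prod.fst ⁻¹' U)) (hc : ContDiffOn ℝ ∞ c (Prod.fst ⁻¹' U))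
    (hsa : MemIdeal U a b c (spray g a)) (hsb : MemIdeal U a b c (spray g b))
    (hsc : MemIdeal U a b c (Multipole.spray g c)) (hF : MemIdeal U a b c F) :
    MemIdeal U a b c (Multipole.spray g F) := by
  obtain ⟨A, B, C, hA, hB, hC, h⟩ := hF
  refine ((((hsa.mul_left hA).add (of_mul_first (ContDiffOn.spray hg hA))).add
    ((hsb.mul_left hB).add (of_mul_second (ContDiffOn.spray hg hB)))).add
    ((hsc.mul_left hC).add (of_mul_third (ContDiffOn.spray hg hC)))).congr fun p hp => ?_
  have hd : ∀ {G}, ContDiffOn ℝ ∞ G (Prod.fst ⁻¹' U) → DifferentiableAt ℝ G p := fun hG =>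
    ContDiffOn.differentiableAt_fst hg.isOpen hG hp
  rw [spray_congr hg.isOpen h hp,
    spray_add (((hd ha).fun_mul (hd hA)).fun_add ((hd hb).fun_mul (hd hB)))
      ((hd hc).fun_mul (hd hC)),
    spray_add ((hd ha).fun_mul (hd hA)) ((hd hb).fun_mul (hd hB)),
    spray_mul (hd ha) (hd hA), spray_mul (hd hb) (hd hB), spray_mul (hd hc) (hd hC)]
  ring

end MemIdeal

/-- The differential of `f` as a function on the tangent bundle. -/
def diffForm (f : EuclideanSpace ℝ ι → ℝ) (p : EuclideanSpace ℝ ι × EuclideanSpace ℝ ι) : ℝ :=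
  ∑ i, p.2 i * pderiv i f p.1

theorem contDiffOn_diffForm (hU : IsOpen U) {f : EuclideanSpace ℝ ι → ℝ}
    (hf : ContDiffOn ℝ ∞ f U) : ContDiffOn ℝ ∞ (diffForm f) (Prod.fst ⁻¹' U) :=
  ContDiffOn.sum fun i _ => (contDiff_snd_apply i).contDiffOn.mul
    (ContDiffOn.comp_fst (ContDiffOn.pderiv hU hf i))

theorem spray_sub {F G : EuclideanSpace ℝ ι × EuclideanSpace ℝ ι → ℝ}
    {p : EuclideanSpace ℝ ι × EuclideanSpace ℝ ι}
    (hF : DifferentiableAt ℝ F p) (hG : DifferentiableAt ℝ G p) :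
    spray g (fun p => F p - G p) p = spray g F p - spray g G p := by
  simp [spray, fderiv_fun_sub hF hG]

/-- Two potentials which differ by a multiple of the conformal factor `Ω` produce the same moments
at a critical zero of `Ω`, provided that along the geodesic spray the second derivative of `Ω` lies
in the ideal generated by `Ω`, `dΩ` and the metric. -/
theorem multipoleTensor_eq_of_memIdeal (hg : IsSmoothMetricOn g U)
    {Ω f φ ψ : EuclideanSpace ℝ ι → ℝ} (hΩ : ContDiffOn ℝ ∞ Ω U) (hf : ContDiffOn ℝ ∞ f U)
    (hφ : ContDiffOn ℝ ∞ φ U) (hψ : ContDiffOn ℝ ∞ ψ U)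
    (hdiff : ∀ x ∈ U, φ x - ψ x = Ω x * f x)
    (hess : MemIdeal U (fun p => Ω p.1) (diffForm Ω) (metricForm g) (spray g (diffForm Ω)))
    {x₀ : EuclideanSpace ℝ ι} (hx₀ : x₀ ∈ U) (hΩ₀ : Ω x₀ = 0)
    (hdΩ₀ : ∀ i, pderiv i Ω x₀ = 0) (n : ℕ) :
    multipoleTensor g φ n x₀ = multipoleTensor g ψ n x₀ := by
  have hΩ' := ContDiffOn.comp_fst hΩ
  have hdΩ := contDiffOn_diffForm hg.isOpen hΩ
  have hq := contDiffOn_metricForm hg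
  have hspray : ∀ {F}, MemIdeal U (fun p => Ω p.1) (diffForm Ω) (metricForm g) F →
      MemIdeal U (fun p => Ω p.1) (diffForm Ω) (metricForm g) (spray g F) := fun hF => by
    -- On the generators: the derivative of `Ω` is `dΩ`, that of `dΩ` is covered by `hess`, and that
    -- of the metric is zero.
    refine MemIdeal.spray hg hΩ' hdΩ hq ?_ hess ?_ hF
    · refine (MemIdeal.of_mul_second (G := fun _ => 1) contDiffOn_const).congr fun p hp => ?_
      rw [spray_comp_fst (contDiffOn_differentiableAt hg.isOpen hΩ hp), mul_one]
      rfl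
    · refine (MemIdeal.of_mul_third (G := fun _ => 0) contDiffOn_const).congr fun p hp => ?_
      rw [spray_metricForm hg hp, mul_zero]
  have hev : ∀ {χ : EuclideanSpace ℝ ι → ℝ} (_ : ContDiffOn ℝ ∞ χ U) (m : ℕ), ContDiffOn ℝ ∞
      (fun p : EuclideanSpace ℝ ι × EuclideanSpace ℝ ι =>
        tensorEval (multipoleTensor g χ m p.1) p.2) (Prod.fst ⁻¹' U) := fun hχ m =>
    contDiffOn_tensorEval (contDiffOn_multipoleTensor hg hχ m)
  have hspray' : ∀ m, MemIdeal U (fun p => Ω p.1) (diffForm Ω) (metricForm g) (fun p =>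
      tensorEval (multipoleTensor g φ m p.1) p.2 - tensorEval (multipoleTensor g ψ m p.1) p.2) →
      MemIdeal U (fun p => Ω p.1) (diffForm Ω) (metricForm g) (fun p =>
        spray g (fun p => tensorEval (multipoleTensor g φ m p.1) p.2) p -
          spray g (fun p => tensorEval (multipoleTensor g ψ m p.1) p.2) p) := fun m hm =>
    (hspray hm).congr fun p hp => (spray_sub
      (ContDiffOn.differentiableAt_fst hg.isOpen (hev hφ m) hp)
      (ContDiffOn.differentiableAt_fst hg.isOpen (hev hψ m) hp)).symm
  have key : ∀ m, MemIdeal U (fun p => Ω p.1) (diffForm Ω) (metricForm g) fun p =>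
      tensorEval (multipoleTensor g φ m p.1) p.2 -
        tensorEval (multipoleTensor g ψ m p.1) p.2 := by
    intro m
    -- Strong induction, since the Ricci term reaches back two ranks. The trace terms `Z` and `Z'`
    -- of the two potentials differ, but both are multiplied by the metric.
    induction m using Nat.strong_induction_on with
    | _ m ih =>
      match m, ih with
      | 0, _ =>
        refine (MemIdeal.of_mul_first (ContDiffOn.comp_fst hf)).congr fun p hp => ?_
        rw [← hdiff p.1 hp]
        simp [tensorEval, multipoleTensor]
      | 1, ih =>
        obtain ⟨Z, hZ, h⟩ := exists_tensorEval_multipoleTensor_one hg hφ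
        obtain ⟨Z', hZ', h'⟩ := exists_tensorEval_multipoleTensor_one hg hψ
        refine ((hspray' 0 (ih 0 one_pos)).add (MemIdeal.of_mul_third (hZ.sub hZ'))).congr
          fun p hp => ?_
        rw [h p hp, h' p hp]
        ring
      | m + 2, ih =>
        obtain ⟨Z, hZ, h⟩ := exists_tensorEval_multipoleTensor_add_two hg hφ m
        obtain ⟨Z', hZ', h'⟩ := exists_tensorEval_multipoleTensor_add_two hg hψ m
        refine (((hspray' (m + 1) (ih (m + 1) (by omega))).sub ((ih m (by omega)).mul_left
          ((contDiffOn_ricciForm hg).const_smul ((m + 1 : ℝ) * (2 * m + 1) / 2)))).add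
          (MemIdeal.of_mul_third (hZ.sub hZ'))).congr fun p hp => ?_
        rw [h p hp, h' p hp]
        simp only [smul_eq_mul]
        ring
  obtain ⟨A, B, C, -, -, hC, h⟩ := key n
  rw [← sub_eq_zero]
  -- At the critical zero the first two generators vanish on the whole fibre, which leaves a
  -- multiple of the metric.
  refine IsSTF.eq_zero_of_tensorEval_eq (hg.posDef x₀ hx₀)
    ((stfSubmodule (g x₀) n).sub_mem (isSTF_multipoleTensor hg φ hx₀ n)
      (isSTF_multipoleTensor hg ψ hx₀ n)) (Z := fun v => C (x₀, v)) ?_ fun v => ?_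
  · rw [← contDiffOn_univ]
    exact hC.comp (contDiff_const.prodMk contDiff_id).contDiffOn fun v _ => hx₀
  · rw [tensorEval_sub]
    refine (h (x₀, v) hx₀).trans ?_
    simp [hΩ₀, diffForm, hdΩ₀, metricForm]

end Moments

/-! ### Christoffel symbols and Ricci tensor under a conformal change of metric. -/

section Conformal

variable {ι : Type} [Fintype ι] [DecidableEq ι] {U : Set (EuclideanSpace ℝ ι)}
  {g : EuclideanSpace ℝ ι → Matrix ι ι ℝ} {x : EuclideanSpace ℝ ι}

/-! ### Rules for partial derivatives -/

theorem pderiv_congr (hU : IsOpen U) {f f' : EuclideanSpace ℝ ι → ℝ} (h : ∀ y ∈ U, f y = f' y)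
    (hx : x ∈ U) (i : ι) : pderiv i f x = pderiv i f' x := by
  rw [pderiv, (Filter.eventuallyEq_of_mem (hU.mem_nhds hx) h).fderiv_eq, pderiv]

theorem pderiv_add {f f' : EuclideanSpace ℝ ι → ℝ} (hf : DifferentiableAt ℝ f x)
    (hf' : DifferentiableAt ℝ f' x) (i : ι) :
    pderiv i (fun y => f y + f' y) x = pderiv i f x + pderiv i f' x := by
  simp [pderiv, fderiv_fun_add hf hf']

theorem pderiv_sub {f f' : EuclideanSpace ℝ ι → ℝ} (hf : DifferentiableAt ℝ f x)
    (hf' : DifferentiableAt ℝ f' x) (i : ι) :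
    pderiv i (fun y => f y - f' y) x = pderiv i f x - pderiv i f' x := by
  simp [pderiv, fderiv_fun_sub hf hf']

theorem pderiv_mul {f f' : EuclideanSpace ℝ ι → ℝ} (hf : DifferentiableAt ℝ f x)
    (hf' : DifferentiableAt ℝ f' x) (i : ι) :
    pderiv i (fun y => f y * f' y) x = pderiv i f x * f' x + f x * pderiv i f' x := by
  simp [pderiv, fderiv_fun_mul hf hf']
  ring

theorem pderiv_const_mul {f : EuclideanSpace ℝ ι → ℝ} (hf : DifferentiableAt ℝ f x) (c : ℝ)
    (i : ι) : pderiv i (fun y => c * f y) x = c * pderiv i f x := by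
  simp [pderiv, fderiv_const_mul hf c]

theorem pderiv_sum {α : Type*} (s : Finset α) {f : α → EuclideanSpace ℝ ι → ℝ}
    (hf : ∀ a ∈ s, DifferentiableAt ℝ (f a) x) (i : ι) :
    pderiv i (fun y => ∑ a ∈ s, f a y) x = ∑ a ∈ s, pderiv i (f a) x := by
  simp [pderiv, fderiv_fun_sum hf]

theorem pderiv_comp {f : EuclideanSpace ℝ ι → ℝ} (hf : DifferentiableAt ℝ f x) {r : ℝ → ℝ} {r' : ℝ}
    (hr : HasDerivAt r r' (f x)) (i : ι) : pderiv i (fun y => r (f y)) x = r' * pderiv i f x := by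
  have := (hr.comp_hasFDerivAt x hf.hasFDerivAt).fderiv
  simp only [Function.comp_def] at this
  rw [pderiv, this]
  simp [pderiv]

theorem pderiv_comm (hU : IsOpen U) {f : EuclideanSpace ℝ ι → ℝ} (hf : ContDiffOn ℝ ∞ f U)
    (hx : x ∈ U) (i j : ι) : pderiv i (pderiv j f) x = pderiv j (pderiv i f) x := by
  have hd : DifferentiableAt ℝ (fderiv ℝ f) x :=
    ((hf.fderiv_of_isOpen (m := ∞) hU (by simp)).contDiffAt
      (hU.mem_nhds hx)).differentiableAt (by simp)
  have hs : IsSymmSndFDerivAt ℝ f x :=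
    (hf.contDiffAt (hU.mem_nhds hx)).isSymmSndFDerivAt
      (by rw [minSmoothness_of_isRCLikeNormedField]; exact WithTop.coe_le_coe.mpr (le_top (a := (2 : ℕ∞))))
  have h : ∀ a b : ι, pderiv a (pderiv b f) x =
      fderiv ℝ (fderiv ℝ f) x (EuclideanSpace.single a 1) (EuclideanSpace.single b 1) := by
    intro a b
    rw [pderiv]
    unfold pderiv
    rw [fderiv_clm_apply hd (differentiableAt_const _)]
    simp
  rw [h, h, hs]

/-! ### Conformal changes of the metric -/

/-- The change of the Christoffel symbols under a conformal change of the metric `G`, in terms of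
the differential `σ` of the logarithm of the conformal factor and of the vector `ρ` dual to `σ`. -/
def conformalShift (G : Matrix ι ι ℝ) (σ ρ : ι → ℝ) (k i j : ι) : ℝ :=
  (if k = i then σ j else 0) + (if k = j then σ i else 0) - G i j * ρ k

theorem sum_conformalShift {G : Matrix ι ι ℝ} {σ ρ : ι → ℝ} (hσ : ∀ i, ∑ k, G i k * ρ k = σ i)
    (i : ι) : ∑ k, conformalShift G σ ρ k i k = Fintype.card ι * σ i := by
  simp [conformalShift, Finset.sum_add_distrib, Finset.sum_sub_distrib, hσ]

theorem sum_conformalShift' {G : Matrix ι ι ℝ} {σ ρ : ι → ℝ} (hG : ∀ i j, G i j = G j i)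
    (hσ : ∀ i, ∑ k, G i k * ρ k = σ i) (i : ι) :
    ∑ k, conformalShift G σ ρ k k i = Fintype.card ι * σ i := by
  rw [← sum_conformalShift hσ]
  exact Finset.sum_congr rfl fun k _ => by simp only [conformalShift, hG k i]; ring

/-- The part of the Ricci tensor which is quadratic in the Christoffel symbols, after a conformal
change of the metric. -/
theorem quadratic_add_conformalShift {G : Matrix ι ι ℝ} {σ ρ : ι → ℝ} {Γ : ι → ι → ι → ℝ}
    (hG : ∀ i j, G i j = G j i) (hσ : ∀ i, ∑ k, G i k * ρ k = σ i)
    (hΓ : ∀ k i j, Γ k i j = Γ k j i) :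
    ∃ θ : ℝ, ∀ i j, ∑ k, ∑ l,
        ((Γ k k l + conformalShift G σ ρ k k l) * (Γ l i j + conformalShift G σ ρ l i j) -
          (Γ k j l + conformalShift G σ ρ k j l) * (Γ l i k + conformalShift G σ ρ l i k)) =
      ∑ k, ∑ l, (Γ k k l * Γ l i j - Γ k j l * Γ l i k) +
        (Fintype.card ι - 2) * (∑ k, Γ k i j * σ k + σ i * σ j) +
        ∑ k, ρ k * (∑ l, G j l * Γ l k i + ∑ l, G i l * Γ l k j) + θ * G i j := by
  set d : ℝ := (Fintype.card ι : ℝ) with hd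
  -- The witness collects the coefficients of `G i j` in `h2` and `h5` below.
  refine ⟨-∑ l, (∑ k, Γ k k l) * ρ l + (2 - d) * ∑ l, σ l * ρ l, fun i j => ?_⟩
  have h1 : ∀ (A : ι → ℝ) (i j : ι), ∑ l, A l * conformalShift G σ ρ l i j =
      A i * σ j + A j * σ i - G i j * ∑ l, A l * ρ l := fun A i j => by
    simp only [conformalShift, mul_add, mul_sub, Finset.sum_add_distrib, Finset.sum_sub_distrib,
      mul_ite, mul_zero, Finset.sum_ite_eq', Finset.mem_univ, if_true, Finset.mul_sum]
    congr 1
    exact Finset.sum_congr rfl fun l _ => by ring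
  have h2 : ∑ k, ∑ l, (Γ k k l + conformalShift G σ ρ k k l) *
      (Γ l i j + conformalShift G σ ρ l i j) =
      ∑ k, ∑ l, Γ k k l * Γ l i j + d * ∑ l, Γ l i j * σ l +
        (∑ k, Γ k k i * σ j + ∑ k, Γ k k j * σ i - G i j * ∑ l, (∑ k, Γ k k l) * ρ l) +
        d * (2 * σ i * σ j - G i j * ∑ l, σ l * ρ l) := by
    rw [Finset.sum_comm]
    simp only [← Finset.sum_mul, Finset.sum_add_distrib, sum_conformalShift' hG hσ, mul_add, h1,
      add_mul]
    rw [Finset.sum_comm (f := fun k l => Γ k k l * Γ l i j)]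
    have e1 : ∑ l, d * σ l * Γ l i j = d * ∑ l, Γ l i j * σ l := by
      rw [Finset.mul_sum]
      exact Finset.sum_congr rfl fun l _ => by ring
    have e2 : ∑ l, d * σ l * ρ l = d * ∑ l, σ l * ρ l := by
      rw [Finset.mul_sum]
      exact Finset.sum_congr rfl fun l _ => by ring
    simp only [← hd, e1, e2, ← Finset.sum_mul]
    ring
  have h3 : ∑ k, ∑ l, Γ k j l * conformalShift G σ ρ l i k =
      ∑ k, Γ k i j * σ k + ∑ k, Γ k k j * σ i - ∑ k, ρ k * ∑ l, G i l * Γ l k j := by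
    simp only [conformalShift, mul_add, mul_sub, Finset.sum_add_distrib, Finset.sum_sub_distrib,
      mul_ite, mul_zero, Finset.sum_ite_eq', Finset.mem_univ, if_true, Finset.mul_sum]
    congr 1
    · congr 1
      · exact Finset.sum_congr rfl fun l _ => by rw [hΓ l j i]
      · exact Finset.sum_congr rfl fun l _ => by rw [hΓ l j l]
    · rw [Finset.sum_comm]
      exact Finset.sum_congr rfl fun l _ => Finset.sum_congr rfl fun k _ => by rw [hΓ k j l]; ring
  have h4 : ∑ k, ∑ l, conformalShift G σ ρ k j l * Γ l i k =
      ∑ k, Γ k i j * σ k + ∑ k, Γ k k i * σ j - ∑ k, ρ k * ∑ l, G j l * Γ l k i := by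
    simp only [conformalShift, add_mul, sub_mul, Finset.sum_add_distrib, Finset.sum_sub_distrib,
      ite_mul, zero_mul, Finset.sum_ite_eq, Finset.mem_univ, if_true,
      Finset.mul_sum]
    congr 1
    · congr 1
      · rw [Finset.sum_comm]
        simp only [Finset.sum_ite_eq', Finset.mem_univ, if_true]
        exact Finset.sum_congr rfl fun l _ => by ring
      · exact Finset.sum_congr rfl fun l _ => by rw [hΓ l i l]; ring
    · exact Finset.sum_congr rfl fun l _ => Finset.sum_congr rfl fun k _ => by rw [hΓ k i l]; ring
  have h5 : ∑ k, ∑ l, conformalShift G σ ρ k j l * conformalShift G σ ρ l i k =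
      (d + 2) * σ i * σ j - 2 * G i j * ∑ l, σ l * ρ l := by
    have e : ∀ k, ∑ l, conformalShift G σ ρ k j l * ρ l =
        if k = j then ∑ l, σ l * ρ l else 0 := by
      intro k
      have : ∀ l, conformalShift G σ ρ k j l * ρ l = (if k = j then σ l * ρ l else 0) +
          (if k = l then σ j * ρ l else 0) - G j l * ρ l * ρ k := fun l => by
        simp only [conformalShift]
        split_ifs <;> ring
      simp only [this, Finset.sum_sub_distrib, Finset.sum_add_distrib, ← Finset.sum_mul, hσ,
        Finset.sum_ite_eq, Finset.mem_univ, if_true]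
      split_ifs
      · ring
      · simp
    simp only [h1, e, Finset.sum_sub_distrib, Finset.sum_add_distrib, ← Finset.sum_mul,
      sum_conformalShift hσ, mul_ite, mul_zero, Finset.sum_ite_eq', Finset.mem_univ, if_true]
    rw [Finset.sum_congr rfl fun k _ => mul_comm (conformalShift G σ ρ k j i) (σ k), h1, hG j i]
    ring
  simp only [Finset.sum_sub_distrib, h2]
  have h6 : ∑ k, ∑ l, (Γ k j l + conformalShift G σ ρ k j l) *
      (Γ l i k + conformalShift G σ ρ l i k) = ∑ k, ∑ l, Γ k j l * Γ l i k +
      ∑ k, ∑ l, Γ k j l * conformalShift G σ ρ l i k +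
      ∑ k, ∑ l, conformalShift G σ ρ k j l * Γ l i k +
      ∑ k, ∑ l, conformalShift G σ ρ k j l * conformalShift G σ ρ l i k := by
    simp only [← Finset.sum_add_distrib]
    exact Finset.sum_congr rfl fun k _ => Finset.sum_congr rfl fun l _ => by ring
  rw [h6, h3, h4, h5]
  simp only [mul_add, Finset.sum_add_distrib]
  ring

/-- The factor `e^{2s}` cancels against its reciprocal in the inverse metric; besides the old symbol
only the derivatives of `s` survive. -/
theorem christoffel_conformal (hg : IsSmoothMetricOn g U) {s : EuclideanSpace ℝ ι → ℝ}
    (hs : ContDiffOn ℝ ∞ s U) (hx : x ∈ U) (k i j : ι) :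
    christoffel (fun y => Real.exp (2 * s y) • g y) k i j x = christoffel g k i j x +
      conformalShift (g x) (fun i => pderiv i s x) (fun k => ∑ l, (g x)⁻¹ k l * pderiv l s x)
        k i j := by
  have hds := contDiffOn_differentiableAt hg.isOpen hs hx
  have hdg := fun a b => contDiffOn_differentiableAt hg.isOpen (hg.smooth a b) hx
  have hexp : HasDerivAt (fun r => Real.exp (2 * r)) (2 * Real.exp (2 * s x)) (s x) := by
    have := ((hasDerivAt_id (s x)).const_mul 2).exp
    simpa [mul_comm] using this
  have hde : DifferentiableAt ℝ (fun y => Real.exp (2 * s y)) x :=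
    (hds.const_mul 2).exp
  have hp : ∀ a b c, pderiv a (fun y => (Real.exp (2 * s y) • g y) b c) x =
      Real.exp (2 * s x) * (2 * pderiv a s x * g x b c + pderiv a (fun y => g y b c) x) := by
    intro a b c
    simp only [Matrix.smul_apply, smul_eq_mul]
    rw [pderiv_mul hde (hdg b c), pderiv_comp hds hexp]
    ring
  have hne : Real.exp (2 * s x) ≠ 0 := (Real.exp_pos _).ne'
  have hinv : (Real.exp (2 * s x) • g x)⁻¹ = (Real.exp (2 * s x))⁻¹ • (g x)⁻¹ := by
    refine Matrix.inv_eq_right_inv ?_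
    rw [Matrix.smul_mul, Matrix.mul_smul, smul_smul, mul_inv_cancel₀ hne, one_smul,
      Matrix.mul_nonsing_inv _ (hg.det_ne_zero hx).isUnit]
  have e : ∀ a, ∑ l, (g x)⁻¹ k l * g x a l = if k = a then 1 else 0 := fun a => by
    rw [← hg.sum_inv_mul hx k a]
    exact Finset.sum_congr rfl fun l _ => by rw [hg.symm hx a l]
  have key : ∀ l, (Real.exp (2 * s x) • g x)⁻¹ k l *
      (pderiv i (fun y => (Real.exp (2 * s y) • g y) j l) x +
        pderiv j (fun y => (Real.exp (2 * s y) • g y) i l) x -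
        pderiv l (fun y => (Real.exp (2 * s y) • g y) i j) x) =
      (g x)⁻¹ k l * (pderiv i (fun y => g y j l) x + pderiv j (fun y => g y i l) x -
        pderiv l (fun y => g y i j) x) + (2 * pderiv i s x * ((g x)⁻¹ k l * g x j l) +
        2 * pderiv j s x * ((g x)⁻¹ k l * g x i l) -
        2 * g x i j * ((g x)⁻¹ k l * pderiv l s x)) := by
    intro l
    rw [hp, hp, hp, hinv, Matrix.smul_apply, smul_eq_mul]
    field_simp
    ring
  rw [christoffel, Finset.sum_congr rfl fun l _ => key l, Finset.sum_add_distrib, mul_add,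
    ← christoffel, Finset.sum_sub_distrib, Finset.sum_add_distrib]
  simp only [← Finset.mul_sum, e, conformalShift]
  split_ifs <;> ring

theorem IsSmoothMetricOn.exp_smul (hg : IsSmoothMetricOn g U) {s : EuclideanSpace ℝ ι → ℝ}
    (hs : ContDiffOn ℝ ∞ s U) : IsSmoothMetricOn (fun y => Real.exp (2 * s y) • g y) U where
  isOpen := hg.isOpen
  smooth i j := ((contDiffOn_const.mul hs).exp).mul (hg.smooth i j)
  posDef x hx := (hg.posDef x hx).smul (Real.exp_pos _)

/-- The Ricci tensor of a conformally changed metric, up to a multiple of the metric. -/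
theorem ricci_conformal (hg : IsSmoothMetricOn g U) {s : EuclideanSpace ℝ ι → ℝ}
    (hs : ContDiffOn ℝ ∞ s U) (hx : x ∈ U) :
    ∃ θ : ℝ, ∀ i j, ricci (fun y => Real.exp (2 * s y) • g y) x i j = ricci g x i j -
      (Fintype.card ι - 2) * (pderiv j (pderiv i s) x - ∑ k, christoffel g k i j x * pderiv k s x -
        pderiv i s x * pderiv j s x) + θ * g x i j := by
  have hU := hg.isOpen
  set ρ : ι → EuclideanSpace ℝ ι → ℝ := fun k y => ∑ l, (g y)⁻¹ k l * pderiv l s y with hρ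
  have hps := fun i => ContDiffOn.pderiv hU hs i
  have hρs : ∀ k, ContDiffOn ℝ ∞ (ρ k) U := fun k =>
    ContDiffOn.sum fun l _ => (hg.contDiffOn_inv k l).mul (hps l)
  have hdiff : ∀ {f : EuclideanSpace ℝ ι → ℝ}, ContDiffOn ℝ ∞ f U → DifferentiableAt ℝ f x :=
    fun hf => contDiffOn_differentiableAt hU hf hx
  have hσ : ∀ y ∈ U, ∀ i, ∑ k, g y i k * ρ k y = pderiv i s y := by
    intro y hy i
    simp only [hρ, Finset.mul_sum]
    rw [Finset.sum_comm]
    simp only [← mul_assoc, ← Finset.sum_mul, hg.sum_mul_inv hy]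
    simp
  obtain ⟨θ, hθ⟩ := quadratic_add_conformalShift (Γ := fun k i j => christoffel g k i j x)
    (hg.symm hx) (hσ x hx) (hg.christoffel_symm hx)
  have hite : ∀ (P : Prop) [Decidable P] (f : EuclideanSpace ℝ ι → ℝ) (k : ι),
      pderiv k (fun y => if P then f y else 0) x = if P then pderiv k f x else 0 := by
    intro P _ f k
    split_ifs <;> simp [pderiv]
  have hdite : ∀ (P : Prop) [Decidable P] {f : EuclideanSpace ℝ ι → ℝ}, ContDiffOn ℝ ∞ f U →
      DifferentiableAt ℝ (fun y => if P then f y else 0) x := by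
    intro P _ f hf
    split_ifs
    · exact hdiff hf
    · exact differentiableAt_const _
  -- The two Kronecker deltas give the second derivative of `s` twice. Differentiating `g` produces,
  -- by metric compatibility, the `ρ` terms that cancel those in `quadratic_add_conformalShift`.
  have hA : ∀ i j, ∑ k, pderiv k (christoffel (fun y => Real.exp (2 * s y) • g y) k i j) x =
      ∑ k, pderiv k (christoffel g k i j) x + 2 * pderiv j (pderiv i s) x -
        ∑ k, ρ k x * (∑ l, g x j l * christoffel g l k i x + ∑ l, g x i l * christoffel g l k j x) -
        g x i j * ∑ k, pderiv k (ρ k) x := by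
    intro i j
    have h1 : ∀ k, pderiv k (christoffel (fun y => Real.exp (2 * s y) • g y) k i j) x =
        pderiv k (christoffel g k i j) x + ((if k = i then pderiv k (pderiv j s) x else 0) +
          (if k = j then pderiv k (pderiv i s) x else 0) -
          (pderiv k (fun y => g y i j) x * ρ k x + g x i j * pderiv k (ρ k) x)) := by
      intro k
      rw [pderiv_congr hU (fun y hy => christoffel_conformal hg hs hy k i j) hx]
      simp only [conformalShift]
      rw [pderiv_add (hdiff (hg.contDiffOn_christoffel k i j))
          (((hdite _ (hps j)).fun_add (hdite _ (hps i))).fun_sub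
            ((hdiff (hg.smooth i j)).fun_mul (hdiff (hρs k)))),
        pderiv_sub ((hdite _ (hps j)).fun_add (hdite _ (hps i)))
            ((hdiff (hg.smooth i j)).fun_mul (hdiff (hρs k))),
        pderiv_add (hdite _ (hps j)) (hdite _ (hps i)), hite, hite,
        pderiv_mul (hdiff (hg.smooth i j)) (hdiff (hρs k))]
    simp only [h1, Finset.sum_add_distrib, Finset.sum_sub_distrib, Finset.sum_ite_eq',
      Finset.mem_univ, if_true, hg.pderiv_eq hx, ← Finset.mul_sum, pderiv_comm hU hs hx i j]
    rw [Finset.sum_congr rfl fun k _ => mul_comm _ (ρ k x)]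
    ring
  have hB : ∀ i j, ∑ k, pderiv j (christoffel (fun y => Real.exp (2 * s y) • g y) k i k) x =
      ∑ k, pderiv j (christoffel g k i k) x + Fintype.card ι * pderiv j (pderiv i s) x := by
    intro i j
    rw [← pderiv_sum _ fun k _ => hdiff ((hg.exp_smul hs).contDiffOn_christoffel k i k),
      ← pderiv_sum _ fun k _ => hdiff (hg.contDiffOn_christoffel k i k),
      ← pderiv_const_mul (hdiff (hps i)),
      ← pderiv_add (DifferentiableAt.fun_sum fun k _ => hdiff (hg.contDiffOn_christoffel k i k))
        ((hdiff (hps i)).const_mul _)]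
    refine pderiv_congr hU (fun y hy => ?_) hx j
    rw [← sum_conformalShift (hσ y hy) i, ← Finset.sum_add_distrib]
    exact Finset.sum_congr rfl fun k _ => christoffel_conformal hg hs hy k i k
  -- The divergence of `ρ` enters only through the term `g i j * ρ k` of the shift, hence as a
  -- multiple of the metric.
  refine ⟨θ - ∑ k, pderiv k (ρ k) x, fun i j => ?_⟩
  have hC := hθ i j
  simp only [hρ, ← christoffel_conformal hg hs hx] at hC
  simp only [ricci, Finset.sum_sub_distrib (f := fun k => pderiv k _ x), hA, hB, hC, hρ]
  ring

end Conformal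

/-! ### Reduction of the spacetime Ricci tensor to the spatial metric. -/

section Static

/-! ### The Ricci tensor of a static metric -/

/-- The projection of spacetime coordinates `(t, x)` to `x`. -/
def spaceProj : EuclideanSpace ℝ (Fin 4) →L[ℝ] EuclideanSpace ℝ (Fin 3) :=
  LinearMap.toContinuousLinearMap
    { toFun := fun y => WithLp.toLp 2 fun i => y i.succ
      map_add' := fun _ _ => rfl
      map_smul' := fun _ _ => rfl }

theorem spaceProj_apply (y : EuclideanSpace ℝ (Fin 4)) :
    spaceProj y = WithLp.toLp 2 fun i => y i.succ := rfl

theorem spaceProj_single_zero : spaceProj (EuclideanSpace.single 0 1) = 0 := by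
  ext i
  simp [spaceProj_apply]

theorem spaceProj_single_succ (i : Fin 3) :
    spaceProj (EuclideanSpace.single i.succ 1) = EuclideanSpace.single i 1 := by
  ext j
  simp [spaceProj_apply]

variable {f : EuclideanSpace ℝ (Fin 3) → ℝ} {y : EuclideanSpace ℝ (Fin 4)}

theorem fderiv_comp_spaceProj (hf : DifferentiableAt ℝ f (spaceProj y))
    (v : EuclideanSpace ℝ (Fin 4)) :
    fderiv ℝ (fun z => f (spaceProj z)) y v = fderiv ℝ f (spaceProj y) (spaceProj v) := by
  have := (hf.hasFDerivAt.comp y spaceProj.hasFDerivAt).fderiv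
  simp only [Function.comp_def] at this
  rw [this]
  rfl

theorem pderiv_zero_comp_spaceProj (hf : DifferentiableAt ℝ f (spaceProj y)) :
    pderiv 0 (fun z => f (spaceProj z)) y = 0 := by
  rw [pderiv, fderiv_comp_spaceProj hf, spaceProj_single_zero, map_zero]

theorem pderiv_succ_comp_spaceProj (hf : DifferentiableAt ℝ f (spaceProj y)) (i : Fin 3) :
    pderiv i.succ (fun z => f (spaceProj z)) y = pderiv i f (spaceProj y) := by
  rw [pderiv, fderiv_comp_spaceProj hf, spaceProj_single_succ, pderiv]

variable (lam : EuclideanSpace ℝ (Fin 3) → ℝ) (h : EuclideanSpace ℝ (Fin 3) → Matrix (Fin 3) (Fin 3) ℝ)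
  (y)

theorem staticMetric_zero_zero : staticMetric lam h y 0 0 = -lam (spaceProj y) := rfl

theorem staticMetric_zero_succ (i : Fin 3) : staticMetric lam h y 0 i.succ = 0 := rfl

theorem staticMetric_succ_zero (i : Fin 3) : staticMetric lam h y i.succ 0 = 0 := rfl

theorem staticMetric_succ_succ (i j : Fin 3) : staticMetric lam h y i.succ j.succ =
    ((lam (spaceProj y))⁻¹ • h (spaceProj y)) i j := rfl

variable {lam h y}

/-- The inverse of a static metric. -/
theorem staticMetric_inv (hlam : lam (spaceProj y) ≠ 0)
    (hh : (((lam (spaceProj y))⁻¹ • h (spaceProj y))).det ≠ 0) :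
    (∀ i : Fin 3, (staticMetric lam h y)⁻¹ 0 i.succ = 0) ∧
    (∀ i : Fin 3, (staticMetric lam h y)⁻¹ i.succ 0 = 0) ∧
    (staticMetric lam h y)⁻¹ 0 0 = -(lam (spaceProj y))⁻¹ ∧
    ∀ i j : Fin 3, (staticMetric lam h y)⁻¹ i.succ j.succ =
      ((lam (spaceProj y))⁻¹ • h (spaceProj y))⁻¹ i j := by
  set k := (lam (spaceProj y))⁻¹ • h (spaceProj y) with hk
  -- The metric is block diagonal, so its inverse is assembled from the inverses of the blocks.
  let N : Matrix (Fin 4) (Fin 4) ℝ := Matrix.of fun a b =>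
    Fin.cases (Fin.cases (-(lam (spaceProj y))⁻¹) (fun _ => 0) b)
      (fun i => Fin.cases 0 (fun j => k⁻¹ i j) b) a
  have hN : (staticMetric lam h y)⁻¹ = N := by
    refine Matrix.inv_eq_right_inv ?_
    have hmul : ∀ i j, ∑ l, k i l * k⁻¹ l j = if i = j then 1 else 0 := fun i j => by
      rw [← Matrix.mul_apply, Matrix.mul_nonsing_inv _ hh.isUnit, Matrix.one_apply]
    ext a b
    rw [Matrix.mul_apply, Fin.sum_univ_succ, Matrix.one_apply]
    refine Fin.cases ?_ (fun i => ?_) a <;> refine Fin.cases ?_ (fun j => ?_) b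
    · simp [N, staticMetric_zero_zero, staticMetric_zero_succ, hlam]
    · simp [N, staticMetric_zero_succ, (Fin.succ_ne_zero j).symm]
    · simp [N, staticMetric_succ_zero]
    · simp only [staticMetric_succ_zero, staticMetric_succ_succ, ← hk, N, Matrix.of_apply,
        Fin.cases_zero, Fin.cases_succ, zero_mul, zero_add, hmul, Fin.succ_inj]
  rw [hN]
  exact ⟨fun _ => rfl, fun _ => rfl, rfl, fun _ _ => rfl⟩

variable {U : Set (EuclideanSpace ℝ (Fin 3))} {u : EuclideanSpace ℝ (Fin 3) → ℝ}

/-- The Christoffel symbols of a static metric `-e^u dt² + k`. -/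
theorem christoffel_staticMetric (hu : ContDiffOn ℝ ∞ u U)
    (hk : IsSmoothMetricOn (fun x => (lam x)⁻¹ • h x) U) (hlam : ∀ x ∈ U, lam x = Real.exp (u x))
    (hy : spaceProj y ∈ U) :
    (∀ k i j : Fin 3, christoffel (staticMetric lam h) k.succ i.succ j.succ y =
      christoffel (fun x => (lam x)⁻¹ • h x) k i j (spaceProj y)) ∧
    (∀ i : Fin 3, christoffel (staticMetric lam h) 0 i.succ 0 y =
      1 / 2 * pderiv i u (spaceProj y)) ∧
    (∀ i : Fin 3, christoffel (staticMetric lam h) 0 0 i.succ y =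
      1 / 2 * pderiv i u (spaceProj y)) ∧
    (∀ i j : Fin 3, christoffel (staticMetric lam h) 0 i.succ j.succ y = 0) ∧
    ∀ k i : Fin 3, christoffel (staticMetric lam h) k.succ i.succ 0 y = 0 := by
  have hU := hk.isOpen
  have hdu := contDiffOn_differentiableAt hU hu hy
  have hlam0 : lam (spaceProj y) ≠ 0 := by
    rw [hlam _ hy]
    exact (Real.exp_pos _).ne'
  obtain ⟨i0s, is0, i00, iss⟩ := staticMetric_inv hlam0 (hk.det_ne_zero hy)
  have hlamEq : lam =ᶠ[nhds (spaceProj y)] fun x => Real.exp (u x) :=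
    Filter.eventuallyEq_of_mem (hU.mem_nhds hy) hlam
  have hdlam : DifferentiableAt ℝ (fun x => -lam x) (spaceProj y) :=
    (hlamEq.differentiableAt_iff.mpr hdu.exp).fun_neg
  have hplam : ∀ i, pderiv i (fun x => -lam x) (spaceProj y) =
      -(lam (spaceProj y) * pderiv i u (spaceProj y)) := by
    intro i
    rw [pderiv_congr hU (f' := fun x => -Real.exp (u x)) (fun x hx => by rw [hlam x hx]) hy,
      pderiv_comp hdu (Real.hasDerivAt_exp _).fun_neg, hlam _ hy]
    ring
  have hdk := fun i j => contDiffOn_differentiableAt hU (hk.smooth i j) hy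
  have p0 : ∀ a, pderiv a (fun z => staticMetric lam h z 0 0) y =
      Fin.cases 0 (fun i => -(lam (spaceProj y) * pderiv i u (spaceProj y))) a := by
    intro a
    refine Fin.cases ?_ (fun i => ?_) a
    · exact pderiv_zero_comp_spaceProj hdlam
    · exact (pderiv_succ_comp_spaceProj hdlam i).trans (hplam i)
  have p0s : ∀ a (i : Fin 3), pderiv a (fun z => staticMetric lam h z 0 i.succ) y = 0 := by
    intro a i
    simp only [staticMetric_zero_succ]
    simp [pderiv]
  have ps0 : ∀ a (i : Fin 3), pderiv a (fun z => staticMetric lam h z i.succ 0) y = 0 := by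
    intro a i
    simp only [staticMetric_succ_zero]
    simp [pderiv]
  have pss : ∀ i j : Fin 3, pderiv 0 (fun z => staticMetric lam h z i.succ j.succ) y = 0 :=
    fun i j => pderiv_zero_comp_spaceProj (hdk i j)
  have psss : ∀ a i j : Fin 3, pderiv a.succ (fun z => staticMetric lam h z i.succ j.succ) y =
      pderiv a (fun x => ((lam x)⁻¹ • h x) i j) (spaceProj y) :=
    fun a i j => pderiv_succ_comp_spaceProj (hdk i j) a
  refine ⟨fun k i j => ?_, fun i => ?_, fun i => ?_, fun i j => ?_, fun k i => ?_⟩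
  · rw [christoffel, Fin.sum_univ_succ, is0]
    simp only [iss, psss, zero_mul, zero_add]
    rfl
  · rw [christoffel, Fin.sum_univ_succ]
    simp only [i0s, i00, p0, ps0, zero_mul, Finset.sum_const_zero, Fin.cases_succ]
    field_simp
    ring
  · rw [christoffel, Fin.sum_univ_succ]
    simp only [i0s, i00, p0, ps0, zero_mul, Finset.sum_const_zero, Fin.cases_succ, p0s]
    field_simp
    ring
  · rw [christoffel, Fin.sum_univ_succ]
    simp [i0s, ps0, pss]
  · rw [christoffel, Fin.sum_univ_succ]
    simp [is0, p0s, ps0, pss]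

/-- The spatial components of the Ricci tensor of a static metric `-e^u dt² + k`. -/
theorem ricci_staticMetric (hu : ContDiffOn ℝ ∞ u U)
    (hk : IsSmoothMetricOn (fun x => (lam x)⁻¹ • h x) U) (hlam : ∀ x ∈ U, lam x = Real.exp (u x))
    (hy : spaceProj y ∈ U) (i j : Fin 3) :
    ricci (staticMetric lam h) y i.succ j.succ =
      ricci (fun x => (lam x)⁻¹ • h x) (spaceProj y) i j -
        1 / 2 * (pderiv j (pderiv i u) (spaceProj y) -
          ∑ l, christoffel (fun x => (lam x)⁻¹ • h x) l i j (spaceProj y) *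
            pderiv l u (spaceProj y)) -
        1 / 4 * (pderiv i u (spaceProj y) * pderiv j u (spaceProj y)) := by
  have hU := hk.isOpen
  have hV : IsOpen (spaceProj ⁻¹' U) := hU.preimage spaceProj.continuous
  have hc : ∀ z ∈ spaceProj ⁻¹' U, _ := fun z hz => christoffel_staticMetric (y := z) hu hk hlam hz
  obtain ⟨css, c0s0, c00s, c0ss, css0⟩ := hc y hy
  have hdΓ := fun k i j => contDiffOn_differentiableAt hU (hk.contDiffOn_christoffel k i j) hy
  have hdu := fun i => contDiffOn_differentiableAt hU (ContDiffOn.pderiv hU hu i) hy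
  have d1 : pderiv 0 (christoffel (staticMetric lam h) 0 i.succ j.succ) y = 0 := by
    rw [pderiv_congr hV (f' := fun _ => 0) (fun z hz => (hc z hz).2.2.2.1 i j) hy]
    simp [pderiv]
  have d2 : pderiv j.succ (christoffel (staticMetric lam h) 0 i.succ 0) y =
      1 / 2 * pderiv j (pderiv i u) (spaceProj y) := by
    rw [pderiv_congr hV (fun z hz => (hc z hz).2.1 i) hy,
      pderiv_succ_comp_spaceProj (f := fun x => 1 / 2 * pderiv i u x) ((hdu i).const_mul _),
      pderiv_const_mul (hdu i)]
  have d3 : ∀ k a i j : Fin 3, pderiv a.succ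
      (christoffel (staticMetric lam h) k.succ i.succ j.succ) y =
      pderiv a (christoffel (fun x => (lam x)⁻¹ • h x) k i j) (spaceProj y) := by
    intro k a i j
    rw [pderiv_congr hV (fun z hz => (hc z hz).1 k i j) hy, pderiv_succ_comp_spaceProj (hdΓ k i j)]
  rw [ricci]
  simp only [Fin.sum_univ_succ (n := 3), d1, d2, d3, css, c0s0, c00s, c0ss, css0]
  rw [ricci]
  simp only [mul_zero, sub_zero, zero_sub, zero_add, Finset.mul_sum, mul_sub]
  rw [Finset.sum_congr rfl fun l _ => show 1 / 2 * pderiv l u (spaceProj y) *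
    christoffel (fun x => (lam x)⁻¹ • h x) l i j (spaceProj y) = 1 / 2 *
    (christoffel (fun x => (lam x)⁻¹ • h x) l i j (spaceProj y) * pderiv l u (spaceProj y)) by ring]
  ring

end Static

/-! ### Locality, Hessians along the spray, and extension across a point. -/

section Congruence

variable {ι : Type} [Fintype ι] [DecidableEq ι] {U V : Set (EuclideanSpace ℝ ι)}
  {g g' : EuclideanSpace ℝ ι → Matrix ι ι ℝ} {x : EuclideanSpace ℝ ι}

theorem christoffel_congr (hU : IsOpen U) (h : ∀ y ∈ U, g y = g' y) (hx : x ∈ U) (k i j : ι) :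
    christoffel g k i j x = christoffel g' k i j x := by
  have hp : ∀ a b c, pderiv a (fun y => g y b c) x = pderiv a (fun y => g' y b c) x :=
    fun a b c => pderiv_congr hU (fun y hy => by rw [h y hy]) hx a
  simp only [christoffel, h x hx, hp]

theorem ricci_congr (hU : IsOpen U) (h : ∀ y ∈ U, g y = g' y) (hx : x ∈ U) (i j : ι) :
    ricci g x i j = ricci g' x i j := by
  have hp : ∀ a k i j, pderiv a (christoffel g k i j) x = pderiv a (christoffel g' k i j) x :=
    fun a k i j => pderiv_congr hU (fun y hy => christoffel_congr hU h hy k i j) hx a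
  simp only [ricci, hp, christoffel_congr hU h hx]

theorem IsSmoothMetricOn.congr (hg : IsSmoothMetricOn g U) (h : ∀ y ∈ U, g' y = g y) :
    IsSmoothMetricOn g' U where
  isOpen := hg.isOpen
  smooth i j := (hg.smooth i j).congr fun y hy => by rw [h y hy]
  posDef y hy := by
    rw [h y hy]
    exact hg.posDef y hy

theorem IsSmoothMetricOn.mono (hg : IsSmoothMetricOn g U) (hV : IsOpen V) (h : V ⊆ U) :
    IsSmoothMetricOn g V where
  isOpen := hV
  smooth i j := (hg.smooth i j).mono h
  posDef y hy := hg.posDef y (h hy)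

/-- The components of the covariant Hessian of a function. -/
def covHessian (g : EuclideanSpace ℝ ι → Matrix ι ι ℝ) (f : EuclideanSpace ℝ ι → ℝ)
    (x : EuclideanSpace ℝ ι) (i j : ι) : ℝ :=
  pderiv j (pderiv i f) x - ∑ k, christoffel g k i j x * pderiv k f x

theorem contDiffOn_covHessian (hg : IsSmoothMetricOn g U) {f : EuclideanSpace ℝ ι → ℝ}
    (hf : ContDiffOn ℝ ∞ f U) (i j : ι) : ContDiffOn ℝ ∞ (fun x => covHessian g f x i j) U :=
  (ContDiffOn.pderiv hg.isOpen (ContDiffOn.pderiv hg.isOpen hf i) j).sub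
    (ContDiffOn.sum fun k _ => (hg.contDiffOn_christoffel k i j).mul
      (ContDiffOn.pderiv hg.isOpen hf k))

/-- The second derivative of a function along the geodesic spray is its Hessian. -/
theorem spray_diffForm (hg : IsSmoothMetricOn g U) {f : EuclideanSpace ℝ ι → ℝ}
    (hf : ContDiffOn ℝ ∞ f U) {p : EuclideanSpace ℝ ι × EuclideanSpace ℝ ι} (hp : p.1 ∈ U) :
    spray g (diffForm f) p = ∑ i, ∑ j, covHessian g f p.1 i j * (p.2 i * p.2 j) := by
  have hpf := fun i => ContDiffOn.pderiv hg.isOpen hf i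
  have hd : ∀ i, DifferentiableAt ℝ
      (fun p : EuclideanSpace ℝ ι × EuclideanSpace ℝ ι => pderiv i f p.1) p := fun i =>
    ContDiffOn.differentiableAt_fst hg.isOpen (ContDiffOn.comp_fst (hpf i)) hp
  unfold diffForm
  rw [spray_sum _ fun i _ => (differentiableAt_snd_apply i).fun_mul (hd i)]
  simp only [spray_mul (differentiableAt_snd_apply _) (hd _), spray_snd_apply,
    spray_comp_fst (contDiffOn_differentiableAt hg.isOpen (hpf _) hp), covHessian, sub_mul,
    Finset.sum_sub_distrib, Finset.sum_add_distrib, Finset.mul_sum, Finset.sum_mul, neg_mul,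
    Finset.sum_neg_distrib]
  rw [neg_add_eq_sub]
  congr 1
  · exact Finset.sum_congr rfl fun i _ => Finset.sum_congr rfl fun j _ => by ring
  · rw [Finset.sum_comm, Finset.sum_congr rfl fun i _ => Finset.sum_comm]
    exact Finset.sum_congr rfl fun i _ => Finset.sum_congr rfl fun j _ =>
      Finset.sum_congr rfl fun k _ => by ring

/-- Continuous functions which agree off a point agree at that point. -/
theorem eq_of_eqOn_punctured [Nonempty ι] (hU : IsOpen U) (hx : x ∈ U)
    {f f' : EuclideanSpace ℝ ι → ℝ} (hf : ContinuousOn f U) (hf' : ContinuousOn f' U)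
    (h : ∀ y ∈ U, y ≠ x → f y = f' y) : f x = f' x := by
  have hn := hU.mem_nhds hx
  refine tendsto_nhds_unique_of_eventuallyEq
    (((hf.continuousAt hn).tendsto).mono_left (nhdsWithin_le_nhds (s := {x}ᶜ)))
    (((hf'.continuousAt hn).tendsto).mono_left nhdsWithin_le_nhds) ?_
  filter_upwards [nhdsWithin_le_nhds hn, self_mem_nhdsWithin] with y hy hne using h y hy hne

end Congruence

/-! ### The Hessian of the conformal factor in a static vacuum. -/

section Vacuum

variable {U V : Set (EuclideanSpace ℝ (Fin 3))} {g : EuclideanSpace ℝ (Fin 3) → Matrix (Fin 3) (Fin 3) ℝ}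
  {lam Ω φ : EuclideanSpace ℝ (Fin 3) → ℝ}

/-! ### The vacuum equations in terms of the rescaled metric -/

/-- The spatial vacuum equations of the static metric `-lam dt² + lam⁻¹ Ω⁻² g`, up to multiples
of `g`. -/
theorem exists_covHessian_eq (hg : IsSmoothMetricOn g V) (hlam : ContDiffOn ℝ ∞ lam V)
    (hlam0 : ∀ x ∈ V, 0 < lam x) (hΩ : ContDiffOn ℝ ∞ Ω V) (hΩ0 : ∀ x ∈ V, 0 < Ω x)
    (hvac : ∀ y, spaceProj y ∈ V → ∀ i j : Fin 3,
      ricci (staticMetric lam fun x => (Ω x ^ 2)⁻¹ • g x) y i.succ j.succ = 0)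
    {x : EuclideanSpace ℝ (Fin 3)} (hx : x ∈ V) :
    ∃ θ : ℝ, ∀ i j, Ω x * ricci g x i j + covHessian g Ω x i j -
      Ω x / 2 * (pderiv i (fun y => Real.log (lam y)) x * pderiv j (fun y => Real.log (lam y)) x) =
        θ * g x i j := by
  have hV := hg.isOpen
  set u : EuclideanSpace ℝ (Fin 3) → ℝ := fun y => Real.log (lam y) with hu_def
  have hu : ContDiffOn ℝ ∞ u V := hlam.log fun y hy => (hlam0 y hy).ne'
  have hlogΩ : ContDiffOn ℝ ∞ (fun y => Real.log (Ω y)) V := hΩ.log fun y hy => (hΩ0 y hy).ne'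
  -- Chosen so that the spatial metric `λ⁻¹ Ω⁻² g` is `e^{2s} g`.
  set s : EuclideanSpace ℝ (Fin 3) → ℝ := fun y => -(1 / 2) * u y - Real.log (Ω y) with hs_def
  have hs : ContDiffOn ℝ ∞ s V := (contDiffOn_const.mul hu).sub hlogΩ
  have hk : ∀ y ∈ V, (lam y)⁻¹ • (Ω y ^ 2)⁻¹ • g y = Real.exp (2 * s y) • g y := by
    intro y hy
    rw [smul_smul]
    congr 1
    have h1 : 2 * s y = -u y + -(2 * Real.log (Ω y)) := by
      simp only [hs_def]
      ring
    have h2 : Real.exp (2 * Real.log (Ω y)) = Ω y ^ 2 := by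
      rw [two_mul, Real.exp_add, Real.exp_log (hΩ0 y hy), sq]
    rw [h1, Real.exp_add, Real.exp_neg, Real.exp_neg, h2, hu_def, Real.exp_log (hlam0 y hy)]
  have hkm := (hg.exp_smul hs).congr hk
  obtain ⟨y, hy⟩ : ∃ y, spaceProj y = x :=
    ⟨WithLp.toLp 2 (Fin.cons 0 x.ofLp), by ext i; simp [spaceProj_apply]⟩
  obtain ⟨θ, hθ⟩ := ricci_conformal hg hs hx
  have hdu : ∀ {z}, z ∈ V → DifferentiableAt ℝ u z := contDiffOn_differentiableAt hV hu
  have hdΩ : ∀ {z}, z ∈ V → DifferentiableAt ℝ Ω z := contDiffOn_differentiableAt hV hΩ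
  have hps : ∀ i, ∀ z ∈ V, pderiv i s z = -(1 / 2) * pderiv i u z - (Ω z)⁻¹ * pderiv i Ω z := by
    intro i z hz
    rw [hs_def, pderiv_sub ((hdu hz).const_mul _)
      (contDiffOn_differentiableAt hV hlogΩ hz), pderiv_const_mul (hdu hz),
      pderiv_comp (hdΩ hz) (Real.hasDerivAt_log (hΩ0 z hz).ne')]
  have hpps : ∀ i j, pderiv j (pderiv i s) x = -(1 / 2) * pderiv j (pderiv i u) x -
      ((Ω x)⁻¹ * pderiv j (pderiv i Ω) x - (Ω x ^ 2)⁻¹ * (pderiv i Ω x * pderiv j Ω x)) := by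
    intro i j
    have hdpu := contDiffOn_differentiableAt hV (ContDiffOn.pderiv hV hu i) hx
    have hdpΩ := contDiffOn_differentiableAt hV (ContDiffOn.pderiv hV hΩ i) hx
    have hdinv : DifferentiableAt ℝ (fun z => (Ω z)⁻¹) x := (hdΩ hx).inv (hΩ0 x hx).ne'
    rw [pderiv_congr hV (hps i) hx, pderiv_sub (hdpu.const_mul _) (hdinv.fun_mul hdpΩ),
      pderiv_const_mul hdpu, pderiv_mul hdinv hdpΩ,
      pderiv_comp (hdΩ hx) (hasDerivAt_inv (hΩ0 x hx).ne')]
    ring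
  set τ : ℝ := ∑ k, (∑ l, (g x)⁻¹ k l * pderiv l s x) * pderiv k u x with hτ
  refine ⟨Ω x * (1 / 2 * τ - θ), fun i j => ?_⟩
  have hyV : spaceProj y ∈ V := hy ▸ hx
  have h0 := hvac y hyV i j
  rw [ricci_staticMetric hu hkm (fun z hz => (Real.exp_log (hlam0 z hz)).symm) hyV, hy,
    ricci_congr hV hk hx, hθ] at h0
  have hΓ : ∑ l, christoffel (fun z => (lam z)⁻¹ • (Ω z ^ 2)⁻¹ • g z) l i j x * pderiv l u x =
      ∑ l, christoffel g l i j x * pderiv l u x + pderiv i u x * pderiv j s x +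
        pderiv j u x * pderiv i s x - g x i j * τ := by
    simp only [christoffel_congr hV hk hx, christoffel_conformal hg hs hx, conformalShift, hτ,
      add_mul, sub_mul, Finset.sum_add_distrib, Finset.sum_sub_distrib, ite_mul, zero_mul,
      Finset.sum_ite_eq', Finset.mem_univ, if_true]
    rw [Finset.sum_congr rfl fun k _ => mul_assoc (g x i j) _ (pderiv k u x), ← Finset.mul_sum]
    ring
  have hΓs : ∑ k, christoffel g k i j x * pderiv k s x =
      -(1 / 2) * ∑ k, christoffel g k i j x * pderiv k u x -
        (Ω x)⁻¹ * ∑ k, christoffel g k i j x * pderiv k Ω x := by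
    simp only [hps _ x hx, Finset.mul_sum, ← Finset.sum_sub_distrib]
    exact Finset.sum_congr rfl fun k _ => by ring
  rw [hΓ, hΓs, hpps, hps i x hx, hps j x hx] at h0
  have hinv : Ω x * (Ω x)⁻¹ = 1 := mul_inv_cancel₀ (hΩ0 x hx).ne'
  simp only [Fintype.card_fin, Nat.cast_ofNat] at h0
  simp only [covHessian]
  -- In dimension 3 the factor `Fintype.card ι - 2` is 1. The second derivatives of `u` and the
  -- mixed products of `du` with `dΩ` then cancel, as do the products `dΩ dΩ`.
  linear_combination Ω x * h0 - (pderiv j (pderiv i Ω) x -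
    ∑ k, christoffel g k i j x * pderiv k Ω x) * hinv

/-- The source term of the vacuum equations in terms of the rescaled Geroch potential `φ`. -/
theorem source_eq_of_geroch (hV : IsOpen V) (hlam : ContDiffOn ℝ ∞ lam V)
    (hlam0 : ∀ x ∈ V, 0 < lam x) (hΩ : ContDiffOn ℝ ∞ Ω V) (hΩ0 : ∀ x ∈ V, 0 < Ω x)
    (hφ : ContDiffOn ℝ ∞ φ V)
    (hgeroch : ∀ x ∈ V, φ x = lam x ^ (-(1 / 4) : ℝ) * (1 - √(lam x)) / √(Ω x))
    {x : EuclideanSpace ℝ (Fin 3)} (hx : x ∈ V) (i j : Fin 3) :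
    Ω x / 2 * (pderiv i (fun y => Real.log (lam y)) x * pderiv j (fun y => Real.log (lam y)) x) =
      8 * (4 + Ω x * φ x ^ 2)⁻¹ * ((Ω x * pderiv i φ x + 1 / 2 * φ x * pderiv i Ω x) *
        (Ω x * pderiv j φ x + 1 / 2 * φ x * pderiv j Ω x)) := by
  set u : EuclideanSpace ℝ (Fin 3) → ℝ := fun y => Real.log (lam y) with hu_def
  have hu : ContDiffOn ℝ ∞ u V := hlam.log fun y hy => (hlam0 y hy).ne'
  have hdu := contDiffOn_differentiableAt hV hu hx
  have hdΩ := contDiffOn_differentiableAt hV hΩ hx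
  have hdφ := contDiffOn_differentiableAt hV hφ hx
  have hpos := hΩ0 x hx
  have hsq : √(Ω x) ^ 2 = Ω x := Real.sq_sqrt hpos.le
  have hne : √(Ω x) ≠ 0 := (Real.sqrt_pos.mpr hpos).ne'
  -- The unrescaled potential is `-2 sinh (u/4)`.
  have hrel : ∀ y ∈ V, √(Ω y) * φ y = Real.exp (-(1 / 4) * u y) - Real.exp (1 / 4 * u y) := by
    intro y hy
    have hl := hlam0 y hy
    rw [hgeroch y hy, mul_div_cancel₀ _ (Real.sqrt_pos.mpr (hΩ0 y hy)).ne',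
      Real.sqrt_eq_rpow, mul_sub, mul_one, ← Real.rpow_add hl, Real.rpow_def_of_pos hl,
      Real.rpow_def_of_pos hl]
    congr 2 <;> (simp only [hu_def]; ring)
  -- Differentiating `√Ω φ` and multiplying by `√Ω` removes the half-integer powers on the left. The
  -- right side is `-(1/2) √Ω cosh (u/4) du`.
  have hder : ∀ k, Ω x * pderiv k φ x + 1 / 2 * φ x * pderiv k Ω x =
      -(1 / 4) * √(Ω x) * (Real.exp (-(1 / 4) * u x) + Real.exp (1 / 4 * u x)) * pderiv k u x := by
    intro k
    have h1 : HasDerivAt (fun r => Real.exp (-(1 / 4) * r) - Real.exp (1 / 4 * r))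
        (-(1 / 4) * (Real.exp (-(1 / 4) * u x) + Real.exp (1 / 4 * u x))) (u x) := by
      have e1 := ((hasDerivAt_id (u x)).const_mul (-(1 / 4) : ℝ)).exp
      have e2 := ((hasDerivAt_id (u x)).const_mul (1 / 4 : ℝ)).exp
      refine (e1.fun_sub e2).congr_deriv ?_
      simp only [id_eq]
      ring
    have h2 := pderiv_congr hV hrel hx k
    rw [pderiv_comp hdu h1, pderiv_mul (hdΩ.sqrt hpos.ne') hdφ,
      pderiv_comp hdΩ (Real.hasDerivAt_sqrt hpos.ne')] at h2
    have h3 : √(Ω x) * (√(Ω x))⁻¹ = 1 := mul_inv_cancel₀ hne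
    linear_combination √(Ω x) * h2 - pderiv k φ x * hsq - 1 / 2 * (pderiv k Ω x * φ x) * h3
  -- This is `4 cosh² = 4 + 4 sinh²`; dividing by it eliminates the hyperbolic cosine from the
  -- product of two derivatives.
  have hsum : (Real.exp (-(1 / 4) * u x) + Real.exp (1 / 4 * u x)) ^ 2 = 4 + Ω x * φ x ^ 2 := by
    have h1 : Ω x * φ x ^ 2 = (√(Ω x) * φ x) ^ 2 := by rw [mul_pow, hsq]
    have h2 : Real.exp (-(1 / 4) * u x) * Real.exp (1 / 4 * u x) = 1 := by
      rw [← Real.exp_add, neg_mul, neg_add_cancel, Real.exp_zero]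
    rw [h1, hrel x hx]
    linear_combination 4 * h2
  have hD : 4 + Ω x * φ x ^ 2 ≠ 0 := by positivity
  rw [hder, hder, ← hsum]
  rw [← hsum] at hD
  field_simp
  rw [hsq]
  ring

/-- In a static vacuum spacetime, the Hessian of the conformal factor belongs to the ideal
generated by the conformal factor, its differential and the metric. -/
theorem memIdeal_spray_diffForm (hg : IsSmoothMetricOn g U) {x₀ : EuclideanSpace ℝ (Fin 3)}
    (hlam : ContDiffOn ℝ ∞ lam (U \ {x₀})) (hlam0 : ∀ x ∈ U \ {x₀}, 0 < lam x)
    (hΩ : ContDiffOn ℝ ∞ Ω U) (hΩ0 : ∀ x ∈ U \ {x₀}, 0 < Ω x) (hΩnn : ∀ x ∈ U, 0 ≤ Ω x)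
    (hφ : ContDiffOn ℝ ∞ φ U)
    (hgeroch : ∀ x ∈ U \ {x₀}, φ x = lam x ^ (-(1 / 4) : ℝ) * (1 - √(lam x)) / √(Ω x))
    (hvac : ∀ y, spaceProj y ∈ U \ {x₀} → ∀ i j : Fin 3,
      ricci (staticMetric lam fun x => (Ω x ^ 2)⁻¹ • g x) y i.succ j.succ = 0) :
    MemIdeal U (fun p => Ω p.1) (diffForm Ω) (metricForm g) (spray g (diffForm Ω)) := by
  have hU := hg.isOpen
  have hV : IsOpen (U \ {x₀}) := hU.sdiff isClosed_singleton
  have hVU : U \ {x₀} ⊆ U := Set.sdiff_subset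
  have hD : ∀ x ∈ U, 4 + Ω x * φ x ^ 2 ≠ 0 := fun x hx => by
    have := mul_nonneg (hΩnn x hx) (sq_nonneg (φ x))
    positivity
  -- Unlike `log λ`, which is only controlled away from `x₀`, the source term expressed through `c`
  -- and `W` is smooth on all of `U`.
  set c : EuclideanSpace ℝ (Fin 3) → ℝ := fun x => 8 * (4 + Ω x * φ x ^ 2)⁻¹ with hc_def
  have hc : ContDiffOn ℝ ∞ c U :=
    contDiffOn_const.mul ((contDiffOn_const.add (hΩ.mul (hφ.pow 2))).inv hD)
  set W : Fin 3 → EuclideanSpace ℝ (Fin 3) → ℝ := fun i x =>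
    Ω x * pderiv i φ x + 1 / 2 * φ x * pderiv i Ω x with hW_def
  have hW : ∀ i, ContDiffOn ℝ ∞ (W i) U := fun i =>
    (hΩ.mul (ContDiffOn.pderiv hU hφ i)).add
      ((contDiffOn_const.mul hφ).mul (ContDiffOn.pderiv hU hΩ i))
  set K : Fin 3 → Fin 3 → EuclideanSpace ℝ (Fin 3) → ℝ := fun i j x =>
    Ω x * ricci g x i j + covHessian g Ω x i j - c x * (W i x * W j x) with hK_def
  have hK : ∀ i j, ContDiffOn ℝ ∞ (K i j) U := fun i j =>
    ((hΩ.mul (hg.contDiffOn_ricci i j)).add (contDiffOn_covHessian hg hΩ i j)).sub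
      (hc.mul ((hW i).mul (hW j)))
  -- The vacuum equations give the proportionality factor only pointwise and off `x₀`. Taking a
  -- third of the trace identifies it with a function that is smooth across `x₀`.
  set θ : EuclideanSpace ℝ (Fin 3) → ℝ := fun x =>
    1 / 3 * ∑ i, ∑ j, (g x)⁻¹ i j * K i j x with hθ_def
  have hθ : ContDiffOn ℝ ∞ θ U := contDiffOn_const.mul
    (ContDiffOn.sum fun i _ => ContDiffOn.sum fun j _ => (hg.contDiffOn_inv i j).mul (hK i j))
  have hKV : ∀ x ∈ U, x ≠ x₀ → ∀ i j, K i j x = θ x * g x i j := by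
    intro x hx hne i j
    have hxV : x ∈ U \ {x₀} := ⟨hx, hne⟩
    obtain ⟨t, ht⟩ := exists_covHessian_eq (hg.mono hV hVU) hlam hlam0 (hΩ.mono hVU) hΩ0 hvac hxV
    have hKt : ∀ i j, K i j x = t * g x i j := fun i j => by
      rw [← ht, source_eq_of_geroch hV hlam hlam0 (hΩ.mono hVU) hΩ0 (hφ.mono hVU) hgeroch hxV]
    have hθt : θ x = t := by
      have h1 : ∀ i, ∑ j, (g x)⁻¹ i j * (t * g x i j) = t := fun i => by
        have := hg.sum_inv_mul hx i i
        rw [if_pos rfl] at this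
        calc ∑ j, (g x)⁻¹ i j * (t * g x i j) = t * ∑ j, (g x)⁻¹ i j * g x j i := by
              rw [Finset.mul_sum]
              exact Finset.sum_congr rfl fun j _ => by rw [hg.symm hx i j]; ring
          _ = t := by rw [this, mul_one]
      simp only [hθ_def, hKt, h1]
      simp
    rw [hKt, hθt]
  -- Both sides are continuous on `U`, so the identity extends to `x₀`.
  have hKU : ∀ x ∈ U, ∀ i j, K i j x = θ x * g x i j := by
    intro x hx i j
    by_cases hne : x = x₀
    · subst hne
      exact eq_of_eqOn_punctured hU hx (hK i j).continuousOn
        (hθ.mul (hg.smooth i j)).continuousOn fun y hy hyx => hKV y hy hyx i j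
    · exact hKV x hx hne i j
  set w : EuclideanSpace ℝ (Fin 3) × EuclideanSpace ℝ (Fin 3) → ℝ := fun p =>
    Ω p.1 * diffForm φ p + 1 / 2 * φ p.1 * diffForm Ω p with hw_def
  have hw : ContDiffOn ℝ ∞ w (Prod.fst ⁻¹' U) :=
    ((ContDiffOn.comp_fst hΩ).mul (contDiffOn_diffForm hU hφ)).add
      ((contDiffOn_const.mul (ContDiffOn.comp_fst hφ)).mul (contDiffOn_diffForm hU hΩ))
  have hcw := (ContDiffOn.comp_fst hc).mul hw
  -- The form `w` is itself a combination of `Ω` and `dΩ`; expanding one factor of `c w²` and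
  -- leaving the other as a coefficient gives these three functions.
  refine ⟨fun p => c p.1 * w p * diffForm φ p - ricciForm g p,
    fun p => c p.1 * w p * (1 / 2 * φ p.1), fun p => θ p.1,
    (hcw.mul (contDiffOn_diffForm hU hφ)).sub (contDiffOn_ricciForm hg),
    hcw.mul (contDiffOn_const.mul (ContDiffOn.comp_fst hφ)), ContDiffOn.comp_fst hθ,
    fun p hp => ?_⟩
  have hwW : w p = ∑ i, W i p.1 * p.2 i := by
    simp only [hw_def, hW_def, diffForm, Finset.mul_sum, ← Finset.sum_add_distrib]
    exact Finset.sum_congr rfl fun i _ => by ring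
  have hww : w p * w p = ∑ i, ∑ j, W i p.1 * W j p.1 * (p.2 i * p.2 j) := by
    rw [hwW, Finset.sum_mul_sum]
    exact Finset.sum_congr rfl fun i _ => Finset.sum_congr rfl fun j _ => by ring
  have hH : ∀ i j, covHessian g Ω p.1 i j =
      θ p.1 * g p.1 i j - Ω p.1 * ricci g p.1 i j + c p.1 * (W i p.1 * W j p.1) := fun i j => by
    rw [← hKU p.1 hp]
    simp only [hK_def]
    ring
  have hsum : spray g (diffForm Ω) p =
      θ p.1 * metricForm g p - Ω p.1 * ricciForm g p + c p.1 * (w p * w p) := by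
    rw [spray_diffForm hg hΩ hp, hww]
    simp only [hH, metricForm, ricciForm, Finset.mul_sum, ← Finset.sum_sub_distrib,
      ← Finset.sum_add_distrib]
    exact Finset.sum_congr rfl fun i _ => Finset.sum_congr rfl fun j _ => by ring
  rw [hsum]
  have hwp : w p = Ω p.1 * diffForm φ p + 1 / 2 * φ p.1 * diffForm Ω p := rfl
  linear_combination (c p.1 * w p) * hwp

end Vacuum

/-! ### Hyperbolic duplication and half-argument formulas. -/

section Potentials

/-! ### The Hansen and the Geroch potential as functions of each other -/

/-- With `u = log l` this is `sinh u = 4 sinh (u/4) cosh (u/4) cosh (u/2)`. The two factors are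
`cosh (u/4)` and `cosh (u/2)`, written through `sinh² (u/4)`. Substituting `l = m⁴` makes everything
rational. -/
theorem hansen_eq_of_geroch {l : ℝ} (hl : 0 < l) :
    (1 - l ^ 2) / (4 * l) = l ^ (-(1 / 4) : ℝ) * (1 - √l) *
      (√(1 + 1 / 4 * (l ^ (-(1 / 4) : ℝ) * (1 - √l)) ^ 2) *
        (1 + 1 / 2 * (l ^ (-(1 / 4) : ℝ) * (1 - √l)) ^ 2)) := by
  obtain ⟨m, hm, rfl⟩ : ∃ m : ℝ, 0 < m ∧ l = m ^ 4 :=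
    ⟨l ^ (1 / 4 : ℝ), Real.rpow_pos_of_pos hl _, by
      rw [← Real.rpow_natCast, ← Real.rpow_mul hl.le]; norm_num⟩
  have h1 : (m ^ 4 : ℝ) ^ (-(1 / 4) : ℝ) = m⁻¹ := by
    rw [← Real.rpow_natCast, ← Real.rpow_mul hm.le, ← Real.rpow_neg_one]
    norm_num
  have h2 : √(m ^ 4) = m ^ 2 := by
    rw [show m ^ 4 = (m ^ 2) ^ 2 by ring, Real.sqrt_sq (by positivity)]
  have h3 : √(1 + 1 / 4 * (m⁻¹ * (1 - m ^ 2)) ^ 2) = (m⁻¹ + m) / 2 := by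
    rw [← Real.sqrt_sq (show 0 ≤ (m⁻¹ + m) / 2 by positivity)]
    congr 1
    field_simp
    ring
  rw [h1, h2, h3]
  field_simp
  ring

/-- The same identity solved for `sinh (u/4)`: the innermost root is `cosh u`, and two half-argument
formulas give `cosh (u/2)` and `cosh (u/4)`. -/
theorem geroch_eq_of_hansen {l : ℝ} (hl : 0 < l) :
    l ^ (-(1 / 4) : ℝ) * (1 - √l) = (1 - l ^ 2) / (4 * l) /
      (√((1 + √(1 + 4 * ((1 - l ^ 2) / (4 * l)) ^ 2)) / 2) *
        √((1 + √((1 + √(1 + 4 * ((1 - l ^ 2) / (4 * l)) ^ 2)) / 2)) / 2)) := by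
  obtain ⟨m, hm, rfl⟩ : ∃ m : ℝ, 0 < m ∧ l = m ^ 4 :=
    ⟨l ^ (1 / 4 : ℝ), Real.rpow_pos_of_pos hl _, by
      rw [← Real.rpow_natCast, ← Real.rpow_mul hl.le]; norm_num⟩
  have h1 : (m ^ 4 : ℝ) ^ (-(1 / 4) : ℝ) = m⁻¹ := by
    rw [← Real.rpow_natCast, ← Real.rpow_mul hm.le, ← Real.rpow_neg_one]
    norm_num
  have h2 : √(m ^ 4) = m ^ 2 := by
    rw [show m ^ 4 = (m ^ 2) ^ 2 by ring, Real.sqrt_sq (by positivity)]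
  have h3 : √(1 + 4 * ((1 - (m ^ 4) ^ 2) / (4 * m ^ 4)) ^ 2) = ((m⁻¹) ^ 4 + m ^ 4) / 2 := by
    rw [← Real.sqrt_sq (show 0 ≤ ((m⁻¹) ^ 4 + m ^ 4) / 2 by positivity)]
    congr 1
    field_simp
    ring
  have h4 : √((1 + ((m⁻¹) ^ 4 + m ^ 4) / 2) / 2) = ((m⁻¹) ^ 2 + m ^ 2) / 2 := by
    rw [← Real.sqrt_sq (show 0 ≤ ((m⁻¹) ^ 2 + m ^ 2) / 2 by positivity)]
    congr 1
    field_simp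
    ring
  have h5 : √((1 + ((m⁻¹) ^ 2 + m ^ 2) / 2) / 2) = (m⁻¹ + m) / 2 := by
    rw [← Real.sqrt_sq (show 0 ≤ (m⁻¹ + m) / 2 by positivity)]
    congr 1
    field_simp
    ring
  rw [h1, h2, h3, h4, h5]
  field_simp
  ring

end Potentials

/-! ### From the manifold to a chart, and the comparison of the two potentials. -/

namespace StaticAF

variable {Vt : Type*} [TopologicalSpace Vt] [ChartedSpace (EuclideanSpace ℝ (Fin 3)) Vt]
  [IsManifold (𝓡 3) ∞ Vt] (S : StaticAF Vt)

/-! ### The data in a chart -/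

theorem Ω_nonneg (p : Vt) : 0 ≤ S.Ω p := by
  by_cases hp : p = S.Λ
  · rw [hp, S.Ω_zero]
  · exact (S.Ω_pos p hp).le

variable {S} {e : OpenPartialHomeomorph Vt (EuclideanSpace ℝ (Fin 3))}

theorem contDiffOn_comp_symm (he : e ∈ IsManifold.maximalAtlas (𝓡 3) ∞ Vt) {f : Vt → ℝ}
    (hf : ContMDiff (𝓡 3) 𝓘(ℝ, ℝ) ∞ f) : ContDiffOn ℝ ∞ (f ∘ e.symm) e.target :=
  contMDiffOn_iff_contDiffOn.mp
    (hf.comp_contMDiffOn (contMDiffOn_symm_of_mem_maximalAtlas he))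

theorem symm_ne_Λ {x : EuclideanSpace ℝ (Fin 3)}
    (hx : x ∈ e.target \ {e S.Λ}) : e.symm x ≠ S.Λ := fun h =>
  hx.2 (by rw [Set.mem_singleton_iff, ← h, e.right_inv hx.1])

theorem contDiffOn_lam (he : e ∈ IsManifold.maximalAtlas (𝓡 3) ∞ Vt) :
    ContDiffOn ℝ ∞ (S.lam ∘ e.symm) (e.target \ {e S.Λ}) :=
  contMDiffOn_iff_contDiffOn.mp (S.lam_smooth.comp
    ((contMDiffOn_symm_of_mem_maximalAtlas he).mono Set.sdiff_subset) fun _ hx => symm_ne_Λ hx)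

/-- The coordinate fields are smooth sections along the inverse chart; pairing them with the bundle
metric gives smooth components. -/
theorem contMDiffOn_coordinateVector (he : e ∈ IsManifold.maximalAtlas (𝓡 3) ∞ Vt) (i : Fin 3) :
    ContMDiffOn (𝓡 3) (𝓡 3).tangent ∞ (fun x => (⟨e.symm x, mfderiv (𝓡 3) (𝓡 3) e.symm x
      (EuclideanSpace.single i (1 : ℝ) : EuclideanSpace ℝ (Fin 3))⟩ : TangentBundle (𝓡 3) Vt))
      e.target := by
  have h1 := (contMDiffOn_symm_of_mem_maximalAtlas he).contMDiffOn_tangentMapWithin (m := ∞)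
    (by simp) e.open_target.uniqueMDiffOn
  have h2 : ContMDiffOn (𝓡 3) (𝓡 3).tangent ∞ (fun x : EuclideanSpace ℝ (Fin 3) =>
      (⟨x, (EuclideanSpace.single i (1 : ℝ) : EuclideanSpace ℝ (Fin 3))⟩ :
        TangentBundle (𝓡 3) (EuclideanSpace ℝ (Fin 3)))) e.target := fun x _ =>
    (contMDiffAt_vectorSpace_iff_contDiffAt.mpr contDiffAt_const).contMDiffWithinAt
  refine (h1.comp h2 fun x hx => hx).congr fun x hx => ?_
  simp only [Function.comp_apply, tangentMapWithin, mfderivWithin_of_isOpen e.open_target hx]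

theorem contDiffOn_htChart (he : e ∈ IsManifold.maximalAtlas (𝓡 3) ∞ Vt) (i j : Fin 3) :
    ContDiffOn ℝ ∞ (fun x => S.htChart e x i j) e.target := by
  rw [← contMDiffOn_iff_contDiffOn]
  intro x hx
  have h : ContMDiffWithinAt (𝓡 3) ((𝓡 3).prod 𝓘(ℝ)) ∞ (fun x =>
      Bundle.TotalSpace.mk' ℝ (E := Bundle.Trivial Vt ℝ) (e.symm x) (S.ht.inner (e.symm x)
        (mfderiv (𝓡 3) (𝓡 3) e.symm x (EuclideanSpace.single i (1 : ℝ) : EuclideanSpace ℝ (Fin 3)))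
        (mfderiv (𝓡 3) (𝓡 3) e.symm x
          (EuclideanSpace.single j (1 : ℝ) : EuclideanSpace ℝ (Fin 3))))) e.target x := by
    apply ContMDiffWithinAt.clm_bundle_apply₂ (F₁ := EuclideanSpace ℝ (Fin 3))
      (F₂ := EuclideanSpace ℝ (Fin 3))
    · exact ContMDiffAt.comp_contMDiffWithinAt x S.ht.contMDiff.contMDiffAt
        (contMDiffOn_symm_of_mem_maximalAtlas he x hx)
    · exact contMDiffOn_coordinateVector he i x hx
    · exact contMDiffOn_coordinateVector he j x hx
  simp only [Bundle.contMDiffWithinAt_totalSpace] at h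
  exact h.2

theorem isSmoothMetricOn_htChart (he : e ∈ IsManifold.maximalAtlas (𝓡 3) ∞ Vt) :
    IsSmoothMetricOn (S.htChart e) e.target where
  isOpen := e.open_target
  smooth := contDiffOn_htChart he
  posDef x hx := by
    set A : EuclideanSpace ℝ (Fin 3) →L[ℝ] TangentSpace (𝓡 3) (e.symm x) :=
      mfderiv (𝓡 3) (𝓡 3) e.symm x with hA
    have hdiff : e.MDifferentiable (𝓡 3) (𝓡 3) :=
      ⟨(contMDiffOn_of_mem_maximalAtlas he).mdifferentiableOn (by simp),
        (contMDiffOn_symm_of_mem_maximalAtlas he).mdifferentiableOn (by simp)⟩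
    have : IsManifold (𝓡 3) 1 Vt := IsManifold.of_le (n := ∞) (by simp)
    -- The differential of a chart inverse is injective, so positivity of the metric on tangent
    -- vectors passes to its matrix.
    have hinj : Function.Injective A := hdiff.symm.mfderiv_injective hx
    refine Matrix.PosDef.of_dotProduct_mulVec_pos ?_ fun v hv => ?_
    · ext i j
      exact S.ht.symm _ _ _
    · have hw : A (WithLp.toLp 2 v) ≠ 0 := fun h => hv (by
        have h0 := hinj (h.trans (map_zero A).symm)
        funext i
        exact congrArg (fun w : EuclideanSpace ℝ (Fin 3) => w i) h0)
      refine (S.ht.pos (e.symm x) _ hw).trans_eq ?_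
      have hsum : A (WithLp.toLp 2 v) = ∑ i, v i • A (EuclideanSpace.single i 1) := by
        conv_lhs => rw [← sum_smul_single (WithLp.toLp 2 v)]
        rw [map_sum]
        exact Finset.sum_congr rfl fun i _ => map_smul A _ _
      rw [hsum]
      simp only [map_sum, map_smul, sum_apply, smul_apply, smul_eq_mul, dotProduct, Matrix.mulVec,
        star_trivial, Finset.mul_sum]
      rw [Finset.sum_comm]
      refine Finset.sum_congr rfl fun i _ => Finset.sum_congr rfl fun j _ => ?_
      change _ = v i * (S.ht.inner (e.symm x) (A _) (A _) * v j)
      ring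

theorem chartComponents_h (e : OpenPartialHomeomorph Vt (EuclideanSpace ℝ (Fin 3))) :
    chartComponents S.h e = fun x => ((S.Ω ∘ e.symm) x ^ 2)⁻¹ • S.htChart e x := rfl

theorem memIdeal_htChart (hvac : S.IsVacuum) {φ : Vt → ℝ} (hφ : S.IsRescaled S.geroch φ)
    (he : e ∈ IsManifold.maximalAtlas (𝓡 3) ∞ Vt) :
    MemIdeal e.target (fun p => (S.Ω ∘ e.symm) p.1) (diffForm (S.Ω ∘ e.symm))
      (metricForm (S.htChart e)) (spray (S.htChart e) (diffForm (S.Ω ∘ e.symm))) := by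
  refine memIdeal_spray_diffForm (isSmoothMetricOn_htChart he) (x₀ := e S.Λ) (contDiffOn_lam he)
    (fun x hx => S.lam_pos _ (symm_ne_Λ hx)) (contDiffOn_comp_symm he S.Ω_smooth)
    (fun x hx => S.Ω_pos _ (symm_ne_Λ hx)) (fun x _ => S.Ω_nonneg _)
    (contDiffOn_comp_symm he hφ.1) (fun x hx => hφ.2 _ (symm_ne_Λ hx)) fun y hy i j => ?_
  rw [← chartComponents_h]
  exact hvac e he y (spaceProj y) (fun _ => rfl) hy.1 (symm_ne_Λ hy) i.succ j.succ

/-! ### Comparison of the rescaled potentials -/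

/-- Although `φ_G` contains `√Ω`, the correction factor depends on `φ_G² = Ω φ²` only, which is
smooth at `Λ`; it is nonnegative, so the root is taken of a positive quantity. -/
theorem isRescaled_hansen_of_geroch {φ : Vt → ℝ} (hφ : S.IsRescaled S.geroch φ) :
    S.IsRescaled S.hansen fun p => φ p *
      (√(1 + 1 / 4 * (S.Ω p * φ p ^ 2)) * (1 + 1 / 2 * (S.Ω p * φ p ^ 2))) := by
  have hw : ContMDiff (𝓡 3) 𝓘(ℝ, ℝ) ∞ fun p => S.Ω p * φ p ^ 2 := S.Ω_smooth.mul (hφ.1.pow 2)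
  refine ⟨hφ.1.mul fun p => ?_, fun p hp => ?_⟩
  · have hnn : 0 ≤ S.Ω p * φ p ^ 2 := mul_nonneg (S.Ω_nonneg p) (sq_nonneg _)
    have hA : ContDiffAt ℝ ∞ (fun w : ℝ => √(1 + 1 / 4 * w) * (1 + 1 / 2 * w))
        (S.Ω p * φ p ^ 2) :=
      ((contDiffAt_const.add (contDiffAt_const.mul contDiffAt_id)).sqrt (by positivity)).mul
        (contDiffAt_const.add (contDiffAt_const.mul contDiffAt_id))
    exact hA.contMDiffAt.comp p hw.contMDiffAt
  · have hΩ := S.Ω_pos p hp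
    have hsq : S.Ω p * φ p ^ 2 = S.geroch p ^ 2 := by
      rw [hφ.2 p hp, div_pow, Real.sq_sqrt hΩ.le, mul_div_cancel₀ _ hΩ.ne']
    simp only [hsq]
    rw [hφ.2 p hp, hansen, hansen_eq_of_geroch (S.lam_pos p hp), geroch]
    ring

/-- Again the factor depends smoothly on `φ_H² = Ω φ²`, and its denominator never vanishes. -/
theorem isRescaled_geroch_of_hansen {φ : Vt → ℝ} (hφ : S.IsRescaled S.hansen φ) :
    S.IsRescaled S.geroch fun p => φ p / (√((1 + √(1 + 4 * (S.Ω p * φ p ^ 2))) / 2) *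
      √((1 + √((1 + √(1 + 4 * (S.Ω p * φ p ^ 2))) / 2)) / 2)) := by
  have hw : ContMDiff (𝓡 3) 𝓘(ℝ, ℝ) ∞ fun p => S.Ω p * φ p ^ 2 := S.Ω_smooth.mul (hφ.1.pow 2)
  refine ⟨?_, fun p hp => ?_⟩
  · simp only [div_eq_mul_inv (φ _)]
    refine hφ.1.mul fun p => ?_
    have hnn : 0 ≤ S.Ω p * φ p ^ 2 := mul_nonneg (S.Ω_nonneg p) (sq_nonneg _)
    have h1 : ContDiffAt ℝ ∞ (fun w : ℝ => √((1 + √(1 + 4 * w)) / 2)) (S.Ω p * φ p ^ 2) :=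
      ((contDiffAt_const.add ((contDiffAt_const.add (contDiffAt_const.mul contDiffAt_id)).sqrt
        (by positivity))).div_const 2).sqrt (by positivity)
    have hA : ContDiffAt ℝ ∞ (fun w : ℝ => (√((1 + √(1 + 4 * w)) / 2) *
        √((1 + √((1 + √(1 + 4 * w)) / 2)) / 2))⁻¹) (S.Ω p * φ p ^ 2) :=
      (h1.mul (((contDiffAt_const.add h1).div_const 2).sqrt (by positivity))).inv (by positivity)
    have h2 := ContMDiffAt.comp p (f := fun p => S.Ω p * φ p ^ 2) hA.contMDiffAt hw.contMDiffAt
    exact h2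
  · have hΩ := S.Ω_pos p hp
    have hsq : S.Ω p * φ p ^ 2 = S.hansen p ^ 2 := by
      rw [hφ.2 p hp, div_pow, Real.sq_sqrt hΩ.le, mul_div_cancel₀ _ hΩ.ne']
    simp only [hsq]
    rw [hφ.2 p hp, geroch, geroch_eq_of_hansen (S.lam_pos p hp), hansen, div_right_comm]

theorem moment_eq (hvac : S.IsVacuum) {φ ψ : Vt → ℝ} (hφ : S.IsRescaled S.hansen φ)
    (hψ : S.IsRescaled S.geroch ψ) (he : e ∈ IsManifold.maximalAtlas (𝓡 3) ∞ Vt)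
    (hΛ : S.Λ ∈ e.source) (n : ℕ) : S.moment φ e n = S.moment ψ e n := by
  have hx₀ : e S.Λ ∈ e.target := e.map_source hΛ
  have hψ' := isRescaled_hansen_of_geroch hψ
  have hsφ := contDiffOn_comp_symm he hφ.1
  have hsψ := contDiffOn_comp_symm he hψ.1
  have hsΩ := contDiffOn_comp_symm he S.Ω_smooth
  -- A rescaled potential is prescribed off `Λ` only; continuity gives the relation at `Λ` as well.
  have heq : ∀ x ∈ e.target, φ (e.symm x) = ψ (e.symm x) *
      (√(1 + 1 / 4 * (S.Ω (e.symm x) * ψ (e.symm x) ^ 2)) *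
        (1 + 1 / 2 * (S.Ω (e.symm x) * ψ (e.symm x) ^ 2))) := by
    have hoff : ∀ x ∈ e.target, x ≠ e S.Λ → φ (e.symm x) = ψ (e.symm x) *
        (√(1 + 1 / 4 * (S.Ω (e.symm x) * ψ (e.symm x) ^ 2)) *
          (1 + 1 / 2 * (S.Ω (e.symm x) * ψ (e.symm x) ^ 2))) := fun x hx hne => by
      have h := symm_ne_Λ (S := S) (e := e) ⟨hx, hne⟩
      exact (hφ.2 _ h).trans (hψ'.2 _ h).symm
    intro x hx
    by_cases hne : x = e S.Λ
    · subst hne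
      exact eq_of_eqOn_punctured e.open_target hx hsφ.continuousOn
        (contDiffOn_comp_symm he hψ'.1).continuousOn hoff
    · exact hoff x hx hne
  have hw : ContDiffOn ℝ ∞ (fun x => (S.Ω ∘ e.symm) x * (ψ ∘ e.symm) x ^ 2) e.target :=
    hsΩ.mul (hsψ.pow 2)
  have hnn : ∀ x, 0 ≤ (S.Ω ∘ e.symm) x * (ψ ∘ e.symm) x ^ 2 := fun x =>
    mul_nonneg (S.Ω_nonneg _) (sq_nonneg _)
  have hroot : ContDiffOn ℝ ∞
      (fun x => √(1 + 1 / 4 * ((S.Ω ∘ e.symm) x * (ψ ∘ e.symm) x ^ 2))) e.target :=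
    (contDiffOn_const.add (contDiffOn_const.mul hw)).sqrt fun x _ => by
      have := hnn x
      positivity
  refine multipoleTensor_eq_of_memIdeal (isSmoothMetricOn_htChart he) hsΩ
    -- With `w = Ω ψ²` and `r = √(1 + w/4)` the difference of the potentials is `ψ (r (1 + w/2) -
    -- 1)`. Since `r - 1 = (w/4) / (r + 1)`, a factor `w` splits off without division by `w`, and `ψ
    -- w = Ω ψ³`.
    (f := fun x => (ψ ∘ e.symm) x ^ 3 * (1 / 4 * (1 + 1 / 2 * ((S.Ω ∘ e.symm) x *
      (ψ ∘ e.symm) x ^ 2)) / (√(1 + 1 / 4 * ((S.Ω ∘ e.symm) x * (ψ ∘ e.symm) x ^ 2)) + 1) + 1 / 2))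
    ?_ hsφ hsψ (fun x hx => ?_) (memIdeal_htChart hvac hψ he) hx₀ ?_ (S.Ω_grad e he hΛ) n
  · refine (hsψ.pow 3).mul (((contDiffOn_const.mul (contDiffOn_const.add
      (contDiffOn_const.mul hw))).div (hroot.add contDiffOn_const) fun x _ => ?_).add
      contDiffOn_const)
    positivity
  · rw [Function.comp_apply, heq x hx]
    have h1 := hnn x
    simp only [Function.comp_apply] at h1 ⊢
    set w := S.Ω (e.symm x) * ψ (e.symm x) ^ 2 with hw_def
    have h2 : √(1 + 1 / 4 * w) ^ 2 = 1 + 1 / 4 * w := Real.sq_sqrt (by positivity)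
    have h3 : √(1 + 1 / 4 * w) + 1 ≠ 0 := by positivity
    set r := √(1 + 1 / 4 * w)
    have h4 : 1 / 4 * (1 + 1 / 2 * w) / (r + 1) * w = (1 + 1 / 2 * w) * (r - 1) := by
      rw [div_mul_eq_mul_div, div_eq_iff h3]
      linear_combination -(1 + 1 / 2 * w) * h2
    linear_combination -ψ (e.symm x) * h4 +
      ψ (e.symm x) * (1 / 4 * (1 + 1 / 2 * w) / (r + 1) + 1 / 2) * hw_def
  · simp [e.left_inv hΛ, S.Ω_zero]

end StaticAF

end Multipole

end

/-! ### Equivalence of the two extendability conditions and equality of the moments. -/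

theorem mainTheorem5 {Vt : Type*} [TopologicalSpace Vt]
    [ChartedSpace (EuclideanSpace ℝ (Fin 3)) Vt] [IsManifold (𝓡 3) ∞ Vt]
    (S : Multipole.StaticAF Vt) (hvac : S.IsVacuum) (haxi : S.IsAxisymmetric) :
    ((∃ φH, S.IsRescaled S.hansen φH) ↔ ∃ φG, S.IsRescaled S.geroch φG) ∧
    ∀ φH φG : Vt → ℝ, S.IsRescaled S.hansen φH → S.IsRescaled S.geroch φG →
      ∀ e ∈ IsManifold.maximalAtlas (𝓡 3) ∞ Vt, S.Λ ∈ e.source →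
        ∀ n : ℕ, S.moment φH e n = S.moment φG e n := by
  refine ⟨⟨fun ⟨_, hφ⟩ => ⟨_, Multipole.StaticAF.isRescaled_geroch_of_hansen hφ⟩,
    fun ⟨_, hφ⟩ => ⟨_, Multipole.StaticAF.isRescaled_hansen_of_geroch hφ⟩⟩, ?_⟩
  intro φH φG hφH hφG e he hΛ n
  exact Multipole.StaticAF.moment_eq hvac hφH hφG he hΛ n
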